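/- **Setting.** Write $[r,\theta]=r\,e^{2\pi i\theta/7}\in\mathbb C$ and let $p_k=[1,k]$, $k\in\mathbb Z/7$, be the seventh roots of unity. Let $S=S_{0,7}=(\mathbb C\cup\{\infty\})\setminus\{p_0,\dots,p_6\}$ (the doubled heptagon: the unit disc is the front heptagon, its exterior the back one). Let $\rho(z)=p_3z$ (rotation by three clicks, i.e. by $6\pi/7$, counterclockwise). Let $a$ and $b$ be the left half-twists that exchange $p_0,p_1$ and $p_1,p_2$, respectively: with $m$ the midpoint of the two punctures, the circle of radius $s$ about $m$ is rotated by the angle $-\pi\cdot\max(0,\min(1,3-4s))$. Put $\tau=a^{-1}\circ b$ and $\varphi_n=\tau^n\circ\rho$ for $n\ge 1$. Let $(r_i)_{i\ge1}$ be natural numbers with $r_1=1$, $r_2=2$ and $r_{i+1}-r_i$ strictly increasing in $i$, and put $\Phi_i=\varphi_{r_1}\circ\dots\circ\varphi_{r_i}$. Let $\gamma_0$ be the simple closed curve $s\mapsto[\,1-\tfrac12\sin^2(2\pi s)+\tfrac25\sin(2\pi s),\ 1+\tfrac54\cos(2\pi s)\,]$, $0\le s\le1$, which bounds a disc containing exactly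 the punctures $p_0$ and $p_2$ and passing $p_1$ on the front side; put $\gamma_i=\Phi_i(\gamma_0)$. **The track $T$.** $T$ is the union of sixteen branches, parametrized by $0\le t\le1$, with the seven switches $[\tfrac9{10},k]$. There are seven loops around the punctures, $t\mapsto[\,\tfrac9{10}+\tfrac45t(1-t),\ k+8t^2(1-t)^2(1-2t)\,]$, $k\in\mathbb Z/7$, and nine branches $e_1,\dots,e_9$, $$e_i(t)=\big[\tfrac9{10}-d_i\,t(1-t)+c_i\,t^5(1-t)^3,\ s_i+\delta_i(3t^2-2t^3)\big],$$ with $(s_i)=(3,3,3,2,2,0,0,0,0)$, $(\delta_i)=(3,2,1,-3,3,3,-1,1,2)$, $(d_i)=(2,2,\tfrac25,3,3,2,\tfrac25,\tfrac25,2)$, $c_1=c_6=160$ and all other $c_i=0$. Thus $e_i$ joins the switch at $p_{s_i}$ to the switch at $p_{s_i+\delta_i}$. A (closed) *train path* is a (closed) edge path in $T$ that at each switch arrives and leaves in the same direction. For a homeomorphism $\varphi$ of $S$, *$\varphi(T)$ is carried by $T$* if there is a continuous map $f:S\to S$, homotopic to the identity, such that $f\circ\varphi$ sends each branch of $T$,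 up to reparametrization, to a train path of $T$ and takes train paths to train paths; $T$ is then called *$\varphi$-invariant*. A closed curve $\gamma$ is *carried by $T$* if there is a continuous $f:S\to S$, homotopic to the identity, such that $f\circ\gamma$ is, up to reparametrization, a closed train path; its weight on a branch is the number of passes over that branch. A *transverse measure* on $T$ is a non-negative weight $\mu$ on the branches such that at each switch the sums over the two sides agree; $w_i(\mu)$ is the weight of $e_i$. If $\varphi(T)$ is carried by $T$, the induced action on transverse measures is $(\varphi_*\mu)(b)=\sum_{b'}n_{bb'}\,\mu(b')$, where $n_{bb'}$ is the number of times that the image of $b'$ passes over $b$. Let $$A=\left(\begin{smallmatrix}1&0&0&0&0&0&0&0&0\\0&1&0&0&0&0&0&0&0\\0&0&1&0&0&0&0&0&0\\0&0&0&1&0&0&0&0&0\\0&0&0&0&1&0&0&0&0\\0&0&0&0&0&1&0&0&0\\0&0&0&0&0&0&1&0&0\\0&0&0&0&0&1&1&1&1\\0&0&0&1&1&2&0&1&2\end{smallmatrix}\right),\qquad M=\left(\begin{smallmatrix}0&0&0&0&0&1&0&0&0\\0&0&0&0&0&0&0&0&1\\0&0&0&0&0&0&0&1&0\\0&1&0&0&0&0&0&0&0\\0&0&0&1&1&0&0&0&0\\0&0&0&0&0&0&1&0&0\\1&0&1&0&0&0&0&0&0\\0&0&1&0&0&0&0&0&0\\0&0&0&1&0&0&0&0&0\end{smallmatrix}\right).$$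 **Proposition.** 1. $T$ is an embedded smooth 1-complex in $S$: its branches are smooth with non-vanishing velocity, their interiors are embedded and disjoint from each other and from the switches, and at each switch all branches are tangent to one line, with branches leaving in both directions. For each $v\in\mathbb R_{\ge0}^9$ there is exactly one transverse measure $\mu$ on $T$ with $(w_1(\mu),\dots,w_9(\mu))=v$. 2. $T$ is $\tau$-invariant and $(\tau\circ\rho)$-invariant, for carrying maps whose action on $(w_1,\dots,w_9)^t$ is given by the matrix $A$ for $\tau$ and by the matrix $M$ for $\tau\circ\rho$. 3. Hence $T$ is $\varphi_n$-invariant for each $n\ge1$, with matrix $A^{n-1}M$. 4. $T$ carries $\gamma_0$, with $(w_1,\dots,w_9)^t=2v_0$, where $v_0=(0,0,0,0,0,0,0,0,1)^t$. Hence, for each sequence $(r_i)$ as above and each $i\ge0$, $T$ carries $\gamma_i$, with $(w_1,\dots,w_9)^t=2\,A^{r_1-1}M\,A^{r_2-1}M\cdots A^{r_i-1}M\,v_0$. -/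

import Mathlib

open scoped unitInterval Matrix

namespace SevenPuncturedSphere

/-! ### The seven-times punctured sphere -/

/-- The point of the plane with modulus `r` and argument `θ · 2π/7`
(angles are measured in sevenths of a full turn). -/
noncomputable def polar (r θ : ℝ) : ℂ :=
  (r : ℂ) * Complex.exp ((2 * Real.pi * θ / 7 : ℝ) * Complex.I)

/-- The punctures `p_0, …, p_6`: the seventh roots of unity, in counterclockwise order. -/
noncomputable def puncture (k : ZMod 7) : ℂ := polar 1 (k.val : ℝ)

/-- The seven-times punctured sphere `S_{0,7}`: the Riemann sphere minus the seventh roots of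
unity. The closed unit disc and the closure of its exterior are the two copies of the heptagon,
glued along the unit circle; the punctures are the vertices. -/
abbrev S : Type := {x : OnePoint ℂ // ∀ k : ZMod 7, x ≠ ((puncture k : ℂ) : OnePoint ℂ)}

theorem norm_polar {r : ℝ} (hr : 0 ≤ r) (θ : ℝ) : ‖polar r θ‖ = r := by
  rw [polar, norm_mul, Complex.norm_exp_ofReal_mul_I, mul_one, Complex.norm_real,
    Real.norm_of_nonneg hr]

theorem polar_add (r θ : ℝ) (n : ℤ) : polar r (θ + 7 * n) = polar r θ := by
  unfold polar
  congr 1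
  rw [Complex.exp_eq_exp_iff_exists_int]
  exact ⟨n, by push_cast; ring⟩

/-- A point in polar form is a puncture only if its modulus is `1` and its angle is an integer. -/
theorem eq_int_of_polar_eq_puncture {r θ : ℝ} (hr : 0 ≤ r) {k : ZMod 7}
    (h : polar r θ = puncture k) : r = 1 ∧ ∃ n : ℤ, θ = n := by
  have h1 : r = 1 := by
    have := congrArg norm h
    rwa [puncture, norm_polar hr, norm_polar zero_le_one] at this
  refine ⟨h1, ?_⟩
  subst h1
  unfold puncture polar at h
  have h2 := mul_left_cancel₀ (by simp) h
  rw [Complex.exp_eq_exp_iff_exists_int] at h2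
  obtain ⟨n, hn⟩ := h2
  have h3 : ((2 * Real.pi * θ / 7 : ℝ) : ℂ) =
      ((2 * Real.pi * (k.val : ℝ) / 7 + n * (2 * Real.pi) : ℝ) : ℂ) := by
    apply mul_right_cancel₀ Complex.I_ne_zero
    rw [hn]; push_cast; ring
  have h4 := Complex.ofReal_injective h3
  refine ⟨k.val + 7 * n, ?_⟩
  have hpi := Real.pi_pos
  push_cast
  field_simp at h4
  linarith

theorem puncture_add (j k : ZMod 7) : puncture (j + k) = puncture j * puncture k := by
  have key : ∀ j k : ZMod 7, (j + k).val = j.val + k.val ∨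
      (j + k).val + 7 = j.val + k.val := by decide
  have h1 : puncture j * puncture k = polar 1 ((j.val : ℝ) + k.val) := by
    unfold puncture polar
    simp only [Complex.ofReal_one, one_mul]
    rw [← Complex.exp_add]
    congr 1
    push_cast; ring
  rw [h1]
  rcases key j k with h | h
  · rw [puncture, h]; push_cast; rfl
  · have h2 : ((j.val : ℝ) + k.val) = ((j + k).val : ℝ) + 7 * ((1 : ℤ) : ℝ) := by
      rw [← Nat.cast_add, ← h]; push_cast; ring
    rw [h2, polar_add, puncture]

theorem puncture_zero : puncture 0 = 1 := by
  simp [puncture, polar]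

theorem norm_puncture (k : ZMod 7) : ‖puncture k‖ = 1 := norm_polar zero_le_one _

theorem puncture_ne_zero (k : ZMod 7) : puncture k ≠ 0 := by
  rw [← norm_ne_zero_iff, norm_puncture]; exact one_ne_zero

/-! ### The homeomorphisms `ρ`, `τ` and `φ_n` -/

/-- A homeomorphism of the plane that permutes the punctures, extended by `∞ ↦ ∞` and
restricted to `S`. -/
noncomputable def liftHomeo (h : ℂ ≃ₜ ℂ) (e : Equiv.Perm (ZMod 7))
    (he : ∀ k, h (puncture k) = puncture (e k)) : S ≃ₜ S :=
  h.onePointCongr.subtype fun x => by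
    have hp : ∀ k, h.onePointCongr ((puncture k : ℂ) : OnePoint ℂ) =
        ((puncture (e k) : ℂ) : OnePoint ℂ) := fun k => by
      rw [← he k]; rfl
    constructor
    · intro hx k hk
      apply hx (e.symm k)
      apply h.onePointCongr.injective
      rw [hk, hp, Equiv.apply_symm_apply]
    · intro hx k hk
      exact hx (e k) (by rw [hk, hp])

/-- The rotation of the doubled heptagon by three clicks counterclockwise. -/
noncomputable def rho : S ≃ₜ S :=
  liftHomeo (Homeomorph.mulLeft₀ (puncture 3) (puncture_ne_zero 3)) (Equiv.addLeft 3) fun k => by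
    rw [Homeomorph.coe_mulLeft₀, Equiv.coe_addLeft, puncture_add]

/-- The homeomorphism of the plane that turns each circle of radius `s` about `c` by the
angle `θ s`. -/
noncomputable def twist (c : ℂ) (θ : ℝ → ℝ) (hθ : Continuous θ) : ℂ ≃ₜ ℂ where
  toFun z := c + (z - c) * Complex.exp ((θ ‖z - c‖ : ℝ) * Complex.I)
  invFun z := c + (z - c) * Complex.exp ((-θ ‖z - c‖ : ℝ) * Complex.I)
  left_inv z := by
    simp only [add_sub_cancel_left, norm_mul, Complex.norm_exp_ofReal_mul_I, mul_one]
    rw [mul_assoc, ← Complex.exp_add]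
    push_cast
    simp
  right_inv z := by
    simp only [add_sub_cancel_left, norm_mul, Complex.norm_exp_ofReal_mul_I, mul_one]
    rw [mul_assoc, ← Complex.exp_add]
    push_cast
    simp
  continuous_toFun := by fun_prop
  continuous_invFun := by fun_prop

/-- The turning angle of a left half-twist: `-π` up to radius `1/2`, and `0` from radius `3/4`. -/
noncomputable def halfTwistAngle (s : ℝ) : ℝ := -Real.pi * max 0 (min 1 (3 - 4 * s))

theorem continuous_halfTwistAngle : Continuous halfTwistAngle := by
  unfold halfTwistAngle; fun_prop

/-- The midpoint of the segment between the adjacent punctures `p_k` and `p_{k+1}`. -/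
noncomputable def midpt (k : ZMod 7) : ℂ := (puncture k + puncture (k + 1)) / 2

theorem sub_midpt (j k : ZMod 7) :
    puncture j - midpt k = puncture k * (puncture (j - k) - midpt 0) := by
  have h1 : puncture j = puncture k * puncture (j - k) := by
    rw [← puncture_add]; congr 1; ring
  rw [h1, midpt, midpt, puncture_add, zero_add, puncture_zero]; ring

theorem normSq_sub_midpt (j : ZMod 7) :
    ‖puncture j - midpt 0‖ ^ 2 = 3 / 2 + Real.cos (2 * Real.pi / 7) / 2 -
      Real.cos (2 * Real.pi * j.val / 7) - Real.cos (2 * Real.pi * (j.val - 1) / 7) := by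
  have hp : ∀ θ : ℝ, polar 1 θ =
      (Real.cos (2 * Real.pi * θ / 7) : ℂ) + (Real.sin (2 * Real.pi * θ / 7) : ℂ) * Complex.I := by
    intro θ
    rw [polar, Complex.exp_mul_I, Complex.ofReal_one, one_mul, Complex.ofReal_cos,
      Complex.ofReal_sin]
  have h1 : puncture j - midpt 0 =
      ((Real.cos (2 * Real.pi * j.val / 7) - (1 + Real.cos (2 * Real.pi / 7)) / 2 : ℝ) : ℂ) +
      ((Real.sin (2 * Real.pi * j.val / 7) - Real.sin (2 * Real.pi / 7) / 2 : ℝ) : ℂ) *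
        Complex.I := by
    have h2 : ((1 : ZMod 7).val : ℝ) = 1 := by
      have : (1 : ZMod 7).val = 1 := by decide
      rw [this]; norm_num
    rw [midpt, zero_add, puncture_zero, puncture, puncture, hp, hp, h2, mul_one]
    push_cast; ring
  rw [h1, Complex.sq_norm, Complex.normSq_add_mul_I]
  have h3 : Real.cos (2 * Real.pi * (j.val - 1) / 7) =
      Real.cos (2 * Real.pi * j.val / 7) * Real.cos (2 * Real.pi / 7) +
      Real.sin (2 * Real.pi * j.val / 7) * Real.sin (2 * Real.pi / 7) := by
    rw [← Real.cos_sub]; congr 1; ring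
  rw [h3]
  have e1 := Real.sin_sq_add_cos_sq (2 * Real.pi * j.val / 7)
  have e2 := Real.sin_sq_add_cos_sq (2 * Real.pi / 7)
  nlinarith

theorem half_le_cos : 1 / 2 ≤ Real.cos (2 * Real.pi / 7) := by
  rw [← Real.cos_pi_div_three]
  have := Real.pi_pos
  apply Real.cos_le_cos_of_nonneg_of_le_pi <;> linarith

theorem norm_sub_midpt_le (k : ZMod 7) : ‖puncture k - midpt k‖ ≤ 1 / 2 := by
  rw [sub_midpt, norm_mul, norm_puncture, one_mul, sub_self]
  have h := normSq_sub_midpt 0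
  have h0 : ((0 : ZMod 7).val : ℝ) = 0 := by simp
  rw [h0] at h
  have h1 : Real.cos (2 * Real.pi * (0 - 1) / 7) = Real.cos (2 * Real.pi / 7) := by
    rw [← Real.cos_neg]; congr 1; ring
  rw [h1, mul_zero, zero_div, Real.cos_zero] at h
  have := half_le_cos
  nlinarith [norm_nonneg (puncture 0 - midpt 0)]

theorem le_norm_sub_midpt {j k : ZMod 7} (h0 : j ≠ k) (h1 : j ≠ k + 1) :
    3 / 4 ≤ ‖puncture j - midpt k‖ := by
  rw [sub_midpt, norm_mul, norm_puncture, one_mul]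
  have hj0 : j - k ≠ 0 := sub_ne_zero.mpr h0
  have hj1 : j - k ≠ 1 := fun h => h1 (by rw [← h]; ring)
  generalize j - k = i at hj0 hj1
  have h := normSq_sub_midpt i
  have hpi := Real.pi_pos
  have c1 : Real.cos (2 * Real.pi / 7) ≤ 1 := Real.cos_le_one _
  have c2 : Real.cos (4 * Real.pi / 7) ≤ 0 :=
    Real.cos_nonpos_of_pi_div_two_le_of_le (by linarith) (by linarith)
  have c3 : Real.cos (6 * Real.pi / 7) ≤ 0 :=
    Real.cos_nonpos_of_pi_div_two_le_of_le (by linarith) (by linarith)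
  have c1' := half_le_cos
  have hr : ∀ x y : ℝ, x + y = 2 * Real.pi → Real.cos x = Real.cos y := by
    intro x y hxy
    have : x = 2 * Real.pi - y := by linarith
    rw [this, Real.cos_two_pi_sub]
  have hn := norm_nonneg (puncture i - midpt 0)
  have key : ∀ i : ZMod 7, i ≠ 0 → i ≠ 1 →
      i.val = 2 ∨ i.val = 3 ∨ i.val = 4 ∨ i.val = 5 ∨ i.val = 6 := by decide
  suffices h9 : 9 / 16 ≤ ‖puncture i - midpt 0‖ ^ 2 by nlinarith
  rw [h]
  rcases key i hj0 hj1 with hv | hv | hv | hv | hv <;> rw [hv] <;> push_cast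
  · rw [show 2 * Real.pi * 2 / 7 = 4 * Real.pi / 7 by ring,
      show 2 * Real.pi * (2 - 1) / 7 = 2 * Real.pi / 7 by ring]
    linarith
  · rw [show 2 * Real.pi * 3 / 7 = 6 * Real.pi / 7 by ring,
      show 2 * Real.pi * (3 - 1) / 7 = 4 * Real.pi / 7 by ring]
    linarith
  · rw [hr (2 * Real.pi * 4 / 7) (6 * Real.pi / 7) (by ring),
      show 2 * Real.pi * (4 - 1) / 7 = 6 * Real.pi / 7 by ring]
    linarith
  · rw [hr (2 * Real.pi * 5 / 7) (4 * Real.pi / 7) (by ring),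
      hr (2 * Real.pi * (5 - 1) / 7) (6 * Real.pi / 7) (by ring)]
    linarith
  · rw [hr (2 * Real.pi * 6 / 7) (2 * Real.pi / 7) (by ring),
      hr (2 * Real.pi * (6 - 1) / 7) (4 * Real.pi / 7) (by ring)]
    linarith

theorem twist_of_le {c z : ℂ} (hz : ‖z - c‖ ≤ 1 / 2) :
    twist c halfTwistAngle continuous_halfTwistAngle z = 2 * c - z := by
  have h : halfTwistAngle ‖z - c‖ = -Real.pi := by
    rw [halfTwistAngle, min_eq_left (by linarith), max_eq_right zero_le_one, mul_one]
  change c + (z - c) * Complex.exp ((halfTwistAngle ‖z - c‖ : ℝ) * Complex.I) = _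
  rw [h]
  push_cast
  rw [neg_mul, Complex.exp_neg, Complex.exp_pi_mul_I]
  ring

theorem twist_of_ge {c z : ℂ} (hz : 3 / 4 ≤ ‖z - c‖) :
    twist c halfTwistAngle continuous_halfTwistAngle z = z := by
  have h : halfTwistAngle ‖z - c‖ = 0 := by
    rw [halfTwistAngle, min_eq_right (by linarith), max_eq_left (by linarith), mul_zero]
  change c + (z - c) * Complex.exp ((halfTwistAngle ‖z - c‖ : ℝ) * Complex.I) = _
  rw [h]
  simp

/-- The left half-twist that exchanges the adjacent punctures `p_k` and `p_{k+1}`. It is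
supported in the disc of radius `3/4` about their midpoint, which contains no other puncture. -/
noncomputable def halfTwist (k : ZMod 7) : S ≃ₜ S :=
  liftHomeo (twist (midpt k) halfTwistAngle continuous_halfTwistAngle) (Equiv.swap k (k + 1))
    fun j => by
      by_cases h0 : j = k
      · subst h0
        rw [Equiv.swap_apply_left, twist_of_le (norm_sub_midpt_le j), midpt]; ring
      by_cases h1 : j = k + 1
      · have h2 : puncture j - midpt k = -(puncture k - midpt k) := by
          rw [h1, midpt]; ring
        rw [twist_of_le (by rw [h2, norm_neg]; exact norm_sub_midpt_le k), h1,
          Equiv.swap_apply_right, midpt]; ring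
      · rw [Equiv.swap_apply_of_ne_of_ne h0 h1, twist_of_ge (le_norm_sub_midpt h0 h1)]

/-- The partial pseudo-Anosov map `τ = a⁻¹ ∘ b`, where `a` and `b` are the half-twists
exchanging `p_0, p_1` and `p_1, p_2`. (The product of `S ≃ₜ S` is composition.) -/
noncomputable def tau : S ≃ₜ S := (halfTwist 0)⁻¹ * halfTwist 1

/-- `φ_n = τⁿ ∘ ρ`. -/
noncomputable def phi (n : ℕ) : S ≃ₜ S := tau ^ n * rho

/-- `Φ_i = φ_{r_1} ∘ φ_{r_2} ∘ ⋯ ∘ φ_{r_i}`. -/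
noncomputable def Phi (r : ℕ → ℕ) : ℕ → (S ≃ₜ S)
  | 0 => 1
  | i + 1 => Phi r i * phi (r (i + 1))

/-! ### The train track `T` -/

/-- The branches of `T`: a loop around each of the seven punctures, and nine further branches;
`Sum.inr 0, …, Sum.inr 8` are the nine chosen branches, with the weights `w_1, …, w_9`. -/
abbrev Branch : Type := ZMod 7 ⊕ Fin 9

/-- The `i`-th of the nine branches starts at the switch next to the puncture `p_k` with
`k = start i`, … -/
def start : Fin 9 → ℕ := ![3, 3, 3, 2, 2, 0, 0, 0, 0]

/-- … and turns about the origin by `shift i` sevenths of a full turn, so that it ends at the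
switch next to the puncture `p_k` with `k ≡ start i + shift i` modulo `7`. -/
def shift : Fin 9 → ℤ := ![3, 2, 1, -3, 3, 3, -1, 1, 2]

/-- How far a branch dips towards the origin. -/
noncomputable def dip : Fin 9 → ℝ := ![2, 2, 2 / 5, 3, 3, 2, 2 / 5, 2 / 5, 2]

/-- The branches `1` and `6` leave the unit disc to pass around a puncture on the outer side. -/
noncomputable def bulge : Fin 9 → ℝ := ![160, 0, 0, 0, 0, 160, 0, 0, 0]

/-- The modulus of the point with parameter `t ∈ [0, 1]` of a branch. -/
noncomputable def modulus : Branch → ℝ → ℝ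
  | Sum.inl _, t => 9 / 10 + 4 / 5 * (t * (1 - t))
  | Sum.inr i, t => 9 / 10 - dip i * (t * (1 - t)) + bulge i * (t ^ 5 * (1 - t) ^ 3)

/-- The angle (in sevenths of a full turn) of the point with parameter `t ∈ [0, 1]`. -/
noncomputable def angle : Branch → ℝ → ℝ
  | Sum.inl k, t => (k.val : ℝ) + 8 * ((t * (1 - t)) ^ 2 * (1 - 2 * t))
  | Sum.inr i, t => (start i : ℝ) + (shift i : ℝ) * (3 * t ^ 2 - 2 * t ^ 3)

/-- The parametrization of a branch of `T`, over `0 ≤ t ≤ 1`. -/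
noncomputable def curve (b : Branch) (t : ℝ) : ℂ := polar (modulus b t) (angle b t)

theorem curve_eq_polar (b : Branch) (t : ℝ) : curve b t = polar (modulus b t) (angle b t) := rfl

theorem continuous_polar {X : Type*} [TopologicalSpace X] {r θ : X → ℝ} (hr : Continuous r)
    (hθ : Continuous θ) : Continuous fun x => polar (r x) (θ x) := by
  unfold polar; fun_prop

theorem continuous_curve (b : Branch) : Continuous (curve b) := by
  unfold curve
  apply continuous_polar
  · cases b <;> unfold modulus <;> fun_prop
  · cases b <;> unfold angle <;> fun_prop

theorem loop_ne (k : ZMod 7) {t : ℝ} (h0 : 0 ≤ t) (h1 : t ≤ 1) (j : ZMod 7) :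
    curve (Sum.inl k) t ≠ puncture j := by
  intro h
  have hs : 0 ≤ t * (1 - t) := mul_nonneg h0 (by linarith)
  obtain ⟨hr, n, hn⟩ := eq_int_of_polar_eq_puncture (by simp only [modulus]; linarith) h
  simp only [modulus] at hr
  simp only [angle] at hn
  have hs' : t * (1 - t) = 1 / 8 := by linarith
  rw [hs'] at hn
  have hsq : (1 - 2 * t) ^ 2 = 1 / 2 := by nlinarith
  have hd : ((8 * (n - k.val) : ℤ) : ℝ) = 1 - 2 * t := by push_cast; linarith
  have hd2 : ((2 * (8 * (n - k.val)) ^ 2 : ℤ) : ℝ) = ((1 : ℤ) : ℝ) := by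
    push_cast at hd ⊢; rw [hd, hsq]; norm_num
  have hd3 : 2 * (8 * (n - k.val)) ^ 2 = 1 := by exact_mod_cast hd2
  omega

theorem simple_ne {b : Branch} {t d : ℝ} (h0 : 0 ≤ t) (h1 : t ≤ 1) (hd : 0 ≤ d) (hd' : d ≤ 3)
    (hm : modulus b t = 9 / 10 - d * (t * (1 - t))) (j : ZMod 7) : curve b t ≠ puncture j := by
  intro h
  have hs : 0 ≤ t * (1 - t) := mul_nonneg h0 (by linarith)
  have hs' : t * (1 - t) ≤ 1 / 4 := by nlinarith [sq_nonneg (1 - 2 * t)]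
  have hds : d * (t * (1 - t)) ≤ 3 * (1 / 4) := mul_le_mul hd' hs' hs (by norm_num)
  obtain ⟨hr, -⟩ := eq_int_of_polar_eq_puncture (by rw [hm]; linarith) h
  rw [hm] at hr
  nlinarith [mul_nonneg hd hs]

theorem bulging_ne {b : Branch} {t c : ℝ} (h0 : 0 ≤ t) (h1 : t ≤ 1) (hc : ∃ n : ℤ, c = n)
    (hm : modulus b t = 9 / 10 - 2 * (t * (1 - t)) + 160 * (t ^ 5 * (1 - t) ^ 3))
    (ha : angle b t = c + 3 * (3 * t ^ 2 - 2 * t ^ 3)) (j : ZMod 7) : curve b t ≠ puncture j := by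
  intro h
  have hu : 0 ≤ 1 - t := by linarith
  have hs : 0 ≤ t * (1 - t) := mul_nonneg h0 hu
  have hs' : t * (1 - t) ≤ 1 / 4 := by nlinarith [sq_nonneg (1 - 2 * t)]
  have hb : 0 ≤ t ^ 5 * (1 - t) ^ 3 := by positivity
  obtain ⟨hr, n, hn⟩ := eq_int_of_polar_eq_puncture (by rw [hm]; linarith) h
  rw [hm] at hr
  rw [ha] at hn
  obtain ⟨m, rfl⟩ := hc
  have hq : ((n - m : ℤ) : ℝ) = 9 * t ^ 2 - 6 * t ^ 3 := by push_cast; linarith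
  generalize n - m = q at hq
  have q0 : 0 ≤ q := by
    have : (0 : ℝ) ≤ q := by rw [hq]; nlinarith [mul_nonneg h0 h0, mul_nonneg (mul_nonneg h0 h0) hu]
    exact_mod_cast this
  have q3 : q ≤ 3 := by
    have : (q : ℝ) ≤ 3 := by
      rw [hq]; nlinarith [mul_nonneg (mul_nonneg hu hu) h0, mul_nonneg hu hu]
    exact_mod_cast this
  have mono : ∀ x y : ℝ, 0 ≤ x → x ≤ y → y ≤ 1 → 9 * x ^ 2 - 6 * x ^ 3 ≤ 9 * y ^ 2 - 6 * y ^ 3 := by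
    intro x y hx hxy hy
    have e2 : 0 ≤ (y - x) * (9 * (x + y) - 6 * (x ^ 2 + x * y + y ^ 2)) := by
      apply mul_nonneg (by linarith)
      nlinarith [mul_nonneg hx (sub_nonneg.2 (hxy.trans hy)), mul_nonneg (hx.trans hxy) (sub_nonneg.2 hy),
        mul_nonneg hx (sub_nonneg.2 hy)]
    nlinarith
  interval_cases q
  · have ht : t = 0 := by
      by_contra hne
      have : 0 < t := lt_of_le_of_ne h0 (Ne.symm hne)
      norm_num at hq
      nlinarith [mul_pos this this, mul_nonneg (mul_nonneg h0 h0) hu]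
    rw [ht] at hr; norm_num at hr
  · norm_num at hq
    have ht1 : 19 / 50 ≤ t := by
      by_contra hlt
      have := mono t (19 / 50) h0 (by linarith) (by norm_num)
      norm_num at this; linarith
    have ht2 : t ≤ 39 / 100 := by
      by_contra hlt
      have := mono (39 / 100) t (by norm_num) (by linarith) h1
      norm_num at this; linarith
    have hA : t ^ 5 ≤ (39 / 100) ^ 5 := pow_le_pow_left₀ h0 ht2 5
    have hB : (1 - t) ^ 3 ≤ (62 / 100) ^ 3 := pow_le_pow_left₀ hu (by linarith) 3
    have hAB := mul_le_mul hA hB (by positivity) (by positivity)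
    have hC : 47 / 200 ≤ t * (1 - t) := by nlinarith
    norm_num at hAB
    nlinarith
  · norm_num at hq
    have ht1 : 61 / 100 ≤ t := by
      by_contra hlt
      have := mono t (61 / 100) h0 (by linarith) (by norm_num)
      norm_num at this; linarith
    have ht2 : t ≤ 62 / 100 := by
      by_contra hlt
      have := mono (62 / 100) t (by norm_num) (by linarith) h1
      norm_num at this; linarith
    have hA : (61 / 100) ^ 5 ≤ t ^ 5 := pow_le_pow_left₀ (by norm_num) ht1 5
    have hB : (38 / 100) ^ 3 ≤ (1 - t) ^ 3 := pow_le_pow_left₀ (by norm_num) (by linarith) 3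
    have hAB := mul_le_mul hA hB (by positivity) (by positivity)
    norm_num at hAB
    nlinarith
  · have ht : t = 1 := by
      by_contra hne
      have : 0 < 1 - t := sub_pos.2 (lt_of_le_of_ne h1 hne)
      norm_num at hq
      nlinarith [mul_pos this this, mul_nonneg (mul_nonneg hu hu) h0]
    rw [ht] at hr; norm_num at hr

/-- The branches of `T` avoid the punctures. -/
theorem curve_ne_puncture (b : Branch) {t : ℝ} (h0 : 0 ≤ t) (h1 : t ≤ 1) (j : ZMod 7) :
    curve b t ≠ puncture j := by
  rcases b with k | i
  · exact loop_ne k h0 h1 j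
  · fin_cases i
    · exact bulging_ne (c := 3) h0 h1 ⟨3, by norm_num⟩ (by simp [modulus, dip, bulge])
        (by simp [angle, start, shift]) j
    · exact simple_ne (d := 2) h0 h1 (by norm_num) (by norm_num) (by simp [modulus, dip, bulge]) j
    · exact simple_ne (d := 2 / 5) h0 h1 (by norm_num) (by norm_num)
        (by simp [modulus, dip, bulge]) j
    · exact simple_ne (d := 3) h0 h1 (by norm_num) (by norm_num) (by simp [modulus, dip, bulge]) j
    · exact simple_ne (d := 3) h0 h1 (by norm_num) (by norm_num) (by simp [modulus, dip, bulge]) j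
    · exact bulging_ne (c := 0) h0 h1 ⟨0, by norm_num⟩ (by simp [modulus, dip, bulge])
        (by simp [angle, start, shift]) j
    · exact simple_ne (d := 2 / 5) h0 h1 (by norm_num) (by norm_num)
        (by simp [modulus, dip, bulge]) j
    · exact simple_ne (d := 2 / 5) h0 h1 (by norm_num) (by norm_num)
        (by simp [modulus, dip, bulge]) j
    · exact simple_ne (d := 2) h0 h1 (by norm_num) (by norm_num) (by simp [modulus, dip, bulge]) j

/-- A path in the plane that avoids the punctures, as a path in `S`. -/
def pathInS (c : ℝ → ℂ) (hc : Continuous c) (h : ∀ t : I, ∀ k, c t ≠ puncture k) : C(I, S) where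
  toFun t := ⟨((c t : ℂ) : OnePoint ℂ), fun k hk => h t k (OnePoint.coe_injective hk)⟩
  continuous_toFun := Continuous.subtype_mk
    (OnePoint.continuous_coe.comp (hc.comp continuous_subtype_val)) _

/-- A branch together with a direction: `true` means the direction of its parametrization. -/
abbrev OBranch : Type := Branch × Bool

/-- The parametrized oriented branch, as a path in `S`. -/
noncomputable def branchPath (x : OBranch) : C(I, S) :=
  let p := pathInS (curve x.1) (continuous_curve x.1)
    fun t => curve_ne_puncture x.1 t.2.1 t.2.2
  if x.2 then p else p.comp ⟨unitInterval.symm, unitInterval.continuous_symm⟩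

/-- The same branch with the opposite direction. -/
def OBranch.rev (x : OBranch) : OBranch := (x.1, !x.2)

/-- The initial point (a switch of `T`) of an oriented branch. -/
noncomputable def initPt (x : OBranch) : ℂ := if x.2 then curve x.1 0 else curve x.1 1

/-- The initial velocity of an oriented branch. -/
noncomputable def initVel (x : OBranch) : ℂ :=
  if x.2 then deriv (curve x.1) 0 else -deriv (curve x.1) 1

/-- `T` is a smooth 1-complex embedded in the plane: the branches are smooth with non-vanishing
velocity, their interiors are embedded and disjoint from each other and from the switches, and at
each switch all branches are tangent to one line, with branches leaving in both directions. -/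
def IsEmbeddedTrack : Prop :=
  (∀ b, ContDiff ℝ (⊤ : ℕ∞) (curve b)) ∧
  (∀ b, ∀ t ∈ Set.Icc (0 : ℝ) 1, deriv (curve b) t ≠ 0) ∧
  (∀ b b', ∀ t ∈ Set.Ioo (0 : ℝ) 1, ∀ t' ∈ Set.Icc (0 : ℝ) 1,
    curve b t = curve b' t' → b = b' ∧ t = t') ∧
  (∀ x y, initPt x = initPt y →
    SameRay ℝ (initVel x) (initVel y) ∨ SameRay ℝ (initVel x) (-initVel y)) ∧
  (∀ x, ∃ y, initPt y = initPt x ∧ SameRay ℝ (initVel y) (-initVel x))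

/-- The oriented branch `y` continues `x` smoothly: it starts at the switch where `x` ends, in the
direction in which `x` arrives. -/
def Continues (x y : OBranch) : Prop :=
  initPt x.rev = initPt y ∧ SameRay ℝ (-initVel x.rev) (initVel y)

/-- Train paths: smooth edge paths in `T`. -/
def IsTrainPath (l : List OBranch) : Prop := l ≠ [] ∧ l.IsChain Continues

/-- Closed train paths: smooth closed edge paths in `T`. -/
def IsClosedTrainPath (l : List OBranch) : Prop :=
  l ≠ [] ∧ Cycle.Chain Continues (l : Cycle OBranch)

/-- The path `p` in `S` runs exactly through the oriented branches in the list `l`, one after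
another, up to a strictly increasing reparametrization `θ` of `[0, 1]` onto `[0, length l]`. -/
def Follows (p : I → S) (l : List OBranch) : Prop :=
  ∃ θ : I → ℝ, Continuous θ ∧ StrictMono θ ∧ θ 0 = 0 ∧ θ 1 = l.length ∧
    ∀ (t : I) (i : Fin l.length), (i : ℝ) ≤ θ t → θ t ≤ (i : ℝ) + 1 →
      p t = branchPath (l.get i) (Set.projIcc 0 1 zero_le_one (θ t - (i : ℝ)))

/-- How often the edge path `l` passes over the branch `b`, in either direction. -/
def passes (l : List OBranch) (b : Branch) : ℕ := (l.map Prod.fst).count b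

/-! ### Carrying and transverse weights -/

/-- A carrying map for `φ(T)`: a continuous map `f : S → S` homotopic to the identity that takes
`φ(T)` into `T`, sending each branch, and hence each smooth path, of `φ(T)` to a smooth path
in `T` without backtracking. -/
structure CarryingMap (φ : S ≃ₜ S) where
  /-- the map -/
  f : C(S, S)
  homotopic : f.Homotopic (ContinuousMap.id S)
  /-- the edge path that is the image of a branch of `φ(T)` -/
  image : OBranch → List OBranch
  follows : ∀ x, Follows (fun t => f (φ (branchPath x t))) (image x)
  smooth : ∀ l, IsTrainPath l → IsTrainPath (l.flatMap image)

open Classical in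
/-- Transverse measures on `T`: non-negative weights on the branches such that at each switch
the sums over the two sides agree. -/
def IsTransverse (μ : Branch → ℝ) : Prop :=
  (∀ b, 0 ≤ μ b) ∧ ∀ x : OBranch,
    ∑ y : OBranch with initPt y = initPt x ∧ SameRay ℝ (initVel y) (initVel x), μ y.1 =
    ∑ y : OBranch with initPt y = initPt x ∧ SameRay ℝ (initVel y) (-initVel x), μ y.1

/-- The weights `w_1, …, w_9`. -/
def w (μ : Branch → ℝ) : Fin 9 → ℝ := fun i => μ (Sum.inr i)

/-- The action on weights: a measured lamination carried by `T` with weights `μ` is taken by `φ` to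
one that is carried by `φ(T)`, hence by `T`, with these weights. -/
def CarryingMap.push {φ : S ≃ₜ S} (c : CarryingMap φ) (μ : Branch → ℝ) : Branch → ℝ :=
  fun b => ∑ b' : Branch, (passes (c.image (b', true)) b : ℝ) * μ b'

/-- `T` is invariant under `φ`, that is, `φ(T)` is carried by `T`, and the action of `φ` on the
weights `w_1, …, w_9` is given by the matrix `N`. -/
def InvariantWithMatrix (φ : S ≃ₜ S) (N : Matrix (Fin 9) (Fin 9) ℝ) : Prop :=
  ∃ c : CarryingMap φ, ∀ μ, IsTransverse μ → IsTransverse (c.push μ) ∧ w (c.push μ) = N *ᵥ w μ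

/-- The closed curve `γ` is carried by `T`, with the weights `v` on the nine chosen branches. -/
def CarriedWithWeights (γ : I → S) (v : Fin 9 → ℝ) : Prop :=
  ∃ f : C(S, S), f.Homotopic (ContinuousMap.id S) ∧ ∃ l : List OBranch,
    IsClosedTrainPath l ∧ Follows (fun t => f (γ t)) l ∧
    ∀ i, (passes l (Sum.inr i) : ℝ) = v i

/-! ### The gamma sequence and the matrices -/

/-- The modulus of the point of `γ_0` with parameter `s`. -/
noncomputable def gammaModulus (s : ℝ) : ℝ :=
  1 - 1 / 2 * Real.sin (2 * Real.pi * s) ^ 2 + 2 / 5 * Real.sin (2 * Real.pi * s)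

/-- The angle (in sevenths of a full turn) of the point of `γ_0` with parameter `s`. -/
noncomputable def gammaAngle (s : ℝ) : ℝ := 1 + 5 / 4 * Real.cos (2 * Real.pi * s)

theorem gamma_ne (s : ℝ) (k : ZMod 7) : polar (gammaModulus s) (gammaAngle s) ≠ puncture k := by
  intro h
  have h1 := Real.sin_sq_add_cos_sq (2 * Real.pi * s)
  have hs := Real.neg_one_le_sin (2 * Real.pi * s)
  have hs' := Real.sin_le_one (2 * Real.pi * s)
  have hpos : 0 ≤ gammaModulus s := by
    unfold gammaModulus; nlinarith
  obtain ⟨hr, n, hn⟩ := eq_int_of_polar_eq_puncture hpos h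
  unfold gammaModulus at hr
  unfold gammaAngle at hn
  set x := Real.sin (2 * Real.pi * s)
  set y := Real.cos (2 * Real.pi * s)
  have hx : x * (5 * x - 4) = 0 := by linarith [sq x]
  have hy : ((25 * y ^ 2 : ℝ)) = ((16 * (n - 1) ^ 2 : ℤ) : ℝ) := by
    have : y = 4 / 5 * ((n : ℝ) - 1) := by linarith
    rw [this]; push_cast; ring
  rcases mul_eq_zero.mp hx with h0 | h0
  · have h2 : ((16 * (n - 1) ^ 2 : ℤ) : ℝ) = ((25 : ℤ) : ℝ) := by
      rw [← hy]; push_cast; rw [h0] at h1; linarith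
    have h3 : 16 * (n - 1) ^ 2 = 25 := by exact_mod_cast h2
    omega
  · have hx' : x = 4 / 5 := by linarith
    have h2 : ((16 * (n - 1) ^ 2 : ℤ) : ℝ) = ((9 : ℤ) : ℝ) := by
      rw [← hy]; push_cast; rw [hx'] at h1; linarith
    have h3 : 16 * (n - 1) ^ 2 = 9 := by exact_mod_cast h2
    omega

theorem continuous_gamma : Continuous fun s => polar (gammaModulus s) (gammaAngle s) := by
  apply continuous_polar
  · unfold gammaModulus; fun_prop
  · unfold gammaAngle; fun_prop

/-- The curve `γ_0`. It bounds a disc with the two punctures `p_0` and `p_2`, which crosses the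
front heptagon (the unit disc) next to `p_1`, and leaves `p_1` outside. -/
noncomputable def gammaZero : C(I, S) :=
  pathInS (fun s => polar (gammaModulus s) (gammaAngle s)) continuous_gamma
    fun s k => gamma_ne s k

/-- `γ_i = Φ_i(γ_0)`. -/
noncomputable def gamma (r : ℕ → ℕ) (i : ℕ) : I → S := fun s => Phi r i (gammaZero s)

/-- The matrix `A`. -/
def matA : Matrix (Fin 9) (Fin 9) ℝ :=
  !![1, 0, 0, 0, 0, 0, 0, 0, 0;
     0, 1, 0, 0, 0, 0, 0, 0, 0;
     0, 0, 1, 0, 0, 0, 0, 0, 0;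
     0, 0, 0, 1, 0, 0, 0, 0, 0;
     0, 0, 0, 0, 1, 0, 0, 0, 0;
     0, 0, 0, 0, 0, 1, 0, 0, 0;
     0, 0, 0, 0, 0, 0, 1, 0, 0;
     0, 0, 0, 0, 0, 1, 1, 1, 1;
     0, 0, 0, 1, 1, 2, 0, 1, 2]

/-- The matrix `M`. -/
def matM : Matrix (Fin 9) (Fin 9) ℝ :=
  !![0, 0, 0, 0, 0, 1, 0, 0, 0;
     0, 0, 0, 0, 0, 0, 0, 0, 1;
     0, 0, 0, 0, 0, 0, 0, 1, 0;
     0, 1, 0, 0, 0, 0, 0, 0, 0;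
     0, 0, 0, 1, 1, 0, 0, 0, 0;
     0, 0, 0, 0, 0, 0, 1, 0, 0;
     1, 0, 1, 0, 0, 0, 0, 0, 0;
     0, 0, 1, 0, 0, 0, 0, 0, 0;
     0, 0, 0, 1, 0, 0, 0, 0, 0]

/-- The vectors `v_0 = (0, …, 0, 1)` and `v_i = A^(r_1 - 1) M ⋯ A^(r_i - 1) M v_0`. -/
def vec (r : ℕ → ℕ) (i : ℕ) : Fin 9 → ℝ :=
  ((List.range i).map fun j => matA ^ (r (j + 1) - 1) * matM).prod *ᵥ Pi.single 8 1

end SevenPuncturedSphere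

/-!
The homotopy part of the statement is reduced to words in a fundamental groupoid. By Borsuk's
homotopy extension property, which holds for maps of `S` to itself because `S` is homeomorphic to an
open subset of the plane, a map `φ` can be changed by a homotopy on the embedded graph `T`: if on
each branch the path `φ(e)` is homotopic to an edge path, by a homotopy that moves its ends along
tracks that depend only on the switches, then `φ` is homotopic to a map `G` that sends the branches
to these edge paths (`exists_homotopic_eq_on_graph`). The carrying map is `f = G ∘ φ⁻¹`
(`EdgeMap.stronglyInvariant`).

The homotopies are found in the fundamental groupoid of `S` with the two base points `0` and `∞`.
The plane without the seven rays `{r p_k | r ≥ 1}` (the front) is star-shaped, and so is its image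
under `z ↦ 1 / z` (the back). So a path that runs alternately in the front and in the back is
determined, up to homotopy, by the sectors between two punctures in which it changes sides, and the
groupoid is generated by the classes `arc k : 0 → ∞` of the paths that change sides between `p_k` and
`p_{k+1}`. The rotation takes `arc j` to `arc (j + 3)`, and the half-twist that exchanges `p_k` and
`p_{k+1}` takes `arc k` to `arc (k + 1) ≫ inv (arc k) ≫ arc (k - 1)` and fixes all other arcs
(`push_halfTwist`). Each branch of `T`, closed up by radii from `0` to the switches, is a word in the
arcs (`cls_edge`), and invariance under `τ` and `τ ∘ ρ` is a comparison of sixteen words for each of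
the two maps (`stronglyInvariant_tau`, `stronglyInvariant_tau_mul_rho`). The same comparison for
`γ_0` shows that it is carried by `T` (`carried_gammaZero`). Smoothness of the image paths, the
switch conditions and the entries of the matrices are finite checks on the edge paths.

Carrying maps compose: if `f₁` carries `φ₁(T)` and `f₂` carries `φ₂(T)`, then `f₁ ∘ φ₁ ∘ f₂ ∘ φ₁⁻¹`
carries `φ₁φ₂(T)`, the edge paths are substituted into each other (`Follows.flatMap`), and the
matrices are multiplied. As the loops are taken to loops, the matrices describe the action on all
weights, and hence also the number of passes of a curve; this gives the statements on `φ_n` and `γ_i`.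

That `T` is embedded (`isEmbeddedTrack`) is elementary: two branches meet in points with the same
angle and the same modulus, and estimates for each pair of branches with overlapping angular
intervals show that this happens only at the ends.
-/

namespace SevenPuncturedSphere

open Topology Filter

/-- Borsuk's homotopy extension property for maps into a space that is homeomorphic to an open
subset of the plane: a homotopy, defined on a closed set, of the restriction of a map `ψ` extends
to a homotopy of `ψ`. -/
theorem exists_homotopy_extension {X Y : Type*} [TopologicalSpace X] [TopologicalSpace Y]
    [NormalSpace X] [NormalSpace (X × I)] {m : Y → ℂ} (hm : IsOpenEmbedding m) {A : Set X}
    (hA : IsClosed A) (ψ : C(X, Y)) (h : C(A × I, Y)) (h0 : ∀ a : A, h (a, 0) = ψ a) :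
    ∃ G : C(X, Y), G.Homotopic ψ ∧ ∀ a : A, G a = h (a, 1) := by
  have he : IsClosedEmbedding (Prod.map ((↑) : A → X) (id : I → I)) :=
    hA.isClosedEmbedding_subtypeVal.prodMap .id
  obtain ⟨F₀, hF₀⟩ := ContinuousMap.exists_extension' he
    ((⟨m, hm.continuous⟩ : C(Y, ℂ)).comp h)
  have hF₀' : ∀ (a : A) (t : I), F₀ (a, t) = m (h (a, t)) := fun a t => congrFun hF₀ (a, t)
  -- Correcting the extension so that it starts at `ψ` does not change it over `A`.
  let F : X × I → ℂ := fun x => F₀ x - F₀ (x.1, 0) + m (ψ x.1)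
  have hmc := hm.continuous
  have hF : Continuous F := by fun_prop
  have F_zero : ∀ x, F (x, 0) = m (ψ x) := fun x => by simp [F]
  have F_mem : ∀ (a : A) (t : I), F (a, t) = m (h (a, t)) := fun a t => by
    simp [F, hF₀', h0]
  have hO : IsOpen (F ⁻¹' Set.range m) := hm.isOpen_range.preimage hF
  let N : Set X := {x | ∀ t : I, F (x, t) ∈ Set.range m}
  have hN : IsOpen N := by
    rw [isOpen_iff_forall_mem_open]
    intro x hx
    obtain ⟨U, V, hU, -, hxU, hV, hUV⟩ := generalized_tube_lemma (isCompact_singleton (x := x))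
      (isCompact_univ (X := I)) hO (by rintro ⟨y, t⟩ ⟨rfl, -⟩; exact hx t)
    exact ⟨U, fun y hy t => hUV ⟨hy, hV trivial⟩, hU, hxU rfl⟩
  have hAN : A ⊆ N := fun a ha t => ⟨_, (F_mem ⟨a, ha⟩ t).symm⟩
  obtain ⟨u, hu0, hu1, hu⟩ := exists_continuous_zero_one_of_isClosed hN.isClosed_compl hA
    (Set.disjoint_left.2 fun x hx hxA => hx (hAN hxA))
  let v : I × X → I := fun x => x.1 * ⟨u x.2, hu x.2⟩
  have hv : Continuous v := by
    refine Continuous.mul continuous_fst (Continuous.subtype_mk ?_ _)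
    exact u.continuous.comp continuous_snd
  have key : ∀ x : I × X, F (x.2, v x) ∈ Set.range m := by
    rintro ⟨s, x⟩
    by_cases hx : x ∈ N
    · exact hx _
    · have hvx : v (s, x) = 0 := by
        have h1 : (⟨u x, hu x⟩ : I) = 0 := Subtype.ext (hu0 hx)
        simp only [v, h1, mul_zero]
      rw [hvx, F_zero]
      exact ⟨_, rfl⟩
  choose K hK using key
  have hKc : Continuous K := by
    rw [hm.isInducing.continuous_iff]
    have : m ∘ K = fun x => F (x.2, v x) := funext hK
    rw [this]
    fun_prop
  refine ⟨⟨fun x => K (1, x), by fun_prop⟩, ⟨ContinuousMap.Homotopy.symm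
    { toFun := K, continuous_toFun := hKc, map_zero_left := fun x => ?_,
      map_one_left := fun x => rfl }⟩, fun a => ?_⟩
  · apply hm.injective
    have hv0 : v (0, x) = 0 := by simp [v]
    rw [hK, hv0, F_zero]
  · apply hm.injective
    have h1 : (⟨u a, hu a⟩ : I) = 1 := Subtype.ext (hu1 a.2)
    have hv1 : v (1, (a : X)) = 1 := by simp only [v, h1, mul_one]
    change m (K (1, a)) = _
    rw [hK, hv1, F_mem]

/-- The homotopy extension property for a homotopy of `ψ ∘ q`, where `q` parametrizes a compact
subset by a compact space. -/
theorem exists_extension_of_compact {Q X Y : Type*} [TopologicalSpace Q] [CompactSpace Q]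
    [TopologicalSpace X] [T2Space X] [TopologicalSpace Y] [NormalSpace X] [NormalSpace (X × I)]
    {m : Y → ℂ} (hm : IsOpenEmbedding m) (q : C(Q, X)) (ψ : C(X, Y)) (H : C(Q × I, Y))
    (h0 : ∀ x, H (x, 0) = ψ (q x)) (hc : ∀ x y, q x = q y → ∀ t, H (x, t) = H (y, t)) :
    ∃ G : C(X, Y), G.Homotopic ψ ∧ ∀ x, G (q x) = H (x, 1) := by
  have hA : IsClosed (Set.range q) := (isCompact_range q.continuous).isClosed
  let p : C(Q × I, Set.range q × I) :=
    ⟨Prod.map (Set.rangeFactorization q) id, by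
      refine Continuous.prodMap ?_ continuous_id
      exact q.continuous.subtype_mk _⟩
  have hp : IsQuotientMap p := by
    refine IsClosedMap.isQuotientMap p.continuous.isClosedMap p.continuous ?_
    exact Set.rangeFactorization_surjective.prodMap Function.surjective_id
  have hfac : Function.FactorsThrough H p := by
    rintro ⟨x, s⟩ ⟨y, t⟩ hxy
    obtain ⟨h1, h2⟩ := Prod.mk.inj hxy
    have h3 : s = t := h2
    rw [h3]
    exact hc x y (congrArg Subtype.val h1) t
  have hl : ∀ x t, hp.lift H hfac (p (x, t)) = H (x, t) := fun x t =>
    DFunLike.congr_fun (hp.lift_comp H hfac) (x, t)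
  obtain ⟨G, hG, hG'⟩ := exists_homotopy_extension hm hA ψ (hp.lift H hfac) (by
    rintro ⟨_, x, rfl⟩
    exact (hl x 0).trans (h0 x))
  exact ⟨G, hG, fun x => (hG' ⟨q x, x, rfl⟩).trans (hl x 1)⟩

/-! ### The inversion of the Riemann sphere -/

open OnePoint in
/-- The inversion `z ↦ 1 / z` of the Riemann sphere, as a map. -/
noncomputable def invFun : OnePoint ℂ → OnePoint ℂ
  | ∞ => ((0 : ℂ) : OnePoint ℂ)
  | (z : ℂ) => if z = 0 then ∞ else ((z⁻¹ : ℂ) : OnePoint ℂ)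

open OnePoint

theorem invFun_infty : invFun ∞ = ((0 : ℂ) : OnePoint ℂ) := rfl

theorem invFun_zero : invFun ((0 : ℂ) : OnePoint ℂ) = ∞ := if_pos rfl

theorem invFun_coe {z : ℂ} (hz : z ≠ 0) : invFun z = ((z⁻¹ : ℂ) : OnePoint ℂ) := if_neg hz

theorem invFun_invFun (x : OnePoint ℂ) : invFun (invFun x) = x := by
  induction x using OnePoint.rec with
  | infty => rw [invFun_infty, invFun_zero]
  | coe z =>
    by_cases hz : z = 0
    · rw [hz, invFun_zero, invFun_infty]
    · rw [invFun_coe hz, invFun_coe (inv_ne_zero hz), inv_inv]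

theorem continuous_invFun : Continuous invFun := by
  rw [continuous_iff_continuousAt]
  intro x
  induction x using OnePoint.rec with
  | infty =>
    rw [OnePoint.continuousAt_infty', invFun_infty, coclosedCompact_eq_cocompact,
      ← Metric.cobounded_eq_cocompact]
    have h1 : Tendsto (fun z : ℂ => ((z⁻¹ : ℂ) : OnePoint ℂ)) (Bornology.cobounded ℂ)
        (𝓝 ((0 : ℂ) : OnePoint ℂ)) :=
      (OnePoint.continuous_coe.tendsto 0).comp tendsto_inv₀_cobounded
    refine h1.congr' ?_
    filter_upwards [Bornology.eventually_ne_cobounded (0 : ℂ)] with z hz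
    exact (invFun_coe hz).symm
  | coe z =>
    rw [OnePoint.continuousAt_coe]
    by_cases hz : z = 0
    · subst hz
      rw [continuousAt_iff_punctured_nhds]
      change Tendsto _ _ (𝓝 (invFun ((0 : ℂ) : OnePoint ℂ)))
      rw [invFun_zero]
      have h1 : Tendsto (fun z : ℂ => ((z⁻¹ : ℂ) : OnePoint ℂ)) (𝓝[≠] 0) (𝓝 ∞) := by
        refine OnePoint.tendsto_coe_infty.comp ?_
        rw [coclosedCompact_eq_cocompact, ← Metric.cobounded_eq_cocompact]
        exact tendsto_inv₀_nhdsNE_zero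
      refine h1.congr' ?_
      filter_upwards [self_mem_nhdsWithin] with z hz
      exact (invFun_coe hz).symm
    · have h1 : ContinuousAt (fun z : ℂ => ((z⁻¹ : ℂ) : OnePoint ℂ)) z :=
        OnePoint.continuous_coe.continuousAt.comp (continuousAt_inv₀ hz)
      refine h1.congr ?_
      filter_upwards [isOpen_ne.mem_nhds hz] with y hy
      exact (invFun_coe hy).symm

/-- The inversion `z ↦ 1 / z` of the Riemann sphere. -/
noncomputable def inversion : OnePoint ℂ ≃ₜ OnePoint ℂ where
  toFun := invFun
  invFun := invFun
  left_inv := invFun_invFun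
  right_inv := invFun_invFun
  continuous_toFun := continuous_invFun
  continuous_invFun := continuous_invFun

theorem inversion_zero : inversion ((0 : ℂ) : OnePoint ℂ) = ∞ := invFun_zero

theorem inversion_coe {z : ℂ} (hz : z ≠ 0) : inversion z = ((z⁻¹ : ℂ) : OnePoint ℂ) :=
  invFun_coe hz

theorem inversion_inversion (x : OnePoint ℂ) : inversion (inversion x) = x := invFun_invFun x

/-- The open subset of the sphere on which the chart `z ↦ 1 / (z - 1)` is finite contains `S`. -/
theorem exists_isOpenEmbedding : ∃ m : S → ℂ, IsOpenEmbedding m := by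
  let e : OnePoint ℂ ≃ₜ OnePoint ℂ :=
    (Homeomorph.onePointCongr (Homeomorph.addRight (-1 : ℂ))).trans inversion
  have he : ∀ x : S, e x.1 ≠ ∞ := by
    intro x hx
    apply x.2 0
    have h1 : e ((1 : ℂ) : OnePoint ℂ) = ∞ := by
      change inversion ((1 + -1 : ℂ) : OnePoint ℂ) = ∞
      rw [add_neg_cancel, inversion_zero]
    rw [puncture_zero]
    exact e.injective (hx.trans h1.symm)
  choose m hm using fun x => OnePoint.ne_infty_iff_exists.1 (he x)
  have hS : IsOpen {x : OnePoint ℂ | ∀ k : ZMod 7, x ≠ ((puncture k : ℂ) : OnePoint ℂ)} := by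
    have : {x : OnePoint ℂ | ∀ k : ZMod 7, x ≠ ((puncture k : ℂ) : OnePoint ℂ)} =
        ⋂ k : ZMod 7, {((puncture k : ℂ) : OnePoint ℂ)}ᶜ := by ext; simp
    rw [this]
    exact isOpen_iInter_of_finite fun k => isOpen_compl_singleton
  have h1 : IsOpenEmbedding (fun x : S => e x.1) :=
    e.isOpenEmbedding.comp hS.isOpenEmbedding_subtypeVal
  have h2 : (fun x : S => e x.1) = (fun z : ℂ => (z : OnePoint ℂ)) ∘ m :=
    funext fun x => (hm x).symm
  rw [h2] at h1
  exact ⟨m, IsOpenEmbedding.of_comp _ OnePoint.isOpenEmbedding_coe h1⟩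

instance : TopologicalSpace.MetrizableSpace S := by
  obtain ⟨m, hm⟩ := exists_isOpenEmbedding
  exact hm.isEmbedding.metrizableSpace

/-- The homotopy extension property for maps of `S` to itself. -/
theorem exists_extension {Q : Type*} [TopologicalSpace Q] [CompactSpace Q] (q : C(Q, S))
    (ψ : C(S, S)) (H : C(Q × I, S)) (h0 : ∀ x, H (x, 0) = ψ (q x))
    (hc : ∀ x y, q x = q y → ∀ t, H (x, t) = H (y, t)) :
    ∃ G : C(S, S), G.Homotopic ψ ∧ ∀ x, G (q x) = H (x, 1) := by
  obtain ⟨m, hm⟩ := exists_isOpenEmbedding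
  exact exists_extension_of_compact hm q ψ H h0 hc

end SevenPuncturedSphere

namespace SevenPuncturedSphere

/-! ### Moving a graph by a homotopy -/

/-- The point `(1 - t) · s/2 + t · (1 - s/4)` of the unit interval. With `s` running from `0` to
`1`, these affine maps shrink `[0, 1]` to the middle piece `[1/2, 3/4]` of a path that is the
concatenation of three paths. -/
noncomputable def shrink (t s : I) : I :=
  ⟨(1 - t) * (s / 2) + t * (1 - s / 4), by
    have ht := t.2; have hs := s.2
    constructor
    · nlinarith [ht.1, ht.2, hs.1, hs.2]
    · nlinarith [ht.1, ht.2, hs.1, hs.2]⟩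

theorem coe_shrink (t s : I) : (shrink t s : ℝ) = (1 - t) * (s / 2) + t * (1 - s / 4) := rfl

theorem continuous_shrink : Continuous fun x : I × I => shrink x.1 x.2 :=
  Continuous.subtype_mk (by fun_prop) _

section
variable {X : Type*} [TopologicalSpace X] {x y z w : X} (c : Path x y) (p : Path y z)
  (c' : Path w z)

theorem trans_shrink_zero_left (s : I) : (c.trans (p.trans c'.symm)) (shrink 0 s) = c s := by
  have hs := s.2
  rw [Path.trans_apply, dif_pos (by rw [coe_shrink]; simp; linarith [hs.2])]
  congr 1
  ext
  rw [Subtype.coe_mk, coe_shrink]; simp; ring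

theorem trans_shrink_one_left (s : I) : (c.trans (p.trans c'.symm)) (shrink 1 s) = c' s := by
  have hs := s.2
  by_cases h1 : s = 1
  · subst h1
    rw [Path.trans_apply, dif_neg (by rw [coe_shrink]; norm_num), Path.trans_apply,
      dif_pos (by simp only [coe_shrink]; norm_num)]
    have : ∀ u : I, (u : ℝ) = 1 → p u = c' 1 := fun u hu => by
      have : u = 1 := Subtype.ext hu
      rw [this]; simp
    apply this
    simp only [coe_shrink]; norm_num
  · have h2 : (s : ℝ) < 1 := lt_of_le_of_ne hs.2 fun h => h1 (Subtype.ext h)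
    rw [Path.trans_apply, dif_neg (by rw [coe_shrink]; simp; linarith),
      Path.trans_apply, dif_neg (by simp only [coe_shrink]; simp; linarith), Path.symm_apply]
    refine congrArg c' (Subtype.ext ?_)
    simp only [unitInterval.coe_symm_eq, coe_shrink]
    simp; ring

theorem trans_shrink_one_right (t : I) : (c.trans (p.trans c'.symm)) (shrink t 1) = p t := by
  have ht := t.2
  by_cases h0 : t = 0
  · subst h0
    rw [trans_shrink_zero_left]; simp
  · have h2 : 0 < (t : ℝ) := lt_of_le_of_ne ht.1 fun h => h0 (Subtype.ext h.symm)
    rw [Path.trans_apply, dif_neg (by rw [coe_shrink]; simp; linarith),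
      Path.trans_apply, dif_pos (by simp only [coe_shrink]; simp; linarith [ht.2])]
    congr 1
    ext
    simp only [coe_shrink]
    simp; ring

theorem shrink_zero_right (t : I) : shrink t 0 = t := by
  ext; simp [coe_shrink]

end

theorem continuous_of_discrete {E Y Z : Type*} [TopologicalSpace E] [DiscreteTopology E]
    [TopologicalSpace Y] [TopologicalSpace Z] (K : E → C(Y × I, Z)) :
    Continuous fun x : (E × Y) × I => K x.1.1 (x.1.2, x.2) := by
  have h1 : Continuous fun x : E × (Y × I) => K x.1 x.2 :=
    continuous_prod_of_discrete_left.2 fun e => (K e).continuous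
  exact h1.comp (Homeomorph.prodAssoc E Y I).continuous

/-- A map of `S` can be changed by a homotopy so that it takes prescribed values `P` on an embedded
finite graph with vertices `pos v` and edges `p e`, provided that there are tracks `c` for the
vertices along which `P` is homotopic to the given map on each of the edges. -/
theorem exists_homotopic_eq_on_graph {E V : Type*} [Finite E] {pos : V → S} {a b : E → V}
    (p : ∀ e, Path (pos (a e)) (pos (b e)))
    (hp : ∀ e e' t t', p e t = p e' t' → (e = e' ∧ t = t') ∨
      ((t = 0 ∨ t = 1) ∧ (t' = 0 ∨ t' = 1)))
    (hpos : Function.Injective pos) (ψ : C(S, S)) {pos' : V → S}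
    (c : ∀ v, Path (ψ (pos v)) (pos' v)) (P : ∀ e, Path (pos' (a e)) (pos' (b e)))
    (h : ∀ e, ((p e).map ψ.continuous).Homotopic ((c (a e)).trans ((P e).trans (c (b e)).symm))) :
    ∃ G : C(S, S), G.Homotopic ψ ∧ ∀ e t, G (p e t) = P e t := by
  let _ : TopologicalSpace E := ⊥
  have : DiscreteTopology E := ⟨rfl⟩
  let q : C(E × I, S) := ⟨fun x => p x.1 x.2,
    continuous_prod_of_discrete_left.2 fun e => (p e).continuous⟩
  -- A homotopy of the edges that depends only on the vertex at both ends of an edge is compatible.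
  have step : ∀ (ψ : C(S, S)) (K : E → C(I × I, S)) (d : V → I → S),
      (∀ e t, K e (t, 0) = ψ (p e t)) → (∀ e s, K e (0, s) = d (a e) s) →
      (∀ e s, K e (1, s) = d (b e) s) →
      ∃ G : C(S, S), G.Homotopic ψ ∧ ∀ e t, G (p e t) = K e (t, 1) := by
    intro ψ K d h0 ha hb
    obtain ⟨G, hG, hG'⟩ := exists_extension q ψ ⟨_, continuous_of_discrete K⟩
      (fun x => h0 x.1 x.2) (by
        rintro ⟨e, t⟩ ⟨e', t'⟩ hx s
        have hx' : p e t = p e' t' := hx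
        have hend : ∀ e t, (t = 0 ∨ t = 1) → ∃ v, p e t = pos v ∧ ∀ s, K e (t, s) = d v s := by
          rintro e t (rfl | rfl)
          · exact ⟨a e, (p e).source, ha e⟩
          · exact ⟨b e, (p e).target, hb e⟩
        rcases hp e e' t t' hx' with ⟨rfl, rfl⟩ | ⟨ht, ht'⟩
        · rfl
        · obtain ⟨v, hv, hvs⟩ := hend e t ht
          obtain ⟨v', hv', hvs'⟩ := hend e' t' ht'
          have : v = v' := hpos (by rw [← hv, ← hv', hx'])
          subst this
          exact (hvs s).trans (hvs' s).symm)
    exact ⟨G, hG, fun e t => hG' (e, t)⟩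
  let F := fun e => (h e).some
  obtain ⟨G₁, hG₁, hG₁'⟩ := step ψ
    (fun e => ⟨fun x => F e (x.2, x.1), by fun_prop⟩) (fun v _ => ψ (pos v))
    (fun e t => by simp) (fun e s => by simp) (fun e s => by simp)
  obtain ⟨G, hG, hG'⟩ := step G₁
    (fun e => ⟨fun x => ((c (a e)).trans ((P e).trans (c (b e)).symm)) (shrink x.1 x.2), by
      have := continuous_shrink
      fun_prop⟩) (fun v s => c v s)
    (fun e t => by simp [hG₁', shrink_zero_right])
    (fun e s => trans_shrink_zero_left _ _ _ s) (fun e s => trans_shrink_one_left _ _ _ s)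
  exact ⟨G, hG.trans hG₁, fun e t => by
    rw [hG']; exact trans_shrink_one_right _ _ _ t⟩

end SevenPuncturedSphere

namespace SevenPuncturedSphere

open CategoryTheory Topology

/-! ### The fundamental groupoid of `S` -/

/-- Homotopy classes of paths from `x` to `y`, as morphisms of the fundamental groupoid. -/
abbrev Hom (x y : S) : Type := FundamentalGroupoid.mk x ⟶ FundamentalGroupoid.mk y

/-- The homotopy class of a path. -/
noncomputable def cls {x y : S} (p : Path x y) : Hom x y := Path.Homotopic.Quotient.mk p

theorem cls_eq_iff {x y : S} {p q : Path x y} : cls p = cls q ↔ p.Homotopic q :=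
  Path.Homotopic.Quotient.eq

theorem cls_trans {x y z : S} (p : Path x y) (q : Path y z) : cls (p.trans q) = cls p ≫ cls q := rfl

theorem cls_symm {x y : S} (p : Path x y) : cls p.symm = inv (cls p) := by
  rw [← Groupoid.inv_eq_inv]; rfl

theorem exists_cls {x y : S} (γ : Hom x y) : ∃ p : Path x y, cls p = γ :=
  Path.Homotopic.Quotient.mk_surjective γ

/-- The image of a homotopy class under a map `h`; the images of the endpoints are given
explicitly, so that no transport of classes along equalities is needed in computations. -/
noncomputable def push (h : C(S, S)) {x y x' y' : S} (hx : h x = x') (hy : h y = y') (γ : Hom x y) :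
    Hom x' y' :=
  Path.Homotopic.Quotient.cast (Path.Homotopic.Quotient.map γ h) hx.symm hy.symm

section push

variable (h k : C(S, S)) {x y z x' y' z' x'' y'' : S} (hx : h x = x') (hy : h y = y')
  (hz : h z = z')

theorem push_eq_map (γ : Hom x y) : push h rfl rfl γ = (FundamentalGroupoid.map h).map γ :=
  Path.Homotopic.Quotient.cast_rfl_rfl _

theorem push_comp (γ : Hom x y) (δ : Hom y z) :
    push h hx hz (γ ≫ δ) = push h hx hy γ ≫ push h hy hz δ := by
  subst hx hy hz
  have e := push_eq_map h (γ ≫ δ)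
  have e1 := push_eq_map h γ
  have e2 := push_eq_map h δ
  exact e.trans (((FundamentalGroupoid.map h).map_comp γ δ).trans (congrArg₂ (· ≫ ·) e1 e2).symm)

theorem push_id : push h hx hx (𝟙 (FundamentalGroupoid.mk x)) = 𝟙 _ := by
  subst hx
  exact (FundamentalGroupoid.map h).map_id _

theorem push_inv (γ : Hom x y) : push h hy hx (inv γ) = inv (push h hx hy γ) := by
  subst hx hy
  have e := push_eq_map h (inv γ)
  have e1 := push_eq_map h γ
  refine e.trans ((Functor.map_inv (FundamentalGroupoid.map h) γ).trans ?_)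
  congr 1
  exact e1.symm

theorem push_cls {p : Path x y} {q : Path x' y'} (hpq : ∀ t, q t = h (p t)) :
    push h hx hy (cls p) = cls q := by
  subst hx hy
  have : q = p.map h.continuous := by ext t; exact congrArg Subtype.val (hpq t)
  rw [this]; rfl

theorem push_push (hx' : k x' = x'') (hy' : k y' = y'') (γ : Hom x y) :
    push k hx' hy' (push h hx hy γ) =
      push (k.comp h) (by simp [hx, hx']) (by simp [hy, hy']) γ := by
  subst hx hy hx' hy'
  obtain ⟨p, rfl⟩ := exists_cls γ
  rfl

theorem push_of_eq_id (hh : ∀ x, h x = x) (γ : Hom x y) : push h (hh x) (hh y) γ = γ := by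
  obtain ⟨p, rfl⟩ := exists_cls γ
  exact push_cls h _ _ fun t => (hh _).symm

end push

theorem cls_subpath {x y : S} (p : Path x y) (r s t : I) :
    cls (p.subpath r s) ≫ cls (p.subpath s t) = cls (p.subpath r t) :=
  cls_eq_iff.2 ⟨Path.Homotopy.subpathTransSubpath p r s t⟩

/-! ### The front and the back -/

/-- The front: the plane cut along the rays that lead from the punctures to infinity. -/
def frontSet : Set ℂ := {z | ∀ k : ZMod 7, ∀ r : ℝ, 1 ≤ r → z ≠ r * puncture k}

theorem zero_mem_frontSet : (0 : ℂ) ∈ frontSet := fun k r hr h => by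
  have := mul_ne_zero (Complex.ofReal_ne_zero.2 (by linarith : r ≠ 0)) (puncture_ne_zero k)
  exact this h.symm

theorem smul_mem_frontSet {z : ℂ} (hz : z ∈ frontSet) {t : ℝ} (h0 : 0 ≤ t) (h1 : t ≤ 1) :
    (t : ℂ) * z ∈ frontSet := by
  rcases h0.eq_or_lt with rfl | h0
  · simpa using zero_mem_frontSet
  · intro k r hr h
    refine hz k (r / t) ((one_le_div h0).2 (h1.trans hr)) ?_
    have : (t : ℂ) ≠ 0 := Complex.ofReal_ne_zero.2 h0.ne'
    push_cast
    field_simp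
    rw [← h]; ring

theorem ne_puncture_of_mem_frontSet {z : ℂ} (hz : z ∈ frontSet) (k : ZMod 7) : z ≠ puncture k := by
  simpa using hz k 1 le_rfl

instance : SimplyConnectedSpace frontSet := by
  have h : StarConvex ℝ 0 frontSet := by
    rw [starConvex_zero_iff]
    intro z hz t h0 h1
    rw [Complex.real_smul]
    exact smul_mem_frontSet hz h0 h1
  have := h.contractibleSpace ⟨0, zero_mem_frontSet⟩
  infer_instance

theorem mul_puncture_mem_frontSet {z : ℂ} (hz : z ∈ frontSet) (k : ZMod 7) :
    puncture k * z ∈ frontSet := by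
  intro j r hr h
  refine hz (j - k) r hr (mul_left_cancel₀ (puncture_ne_zero k) ?_)
  rw [h, mul_left_comm, ← puncture_add]
  congr 2; ring

/-- The inclusion of the front into `S`. -/
noncomputable def frontIncl : C(frontSet, S) where
  toFun z := ⟨((z : ℂ) : OnePoint ℂ), fun k hk =>
    ne_puncture_of_mem_frontSet z.2 k (OnePoint.coe_injective hk)⟩
  continuous_toFun := Continuous.subtype_mk
    (OnePoint.continuous_coe.comp continuous_subtype_val) _

theorem isEmbedding_frontIncl : IsEmbedding frontIncl := by
  have h : IsEmbedding (Subtype.val ∘ frontIncl) :=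
    OnePoint.isOpenEmbedding_coe.isEmbedding.comp IsEmbedding.subtypeVal
  exact IsEmbedding.of_comp frontIncl.continuous continuous_subtype_val h

theorem inv_puncture (k : ZMod 7) : (puncture k)⁻¹ = puncture (-k) := by
  rw [inv_eq_iff_eq_inv]
  refine eq_inv_of_mul_eq_one_left ?_
  rw [← puncture_add, add_neg_cancel, puncture_zero]

/-- The inversion `z ↦ 1 / z` of `S`. It exchanges the front and the back. -/
noncomputable def flip : S ≃ₜ S :=
  inversion.subtype fun x => by
    have h : ∀ y : OnePoint ℂ, (∀ k : ZMod 7, y ≠ ((puncture k : ℂ) : OnePoint ℂ)) →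
        ∀ k : ZMod 7, inversion y ≠ ((puncture k : ℂ) : OnePoint ℂ) := by
      intro y hy k hk
      apply hy (-k)
      rw [← inversion_inversion y, hk, inversion_coe (puncture_ne_zero k), inv_puncture]
    exact ⟨h x, fun hx => by simpa [inversion_inversion] using h _ hx⟩

theorem flip_flip (x : S) : flip (flip x) = x := Subtype.ext (inversion_inversion x.1)

theorem coe_flip (x : S) : (flip x).1 = inversion x.1 := rfl

/-- The points of the front. -/
def InFront (x : S) : Prop := x ∈ Set.range frontIncl

/-- The points of the back: the sphere cut along the rays that lead from the punctures to `0`. -/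
def InBack (x : S) : Prop := InFront (flip x)

theorem inFront_iff {x : S} : InFront x ↔ ∃ z ∈ frontSet, x.1 = ((z : ℂ) : OnePoint ℂ) := by
  constructor
  · rintro ⟨z, rfl⟩; exact ⟨z, z.2, rfl⟩
  · rintro ⟨z, hz, h⟩; exact ⟨⟨z, hz⟩, Subtype.ext h.symm⟩

/-- Two paths with the same endpoints in a simply connected subspace are homotopic. -/
theorem homotopic_of_range {Z X : Type*} [TopologicalSpace Z] [SimplyConnectedSpace Z]
    [TopologicalSpace X] {i : C(Z, X)} (hi : IsEmbedding i) {x y : X} (p q : Path x y)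
    (hp : ∀ t, p t ∈ Set.range i) (hq : ∀ t, q t ∈ Set.range i) : p.Homotopic q := by
  obtain ⟨z, hz⟩ : x ∈ Set.range i := p.source ▸ hp 0
  obtain ⟨z', hz'⟩ : y ∈ Set.range i := p.target ▸ hp 1
  subst hz hz'
  have lift : ∀ r : Path (i z) (i z'), (∀ t, r t ∈ Set.range i) →
      ∃ r' : Path z z', r'.map i.continuous = r := by
    intro r hr
    choose f hf using hr
    refine ⟨⟨⟨f, ?_⟩, ?_, ?_⟩, ?_⟩
    · rw [hi.continuous_iff]
      have : i ∘ f = r := funext hf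
      rw [this]; exact r.continuous
    · exact hi.injective ((hf 0).trans r.source)
    · exact hi.injective ((hf 1).trans r.target)
    · ext t; exact hf t
  obtain ⟨p', rfl⟩ := lift p hp
  obtain ⟨q', rfl⟩ := lift q hq
  exact (SimplyConnectedSpace.paths_homotopic p' q').map i

theorem homotopic_of_inFront {x y : S} (p q : Path x y) (hp : ∀ t, InFront (p t))
    (hq : ∀ t, InFront (q t)) : p.Homotopic q :=
  homotopic_of_range isEmbedding_frontIncl p q hp hq

theorem homotopic_of_inBack {x y : S} (p q : Path x y) (hp : ∀ t, InBack (p t))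
    (hq : ∀ t, InBack (q t)) : p.Homotopic q := by
  have hi : IsEmbedding ((⟨flip, flip.continuous⟩ : C(S, S)).comp frontIncl) :=
    flip.isEmbedding.comp isEmbedding_frontIncl
  have h : ∀ x, InBack x → x ∈ Set.range ((⟨flip, flip.continuous⟩ : C(S, S)).comp frontIncl) := by
    rintro x ⟨z, hz⟩
    refine ⟨z, ?_⟩
    change flip (frontIncl z) = x
    rw [hz, flip_flip]
  exact homotopic_of_range hi p q (fun t => h _ (hp t)) (fun t => h _ (hq t))

/-- The centre `0` of the front heptagon. -/
noncomputable def zeroPt : S := frontIncl ⟨0, zero_mem_frontSet⟩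

/-- The centre `∞` of the back heptagon. -/
noncomputable def inftyPt : S := flip zeroPt

theorem flip_inftyPt : flip inftyPt = zeroPt := flip_flip _

theorem coe_zeroPt : zeroPt.1 = ((0 : ℂ) : OnePoint ℂ) := rfl

theorem coe_inftyPt : inftyPt.1 = OnePoint.infty := inversion_zero

/-- The radius from `0` to a point of the front. -/
noncomputable def radius (z : frontSet) : Path zeroPt (frontIncl z) where
  toFun t := frontIncl ⟨(t : ℝ) * (z : ℂ), smul_mem_frontSet z.2 t.2.1 t.2.2⟩
  continuous_toFun := frontIncl.continuous.comp (Continuous.subtype_mk (by fun_prop) _)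
  source' := by simp [zeroPt]
  target' := by simp

theorem exists_front_path {x : S} (hx : InFront x) :
    ∃ p : Path zeroPt x, ∀ t, InFront (p t) := by
  obtain ⟨z, rfl⟩ := hx
  exact ⟨radius z, fun t => ⟨_, rfl⟩⟩

theorem exists_back_path {x : S} (hx : InBack x) :
    ∃ p : Path inftyPt x, ∀ t, InBack (p t) := by
  obtain ⟨p, hp⟩ := exists_front_path hx
  refine ⟨(p.map flip.continuous).cast rfl (flip_flip x).symm, fun t => ?_⟩
  change InFront (flip (flip (p t)))
  rw [flip_flip]; exact hp t

/-- The class of the paths from `0` to `x` in the front. -/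
noncomputable def front {x : S} (hx : InFront x) : Hom zeroPt x :=
  cls (exists_front_path hx).choose

/-- The class of the paths from `∞` to `x` in the back. -/
noncomputable def back {x : S} (hx : InBack x) : Hom inftyPt x :=
  cls (exists_back_path hx).choose

theorem front_eq {x : S} (hx : InFront x) (p : Path zeroPt x) (hp : ∀ t, InFront (p t)) :
    front hx = cls p :=
  cls_eq_iff.2 (homotopic_of_inFront _ _ (exists_front_path hx).choose_spec hp)

theorem back_eq {x : S} (hx : InBack x) (p : Path inftyPt x) (hp : ∀ t, InBack (p t)) :
    back hx = cls p :=
  cls_eq_iff.2 (homotopic_of_inBack _ _ (exists_back_path hx).choose_spec hp)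

theorem inFront_zeroPt : InFront zeroPt := ⟨_, rfl⟩

theorem inBack_inftyPt : InBack inftyPt := by
  rw [InBack, flip_inftyPt]; exact inFront_zeroPt

theorem front_zeroPt (h : InFront zeroPt) : front h = 𝟙 _ :=
  front_eq h (Path.refl _) fun _ => h

theorem back_inftyPt (h : InBack inftyPt) : back h = 𝟙 _ :=
  back_eq h (Path.refl _) fun _ => h

theorem Path.trans_mem {X : Type*} [TopologicalSpace X] {x y z : X} {P : X → Prop} {p : Path x y}
    {q : Path y z} (hp : ∀ t, P (p t)) (hq : ∀ t, P (q t)) (t : I) : P (p.trans q t) := by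
  rw [Path.trans_apply]
  split_ifs
  · exact hp _
  · exact hq _

theorem front_comp {x y : S} (hx : InFront x) (hy : InFront y) (p : Path x y)
    (hp : ∀ t, InFront (p t)) : front hx ≫ cls p = front hy := by
  rw [front, ← cls_trans, eq_comm]
  exact front_eq _ _ (Path.trans_mem (exists_front_path hx).choose_spec hp)

theorem back_comp {x y : S} (hx : InBack x) (hy : InBack y) (p : Path x y)
    (hp : ∀ t, InBack (p t)) : back hx ≫ cls p = back hy := by
  rw [back, ← cls_trans, eq_comm]
  exact back_eq _ _ (Path.trans_mem (exists_back_path hx).choose_spec hp)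

theorem subpath_mem {P : S → Prop} {x y : S} (p : Path x y) {s t : I} (hst : s ≤ t)
    (hp : ∀ r, s ≤ r → r ≤ t → P (p r)) (u : I) : P (p.subpath s t u) := by
  have h : p.subpath s t u ∈ Set.range (p.subpath s t) := ⟨u, rfl⟩
  rw [Path.range_subpath_of_le p s t hst] at h
  obtain ⟨r, hr, hr'⟩ := h
  rw [← hr']; exact hp r hr.1 hr.2

theorem push_front (h : C(S, S)) (h0 : h zeroPt = zeroPt) (hh : ∀ x, InFront x → InFront (h x))
    {x : S} (hx : InFront x) : push h h0 rfl (front hx) = front (hh x hx) := by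
  rw [front, front_eq (hh x hx) (((exists_front_path hx).choose.map h.continuous).cast h0.symm rfl)
    fun t => hh _ ((exists_front_path hx).choose_spec t)]
  exact push_cls _ _ _ fun _ => rfl

theorem push_back (h : C(S, S)) (h0 : h inftyPt = inftyPt) (hh : ∀ x, InBack x → InBack (h x))
    {x : S} (hx : InBack x) : push h h0 rfl (back hx) = back (hh x hx) := by
  rw [back, back_eq (hh x hx) (((exists_back_path hx).choose.map h.continuous).cast h0.symm rfl)
    fun t => hh _ ((exists_back_path hx).choose_spec t)]
  exact push_cls _ _ _ fun _ => rfl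

/-! ### Sectors and arcs -/

theorem polar_mul (r s θ η : ℝ) : polar r θ * polar s η = polar (r * s) (θ + η) := by
  unfold polar
  rw [mul_mul_mul_comm, ← Complex.exp_add]
  push_cast
  congr 2
  ring

theorem ofReal_mul_puncture (r : ℝ) (k : ZMod 7) : (r : ℂ) * puncture k = polar r k.val := by
  simp [puncture, polar]

theorem polar_ne_zero {r : ℝ} (hr : r ≠ 0) (θ : ℝ) : polar r θ ≠ 0 := by
  unfold polar
  exact mul_ne_zero (Complex.ofReal_ne_zero.2 hr) (Complex.exp_ne_zero _)

theorem inv_polar (r θ : ℝ) : (polar r θ)⁻¹ = polar r⁻¹ (-θ) := by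
  unfold polar
  rw [mul_inv, ← Complex.exp_neg]
  push_cast
  congr 2
  ring

theorem exists_eq_of_polar_eq {r s θ η : ℝ} (hr : 0 < r) (hs : 0 < s)
    (h : polar r θ = polar s η) : r = s ∧ ∃ n : ℤ, θ = η + 7 * n := by
  have h1 : r = s := by
    have := congrArg norm h
    rwa [norm_polar hr.le, norm_polar hs.le] at this
  refine ⟨h1, ?_⟩
  subst h1
  unfold polar at h
  have h2 := mul_left_cancel₀ (Complex.ofReal_ne_zero.2 hr.ne') h
  rw [Complex.exp_eq_exp_iff_exists_int] at h2
  obtain ⟨n, hn⟩ := h2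
  have h3 : ((2 * Real.pi * θ / 7 : ℝ) : ℂ) =
      ((2 * Real.pi * η / 7 + n * (2 * Real.pi) : ℝ) : ℂ) := by
    apply mul_right_cancel₀ Complex.I_ne_zero
    rw [hn]; push_cast; ring
  have h4 := Complex.ofReal_injective h3
  refine ⟨n, ?_⟩
  have hpi := Real.pi_pos
  field_simp at h4
  linarith

/-- The region of `frontSet` in polar coordinates. -/
theorem polar_mem_frontSet {r θ : ℝ} (hr : 0 ≤ r) (h : ∀ n : ℤ, θ = n → r < 1) :
    polar r θ ∈ frontSet := by
  intro k s hs hk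
  rw [ofReal_mul_puncture] at hk
  rcases hr.eq_or_lt with rfl | hr
  · have := congrArg norm hk
    rw [norm_polar le_rfl, norm_polar (by linarith)] at this
    linarith
  · obtain ⟨rfl, n, hn⟩ := exists_eq_of_polar_eq hr (by linarith) hk
    have := h (k.val + 7 * n) (by rw [hn]; push_cast; rfl)
    linarith

theorem inFront_polar {x : S} {r θ : ℝ} (hx : x.1 = ((polar r θ : ℂ) : OnePoint ℂ)) (hr : 0 ≤ r)
    (h : ∀ n : ℤ, θ = n → r < 1) : InFront x :=
  inFront_iff.2 ⟨_, polar_mem_frontSet hr h, hx⟩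

theorem inBack_of_coe {x : S} {z : ℂ} (hx : x.1 = ((z : ℂ) : OnePoint ℂ)) (hz : z ≠ 0)
    (h : ∀ (k : ZMod 7) (r : ℝ), 0 < r → r ≤ 1 → z ≠ r * puncture k) : InBack x := by
  refine inFront_iff.2 ⟨z⁻¹, fun k r hr hk => ?_, by rw [coe_flip, hx, inversion_coe hz]⟩
  refine h (-k) r⁻¹ (by positivity) (inv_le_one_of_one_le₀ hr) ?_
  rw [← inv_puncture, Complex.ofReal_inv, ← mul_inv, ← hk, inv_inv]

theorem inBack_polar {x : S} {r θ : ℝ} (hx : x.1 = ((polar r θ : ℂ) : OnePoint ℂ)) (hr : 0 < r)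
    (h : ∀ n : ℤ, θ = n → 1 < r) : InBack x := by
  refine inBack_of_coe hx (polar_ne_zero hr.ne' θ) fun k s hs hs1 hk => ?_
  rw [ofReal_mul_puncture] at hk
  obtain ⟨rfl, n, hn⟩ := exists_eq_of_polar_eq hr hs hk
  have := h (k.val + 7 * n) (by rw [hn]; push_cast; rfl)
  linarith

/-- The open sector between the rays through `p_k` and `p_{k+1}`. The sectors are the components
of the intersection of the front and the back. -/
def InSector (k : ZMod 7) (x : S) : Prop :=
  ∃ (n : ℤ) (r θ : ℝ), (n : ZMod 7) = k ∧ 0 < r ∧ n < θ ∧ θ < n + 1 ∧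
    x.1 = ((polar r θ : ℂ) : OnePoint ℂ)

theorem ne_int_of_lt {n m : ℤ} {θ : ℝ} (h1 : n < θ) (h2 : θ < n + 1) : θ ≠ m := by
  rintro rfl
  have h3 : n < m := by exact_mod_cast h1
  have h4 : m < n + 1 := by exact_mod_cast h2
  omega

theorem InSector.inFront {k : ZMod 7} {x : S} (h : InSector k x) : InFront x := by
  obtain ⟨n, r, θ, -, hr, h1, h2, hx⟩ := h
  exact inFront_polar hx hr.le fun m hm => absurd hm (ne_int_of_lt h1 h2)

theorem InSector.inBack {k : ZMod 7} {x : S} (h : InSector k x) : InBack x := by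
  obtain ⟨n, r, θ, -, hr, h1, h2, hx⟩ := h
  exact inBack_polar hx hr fun m hm => absurd hm (ne_int_of_lt h1 h2)

theorem InSector.exists_path {k : ZMod 7} {x y : S} (hx : InSector k x) (hy : InSector k y) :
    ∃ p : Path x y, ∀ t, InSector k (p t) := by
  obtain ⟨n, r, θ, hn, hr, h1, h2, hx⟩ := hx
  obtain ⟨m, s, η, hm, hs, h3, h4, hy⟩ := hy
  obtain ⟨j, hj⟩ : ((7 : ℕ) : ℤ) ∣ m - n := (ZMod.intCast_eq_intCast_iff_dvd_sub n m 7).1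
    (hn.trans hm.symm)
  have hmn : (m : ℝ) = n + 7 * j := by
    have : m = n + 7 * j := by push_cast at hj; omega
    rw [this]; push_cast; ring
  have hy' : polar s η = polar s (η - 7 * j) := by
    rw [← polar_add s (η - 7 * j) j]; congr 1; ring
  rw [hy'] at hy
  have conv : ∀ t : I, ∀ a b u v : ℝ, u < a → a < v → u < b → b < v →
      u < (1 - t) * a + t * b ∧ (1 - t) * a + t * b < v := by
    intro t a b u v h1 h2 h3 h4
    have ht := t.2.1
    have ht' := t.2.2
    constructor
    · rcases ht.eq_or_lt with h | h
      · rw [← h]; simpa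
      · nlinarith
    · rcases ht.eq_or_lt with h | h
      · rw [← h]; simpa
      · nlinarith
  have hpos : ∀ t : I, 0 < (1 - t) * r + t * s := fun t =>
    (conv t r s 0 (max r s + 1) hr (by linarith [le_max_left r s]) hs
      (by linarith [le_max_right r s])).1
  have hang : ∀ t : I, (n : ℝ) < (1 - (t : ℝ)) * θ + t * (η - 7 * j) ∧
      (1 - (t : ℝ)) * θ + t * (η - 7 * j) < n + 1 := fun t =>
    conv t θ (η - 7 * j) n (n + 1) h1 h2 (by linarith) (by linarith)
  refine ⟨⟨⟨fun t => ⟨((polar ((1 - t) * r + t * s) ((1 - t) * θ + t * (η - 7 * j)) : ℂ) :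
    OnePoint ℂ), fun l hl => ?_⟩, ?_⟩, ?_, ?_⟩, fun t => ?_⟩
  · obtain ⟨-, i, hi⟩ := eq_int_of_polar_eq_puncture (hpos t).le (OnePoint.coe_injective hl)
    exact ne_int_of_lt (hang t).1 (hang t).2 hi
  · refine Continuous.subtype_mk (OnePoint.continuous_coe.comp (continuous_polar ?_ ?_)) _ <;>
      fun_prop
  · refine Subtype.ext ?_
    simp [hx]
  · refine Subtype.ext ?_
    simp [hy]
  · exact ⟨n, _, _, hn, hpos t, (hang t).1, (hang t).2, rfl⟩

/-- The point of the unit circle halfway between `p_k` and `p_{k+1}`. -/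
noncomputable def midArc (k : ZMod 7) : S :=
  ⟨((polar 1 (k.val + 1 / 2) : ℂ) : OnePoint ℂ), fun l hl => by
    obtain ⟨-, i, hi⟩ := eq_int_of_polar_eq_puncture zero_le_one (OnePoint.coe_injective hl)
    exact ne_int_of_lt (n := k.val) (by push_cast; linarith) (by push_cast; linarith) hi⟩

theorem inSector_midArc (k : ZMod 7) : InSector k (midArc k) :=
  ⟨k.val, 1, k.val + 1 / 2, by simp, one_pos, by push_cast; linarith, by push_cast; linarith, rfl⟩

/-- The class of the paths from `0` to `∞` that pass from the front to the back between `p_k` and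
`p_{k+1}`. These classes generate the fundamental groupoid of `S` on `0` and `∞`. -/
noncomputable def arc (k : ZMod 7) : Hom zeroPt inftyPt :=
  front (inSector_midArc k).inFront ≫ inv (back (inSector_midArc k).inBack)

theorem front_eq_arc {k : ZMod 7} {x : S} (h : InSector k x) (hF : InFront x) (hB : InBack x) :
    front hF = arc k ≫ back hB := by
  obtain ⟨p, hp⟩ := (inSector_midArc k).exists_path h
  rw [← front_comp (inSector_midArc k).inFront hF p fun t => (hp t).inFront,
    ← back_comp (inSector_midArc k).inBack hB p fun t => (hp t).inBack, arc]
  simp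

theorem back_eq_arc {k : ZMod 7} {x : S} (h : InSector k x) (hF : InFront x) (hB : InBack x) :
    back hB = inv (arc k) ≫ front hF := by
  rw [front_eq_arc h hF hB]; simp

theorem arc_eq {k : ZMod 7} {x : S} (h : InSector k x) (hF : InFront x) (hB : InBack x) :
    arc k = front hF ≫ inv (back hB) := by
  rw [front_eq_arc h hF hB]; simp

/-- The class of a path that runs in the front, then in the back, and then in the front. -/
theorem front_comp_front_back_front {x y : S} (hx : InFront x) (hy : InFront y) (p : Path x y)
    {s t : I} (hst : s ≤ t) {k j : ZMod 7} (h1 : ∀ r ≤ s, InFront (p r))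
    (h2 : ∀ r, s ≤ r → r ≤ t → InBack (p r)) (h3 : ∀ r, t ≤ r → InFront (p r))
    (hk : InSector k (p s)) (hj : InSector j (p t)) :
    front hx ≫ cls p = arc k ≫ inv (arc j) ≫ front hy := by
  obtain ⟨c, rfl, rfl⟩ := p
  set p : Path (c 0) (c 1) := ⟨c, rfl, rfl⟩
  have e : cls p = cls (p.subpath 0 s) ≫ cls (p.subpath s t) ≫ cls (p.subpath t 1) := by
    rw [cls_subpath, cls_subpath, Path.subpath_zero_one]; rfl
  rw [e, ← Category.assoc, front_comp hx hk.inFront _ (subpath_mem p s.2.1 fun r _ h => h1 r h),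
    front_eq_arc hk hk.inFront hk.inBack, Category.assoc, ← Category.assoc (back _),
    back_comp hk.inBack hj.inBack _ (subpath_mem p hst h2), back_eq_arc hj hj.inFront hj.inBack,
    Category.assoc, front_comp hj.inFront hy _ (subpath_mem p t.2.2 fun r h _ => h3 r h)]

/-- The class of a path that runs in the back and then in the front. -/
theorem back_comp_back_front {x y : S} (hx : InBack x) (hy : InFront y) (p : Path x y)
    {s : I} {k : ZMod 7} (h1 : ∀ r ≤ s, InBack (p r)) (h2 : ∀ r, s ≤ r → InFront (p r))
    (hk : InSector k (p s)) :
    back hx ≫ cls p = inv (arc k) ≫ front hy := by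
  obtain ⟨c, rfl, rfl⟩ := p
  set p : Path (c 0) (c 1) := ⟨c, rfl, rfl⟩
  have e : cls p = cls (p.subpath 0 s) ≫ cls (p.subpath s 1) := by
    rw [cls_subpath, Path.subpath_zero_one]; rfl
  rw [e, ← Category.assoc, back_comp hx hk.inBack _ (subpath_mem p s.2.1 fun r _ h => h1 r h),
    back_eq_arc hk hk.inFront hk.inBack, Category.assoc,
    front_comp hk.inFront hy _ (subpath_mem p s.2.2 fun r h _ => h2 r h)]

/-! ### Rotations -/

/-- The rotation by `k` clicks; `rho` is definitionally `rot 3`. -/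
noncomputable def rot (k : ZMod 7) : S ≃ₜ S :=
  liftHomeo (Homeomorph.mulLeft₀ (puncture k) (puncture_ne_zero k)) (Equiv.addLeft k) fun j => by
    rw [Homeomorph.coe_mulLeft₀, Equiv.coe_addLeft, puncture_add]

/-- A homeomorphism of `S` as a continuous map. -/
noncomputable abbrev cm (φ : S ≃ₜ S) : C(S, S) := ⟨φ, φ.continuous⟩

theorem coe_liftHomeo {h : ℂ ≃ₜ ℂ} {e : Equiv.Perm (ZMod 7)}
    {he : ∀ k, h (puncture k) = puncture (e k)} {x : S} {z : ℂ}
    (hx : x.1 = ((z : ℂ) : OnePoint ℂ)) : (liftHomeo h e he x).1 = ((h z : ℂ) : OnePoint ℂ) := by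
  change h.onePointCongr x.1 = _
  rw [hx]; rfl

theorem liftHomeo_inftyPt {h : ℂ ≃ₜ ℂ} {e : Equiv.Perm (ZMod 7)}
    {he : ∀ k, h (puncture k) = puncture (e k)} : liftHomeo h e he inftyPt = inftyPt := by
  refine Subtype.ext ?_
  change h.onePointCongr inftyPt.1 = _
  rw [coe_inftyPt]; rfl

theorem coe_rot (k : ZMod 7) {x : S} {z : ℂ} (hx : x.1 = ((z : ℂ) : OnePoint ℂ)) :
    (rot k x).1 = ((puncture k * z : ℂ) : OnePoint ℂ) := coe_liftHomeo hx

theorem rot_inftyPt (k : ZMod 7) : rot k inftyPt = inftyPt := liftHomeo_inftyPt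

theorem rot_zeroPt (k : ZMod 7) : rot k zeroPt = zeroPt :=
  Subtype.ext (by rw [coe_rot k coe_zeroPt, mul_zero]; rfl)

theorem InFront.rot {x : S} (hx : InFront x) (k : ZMod 7) : InFront (rot k x) := by
  obtain ⟨z, hz, h⟩ := inFront_iff.1 hx
  exact inFront_iff.2 ⟨_, mul_puncture_mem_frontSet hz k, coe_rot k h⟩

theorem flip_rot (k : ZMod 7) (x : S) : flip (rot k x) = rot (-k) (flip x) := by
  by_cases hx : x = inftyPt
  · rw [hx, rot_inftyPt, flip_inftyPt, rot_zeroPt]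
  by_cases hx0 : x = zeroPt
  · rw [hx0, rot_zeroPt]; exact (rot_inftyPt _).symm
  obtain ⟨z, hz⟩ : ∃ z : ℂ, (z : OnePoint ℂ) = x.1 := OnePoint.ne_infty_iff_exists.1 fun h =>
    hx (Subtype.ext (by rw [h, coe_inftyPt]))
  have hz0 : z ≠ 0 := fun h => hx0 (Subtype.ext (by rw [← hz, h]; rfl))
  refine Subtype.ext ?_
  have h1 : (flip x).1 = ((z⁻¹ : ℂ) : OnePoint ℂ) := by
    rw [coe_flip, ← hz, inversion_coe hz0]
  rw [coe_rot _ h1, coe_flip, coe_rot k hz.symm,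
    inversion_coe (mul_ne_zero (puncture_ne_zero k) hz0), mul_inv, inv_puncture]

theorem InBack.rot {x : S} (hx : InBack x) (k : ZMod 7) : InBack (rot k x) := by
  rw [InBack, flip_rot]; exact InFront.rot hx _

theorem InSector.rot {j : ZMod 7} {x : S} (hx : InSector j x) (k : ZMod 7) :
    InSector (j + k) (rot k x) := by
  obtain ⟨n, r, θ, hn, hr, h1, h2, hx⟩ := hx
  refine ⟨n + k.val, r, k.val + θ, by simp [hn], hr, by push_cast; linarith,
    by push_cast; linarith, ?_⟩
  rw [coe_rot k hx, puncture, polar_mul, one_mul]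

theorem push_rot_arc (k j : ZMod 7) :
    push (cm (rot k)) (rot_zeroPt k) (rot_inftyPt k) (arc j) = arc (j + k) := by
  have hm := inSector_midArc j
  rw [arc, push_comp (cm (rot k)) _ rfl _, push_inv,
    push_front (cm (rot k)) _ (fun x hx => hx.rot k), push_back (cm (rot k)) _ (fun x hx => hx.rot k)]
  exact (arc_eq (hm.rot k) _ _).symm

/-! ### The half-twists -/

/-- The unit vector in the direction of the midpoint of `p_0` and `p_1`. -/
noncomputable def axis : ℂ := polar 1 (1 / 2)

theorem axis_ne_zero : axis ≠ 0 := polar_ne_zero one_ne_zero _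

theorem norm_axis : ‖axis‖ = 1 := norm_polar zero_le_one _

/-- The distance from `0` to the midpoint of `p_0` and `p_1`. -/
noncomputable def apothem : ℝ := Real.cos (Real.pi / 7)

theorem lt_apothem : 89 / 100 < apothem := by
  have h := Real.one_sub_sq_div_two_le_cos (x := Real.pi / 7)
  have h1 := Real.pi_lt_d2
  have h2 := Real.pi_pos
  unfold apothem
  nlinarith

theorem apothem_lt : apothem < 1 := by
  rw [apothem, ← Real.cos_zero]
  have := Real.pi_pos
  exact Real.cos_lt_cos_of_nonneg_of_le_pi le_rfl (by linarith) (by linarith)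

theorem polar_eq_axis_mul (r θ : ℝ) : polar r θ = axis *
    ((r * Real.cos (2 * Real.pi * (θ - 1 / 2) / 7) : ℝ) +
      (r * Real.sin (2 * Real.pi * (θ - 1 / 2) / 7) : ℝ) * Complex.I) := by
  have h : polar r θ = axis * polar r (θ - 1 / 2) := by
    rw [axis, polar_mul, one_mul]; congr 1; ring
  rw [h, polar, Complex.exp_mul_I, ← Complex.ofReal_cos, ← Complex.ofReal_sin]
  push_cast
  ring

theorem midpt_zero_eq : midpt 0 = axis * (apothem : ℝ) := by
  have h1 : puncture 1 = polar 1 1 := by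
    have : (1 : ZMod 7).val = 1 := by decide
    rw [puncture, this]; norm_num
  have h0 : puncture 0 = polar 1 0 := by simp [puncture]
  rw [midpt, zero_add, h1, h0, polar_eq_axis_mul 1 0, polar_eq_axis_mul 1 1, apothem]
  have e1 : 2 * Real.pi * (1 - 1 / 2) / 7 = Real.pi / 7 := by ring
  have e2 : 2 * Real.pi * (0 - 1 / 2) / 7 = -(Real.pi / 7) := by ring
  rw [e1, e2, Real.cos_neg, Real.sin_neg]
  push_cast
  ring

theorem seven_cases (k : ZMod 7) : k.val = 0 ∨ k.val = 1 ∨ k.val = 2 ∨ k.val = 3 ∨ k.val = 4 ∨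
    k.val = 5 ∨ k.val = 6 := by
  have := k.val_lt
  omega

/-- The direction of a puncture, measured from the axis: either the puncture is one of `p_0` and
`p_1`, or it is far from the axis, or it is behind the origin. -/
theorem direction_cases (k : ZMod 7) :
    Real.cos (2 * Real.pi * (k.val - 1 / 2) / 7) = apothem ∨
    (Real.cos (2 * Real.pi * (k.val - 1 / 2) / 7) ≤ 1 / 2 ∧
      (3 / 4 < |Real.sin (2 * Real.pi * (k.val - 1 / 2) / 7)| ∨
        Real.cos (2 * Real.pi * (k.val - 1 / 2) / 7) < 0)) := by
  have hpi := Real.pi_pos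
  have hpi' := Real.pi_lt_d2
  have s3 : 3 / 4 < Real.sin (3 * Real.pi / 7) := by
    have h1 : Real.sin (3 * Real.pi / 7) = Real.cos (Real.pi / 14) := by
      rw [← Real.cos_pi_div_two_sub]; congr 1; ring
    have := Real.one_sub_sq_div_two_le_cos (x := Real.pi / 14)
    rw [h1]; nlinarith
  have s2 : 3 / 4 < Real.sin (2 * Real.pi / 7) := by
    have h1 : Real.sin (2 * Real.pi / 7) = Real.cos (3 * Real.pi / 14) := by
      rw [← Real.cos_pi_div_two_sub]; congr 1; ring
    have := Real.one_sub_sq_div_two_le_cos (x := 3 * Real.pi / 14)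
    rw [h1]; nlinarith
  have c3 : Real.cos (3 * Real.pi / 7) ≤ 1 / 2 := by
    rw [← Real.cos_pi_div_three]
    exact Real.cos_le_cos_of_nonneg_of_le_pi (by linarith) (by linarith) (by linarith)
  have c2 : Real.cos (2 * Real.pi / 7) > 0 :=
    Real.cos_pos_of_mem_Ioo ⟨by linarith, by linarith⟩
  rcases seven_cases k with h | h | h | h | h | h | h <;> rw [h] <;> push_cast
  · left
    rw [apothem, ← Real.cos_neg]; congr 1; ring
  · left
    rw [apothem]; congr 1; ring
  · right
    rw [show 2 * Real.pi * (2 - 1 / 2) / 7 = 3 * Real.pi / 7 by ring]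
    exact ⟨c3, Or.inl (s3.trans_le (le_abs_self _))⟩
  · right
    rw [show 2 * Real.pi * (3 - 1 / 2) / 7 = Real.pi - 2 * Real.pi / 7 by ring,
      Real.cos_pi_sub, Real.sin_pi_sub]
    exact ⟨by linarith, Or.inl (s2.trans_le (le_abs_self _))⟩
  · right
    rw [show 2 * Real.pi * (4 - 1 / 2) / 7 = Real.pi by ring, Real.cos_pi]
    exact ⟨by norm_num, Or.inr (by norm_num)⟩
  · right
    rw [show 2 * Real.pi * (5 - 1 / 2) / 7 = 2 * Real.pi / 7 + Real.pi by ring,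
      Real.cos_add_pi, Real.sin_add_pi, abs_neg]
    exact ⟨by linarith, Or.inl (s2.trans_le (le_abs_self _))⟩
  · right
    rw [show 2 * Real.pi * (6 - 1 / 2) / 7 = 2 * Real.pi - 3 * Real.pi / 7 by ring,
      Real.cos_two_pi_sub, Real.sin_two_pi_sub, abs_neg]
    exact ⟨c3, Or.inl (s3.trans_le (le_abs_self _))⟩

theorem add_mul_I_inj {a b c d : ℝ} (h : (a : ℂ) + b * Complex.I = c + d * Complex.I) :
    a = c ∧ b = d := by
  constructor
  · simpa using congrArg Complex.re h
  · simpa using congrArg Complex.im h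

theorem eq_of_axis_mul_eq {x y r : ℝ} {k : ZMod 7}
    (h : axis * ((x : ℂ) + y * Complex.I) = r * puncture k) :
    x = r * Real.cos (2 * Real.pi * (k.val - 1 / 2) / 7) ∧
      y = r * Real.sin (2 * Real.pi * (k.val - 1 / 2) / 7) := by
  rw [ofReal_mul_puncture, polar_eq_axis_mul] at h
  exact add_mul_I_inj (mul_left_cancel₀ axis_ne_zero h)

/-- Within the strip of width `3/4` on both sides of the axis, the line through `p_0` and `p_1`
separates the front from the back: the points on the side of `0` are in the front. -/
theorem inFront_of_le_apothem {X : S} {x y : ℝ}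
    (hX : X.1 = ((axis * ((x : ℂ) + y * Complex.I) : ℂ) : OnePoint ℂ)) (h0 : 0 ≤ x)
    (h1 : x ≤ apothem) (hy : |y| ≤ 3 / 4) : InFront X := by
  refine inFront_iff.2 ⟨_, fun k r hr hk => ?_, hX⟩
  obtain ⟨hx', hy'⟩ := eq_of_axis_mul_eq hk
  rcases direction_cases k with h | ⟨-, h | h⟩
  · rw [h] at hx'
    have hr1 : r = 1 := by nlinarith [lt_apothem]
    rw [hr1, Complex.ofReal_one, one_mul] at hk
    exact X.2 k (by rw [hX, hk])
  · rw [hy', abs_mul, abs_of_pos (by linarith)] at hy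
    nlinarith
  · nlinarith

theorem inBack_of_apothem_le {X : S} {x y : ℝ}
    (hX : X.1 = ((axis * ((x : ℂ) + y * Complex.I) : ℂ) : OnePoint ℂ)) (h1 : apothem ≤ x) :
    InBack X := by
  have hc := lt_apothem
  refine inBack_of_coe hX (mul_ne_zero axis_ne_zero fun h => ?_) fun k r hr hr1 hk => ?_
  · have := congrArg Complex.re h
    simp at this
    linarith
  obtain ⟨hx', hy'⟩ := eq_of_axis_mul_eq hk
  rcases direction_cases k with h | ⟨h, -⟩
  · rw [h] at hx'
    have hr1 : r = 1 := by nlinarith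
    rw [hr1, Complex.ofReal_one, one_mul] at hk
    exact X.2 k (by rw [hX, hk])
  · nlinarith

theorem halfTwistAngle_of_ge {s : ℝ} (h : 3 / 4 ≤ s) : halfTwistAngle s = 0 := by
  rw [halfTwistAngle, min_eq_right (by linarith), max_eq_left (by linarith), mul_zero]

theorem cos_halfTwistAngle_nonneg {s : ℝ} (h : 5 / 8 ≤ s) : 0 ≤ Real.cos (halfTwistAngle s) := by
  have hpi := Real.pi_pos
  have h1 : max 0 (min 1 (3 - 4 * s)) ≤ 1 / 2 :=
    max_le (by norm_num) ((min_le_right _ _).trans (by linarith))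
  have h2 : 0 ≤ max 0 (min 1 (3 - 4 * s)) := le_max_left _ _
  apply Real.cos_nonneg_of_neg_pi_div_two_le_of_le <;> unfold halfTwistAngle <;> nlinarith

theorem cos_halfTwistAngle_nonpos {s : ℝ} (h : s ≤ 5 / 8) : Real.cos (halfTwistAngle s) ≤ 0 := by
  have hpi := Real.pi_pos
  have h1 : 1 / 2 ≤ max 0 (min 1 (3 - 4 * s)) :=
    le_max_of_le_right (le_min (by norm_num) (by linarith))
  have h2 : max 0 (min 1 (3 - 4 * s)) ≤ 1 := max_le zero_le_one (min_le_left _ _)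
  rw [halfTwistAngle, neg_mul, Real.cos_neg]
  apply Real.cos_nonpos_of_pi_div_two_le_of_le <;> nlinarith

theorem abs_mul_sin_halfTwistAngle_le (u : ℝ) : |u * Real.sin (halfTwistAngle |u|)| ≤ 3 / 4 := by
  by_cases h : 3 / 4 ≤ |u|
  · rw [halfTwistAngle_of_ge h, Real.sin_zero, mul_zero, abs_zero]; norm_num
  · rw [abs_mul]
    have := Real.abs_sin_le_one (halfTwistAngle |u|)
    nlinarith [abs_nonneg u, abs_nonneg (Real.sin (halfTwistAngle |u|))]

/-- The half-twist that exchanges `p_0` and `p_1`, on the axis. -/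
theorem coe_halfTwist_axis {X : S} {x : ℝ} (hX : X.1 = ((axis * (x : ℝ) : ℂ) : OnePoint ℂ)) :
    (halfTwist 0 X).1 = ((axis * (((apothem + (x - apothem) *
      Real.cos (halfTwistAngle |x - apothem|) : ℝ) : ℂ) +
      ((x - apothem) * Real.sin (halfTwistAngle |x - apothem|) : ℝ) * Complex.I) : ℂ) :
        OnePoint ℂ) := by
  rw [halfTwist, coe_liftHomeo hX]
  congr 1
  change midpt 0 + (axis * (x : ℝ) - midpt 0) *
    Complex.exp ((halfTwistAngle ‖axis * (x : ℝ) - midpt 0‖ : ℝ) * Complex.I) = _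
  have h1 : axis * (x : ℝ) - midpt 0 = axis * ((x - apothem : ℝ) : ℂ) := by
    rw [midpt_zero_eq]; push_cast; ring
  rw [h1, norm_mul, norm_axis, one_mul, Complex.norm_real, Real.norm_eq_abs, Complex.exp_mul_I,
    ← Complex.ofReal_cos, ← Complex.ofReal_sin, midpt_zero_eq]
  push_cast
  ring

theorem inFront_halfTwist_axis {X : S} {x : ℝ} (hX : X.1 = ((axis * (x : ℝ) : ℂ) : OnePoint ℂ))
    (hx0 : 0 ≤ x) (hx : x ≤ apothem - 5 / 8 ∨ apothem ≤ x ∧ x ≤ apothem + 5 / 8) :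
    InFront (halfTwist 0 X) := by
  have hc := lt_apothem
  have hcos := Real.neg_one_le_cos (halfTwistAngle |x - apothem|)
  have hcos' := Real.cos_le_one (halfTwistAngle |x - apothem|)
  refine inFront_of_le_apothem (coe_halfTwist_axis hX) ?_ ?_ (abs_mul_sin_halfTwistAngle_le _)
  · rcases hx with hx | ⟨h, h'⟩ <;> nlinarith
  · rcases hx with hx | ⟨h, h'⟩
    · have := cos_halfTwistAngle_nonneg (s := |x - apothem|) (by
        rw [abs_of_nonpos (by linarith)]; linarith)
      nlinarith
    · have := cos_halfTwistAngle_nonpos (s := |x - apothem|) (by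
        rw [abs_of_nonneg (by linarith)]; linarith)
      nlinarith

theorem inBack_halfTwist_axis {X : S} {x : ℝ} (hX : X.1 = ((axis * (x : ℝ) : ℂ) : OnePoint ℂ))
    (hx : (apothem - 5 / 8 ≤ x ∧ x ≤ apothem) ∨ apothem + 5 / 8 ≤ x) :
    InBack (halfTwist 0 X) := by
  refine inBack_of_apothem_le (coe_halfTwist_axis hX) ?_
  rcases hx with ⟨h, h'⟩ | hx
  · have := cos_halfTwistAngle_nonpos (s := |x - apothem|) (by
      rw [abs_of_nonpos (by linarith)]; linarith)
    nlinarith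
  · have := cos_halfTwistAngle_nonneg (s := |x - apothem|) (by
      rw [abs_of_nonneg (by linarith)]; linarith)
    nlinarith

theorem halfTwistAngle_five_eighths : halfTwistAngle (5 / 8) = -(Real.pi / 2) := by
  rw [halfTwistAngle, min_eq_right (by norm_num), max_eq_right (by norm_num)]; ring

/-- The points where the spirals that are the images of the axis cross from the front to the
back. -/
theorem exists_polar_apothem : ∃ r a : ℝ, 0 < r ∧ Real.pi / 7 < a ∧ a < 3 * Real.pi / 7 ∧
    apothem = r * Real.cos a ∧ 5 / 8 = r * Real.sin a := by
  have hc := lt_apothem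
  have hpi := Real.pi_pos
  have hpi' := Real.pi_lt_d2
  set a := Real.arctan (5 / 8 / apothem) with ha
  have hcos : 0 < Real.cos a := Real.cos_arctan_pos _
  have htan : Real.tan a = 5 / 8 / apothem := Real.tan_arctan _
  refine ⟨apothem / Real.cos a, a, by positivity, ?_, ?_, by field_simp, ?_⟩
  · rw [← Real.arctan_tan (x := Real.pi / 7) (by linarith) (by linarith)]
    apply Real.arctan_strictMono
    rw [Real.tan_eq_sin_div_cos]
    have : Real.sin (Real.pi / 7) < 5 / 8 :=
      (Real.sin_lt (by positivity)).trans (by linarith)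
    exact div_lt_div_of_pos_right this (by change 0 < apothem; linarith)
  · have h1 : a < Real.arctan 1 := by
      apply Real.arctan_strictMono
      rw [div_lt_one (by linarith)]
      linarith
    rw [Real.arctan_one] at h1
    linarith
  · rw [div_mul_eq_mul_div, mul_div_assoc, ← Real.tan_eq_sin_div_cos, htan]
    field_simp

theorem inSector_one {X : S}
    (hX : X.1 = ((axis * ((apothem : ℝ) + (5 / 8 : ℝ) * Complex.I) : ℂ) : OnePoint ℂ)) :
    InSector 1 X := by
  obtain ⟨r, a, hr, h1, h2, hx, hy⟩ := exists_polar_apothem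
  have hpi := Real.pi_pos
  refine ⟨1, r, 1 / 2 + 7 * a / (2 * Real.pi), by norm_num, hr, ?_, ?_, ?_⟩
  · push_cast; field_simp; linarith
  · push_cast; field_simp; linarith
  · rw [hX, polar_eq_axis_mul]
    have : 2 * Real.pi * (1 / 2 + 7 * a / (2 * Real.pi) - 1 / 2) / 7 = a := by field_simp; ring
    rw [this, ← hx, ← hy]

theorem inSector_six {X : S}
    (hX : X.1 = ((axis * ((apothem : ℝ) + (-(5 / 8) : ℝ) * Complex.I) : ℂ) : OnePoint ℂ)) :
    InSector 6 X := by
  obtain ⟨r, a, hr, h1, h2, hx, hy⟩ := exists_polar_apothem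
  have hpi := Real.pi_pos
  refine ⟨-1, r, 1 / 2 - 7 * a / (2 * Real.pi), by decide, hr, ?_, ?_, ?_⟩
  · push_cast; field_simp; linarith
  · push_cast; field_simp; linarith
  · rw [hX, polar_eq_axis_mul]
    have : 2 * Real.pi * (1 / 2 - 7 * a / (2 * Real.pi) - 1 / 2) / 7 = -a := by field_simp; ring
    rw [this, Real.cos_neg, Real.sin_neg, mul_neg, ← hx, ← hy]

/-- The half-twist does not move the rays that stay away from the axis. -/
theorem halfTwist_zero_polar {X : S} {r θ : ℝ} (hX : X.1 = ((polar r θ : ℂ) : OnePoint ℂ))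
    (hr : 0 ≤ r) (hθ : Real.cos (2 * Real.pi * (θ - 1 / 2) / 7) ≤ 1 / 2) : halfTwist 0 X = X := by
  refine Subtype.ext ?_
  rw [halfTwist, coe_liftHomeo hX, twist_of_ge, hX]
  have hc := lt_apothem
  have h1 : polar r θ - midpt 0 = axis *
      ((r * Real.cos (2 * Real.pi * (θ - 1 / 2) / 7) - apothem : ℝ) +
        (r * Real.sin (2 * Real.pi * (θ - 1 / 2) / 7) : ℝ) * Complex.I) := by
    rw [midpt_zero_eq, polar_eq_axis_mul]; push_cast; ring
  rw [h1, norm_mul, norm_axis, one_mul]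
  have h2 := Complex.sq_norm (((r * Real.cos (2 * Real.pi * (θ - 1 / 2) / 7) - apothem : ℝ) : ℂ) +
    (r * Real.sin (2 * Real.pi * (θ - 1 / 2) / 7) : ℝ) * Complex.I)
  rw [Complex.normSq_add_mul_I] at h2
  have h3 := Real.sin_sq_add_cos_sq (2 * Real.pi * (θ - 1 / 2) / 7)
  refine le_of_sq_le_sq ?_ (norm_nonneg _)
  rw [h2]
  set C := Real.cos (2 * Real.pi * (θ - 1 / 2) / 7)
  set D := Real.sin (2 * Real.pi * (θ - 1 / 2) / 7)
  have h4 : (r * C - apothem) ^ 2 + (r * D) ^ 2 = r ^ 2 + apothem ^ 2 - 2 * r * apothem * C := by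
    linear_combination r ^ 2 * h3
  rw [h4]
  have h5 : r * apothem * C ≤ r * apothem * (1 / 2) :=
    mul_le_mul_of_nonneg_left hθ (by positivity)
  nlinarith [sq_nonneg (r - apothem / 2)]

theorem halfTwist_inftyPt (k : ZMod 7) : halfTwist k inftyPt = inftyPt := liftHomeo_inftyPt

theorem halfTwist_eq_conj (k : ZMod 7) : halfTwist k = rot k * halfTwist 0 * (rot k)⁻¹ := by
  rw [eq_mul_inv_iff_mul_eq]
  refine Homeomorph.ext fun x => ?_
  change halfTwist k (rot k x) = rot k (halfTwist 0 x)
  by_cases hx : x = inftyPt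
  · rw [hx, rot_inftyPt, halfTwist_inftyPt, halfTwist_inftyPt, rot_inftyPt]
  obtain ⟨z, hz⟩ : ∃ z : ℂ, (z : OnePoint ℂ) = x.1 := OnePoint.ne_infty_iff_exists.1 fun h =>
    hx (Subtype.ext (by rw [h, coe_inftyPt]))
  refine Subtype.ext ?_
  have h1 : (halfTwist 0 x).1 = _ := coe_liftHomeo hz.symm
  have h2 : (halfTwist k (rot k x)).1 = _ := coe_liftHomeo (coe_rot k hz.symm)
  rw [coe_rot k h1, h2]
  congr 1
  have hm : midpt k = puncture k * midpt 0 := by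
    rw [midpt, midpt, puncture_add, zero_add, puncture_zero]; ring
  change midpt k + (puncture k * z - midpt k) *
      Complex.exp ((halfTwistAngle ‖puncture k * z - midpt k‖ : ℝ) * Complex.I) =
    puncture k * (midpt 0 + (z - midpt 0) *
      Complex.exp ((halfTwistAngle ‖z - midpt 0‖ : ℝ) * Complex.I))
  rw [hm, ← mul_sub, norm_mul, norm_puncture, one_mul]
  ring

theorem halfTwist_zeroPt (k : ZMod 7) : halfTwist k zeroPt = zeroPt := by
  have h0 : halfTwist 0 zeroPt = zeroPt := by
    refine halfTwist_zero_polar (r := 0) (θ := 2 + 1 / 4) ?_ le_rfl ?_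
    · rw [coe_zeroPt]; simp [polar]
    · have : 2 * Real.pi * (2 + 1 / 4 - 1 / 2) / 7 = Real.pi / 2 := by ring
      rw [this, Real.cos_pi_div_two]; norm_num
  rw [halfTwist_eq_conj]
  change rot k (halfTwist 0 ((rot k).symm zeroPt)) = _
  rw [(Homeomorph.symm_apply_eq _).2 (rot_zeroPt k).symm, h0, rot_zeroPt]

/-- The end in the unit circle of the ray at the angle `θ`. -/
noncomputable def rayPt (θ : ℝ) (h : ∀ n : ℤ, θ ≠ n) : frontSet :=
  ⟨polar 1 θ, polar_mem_frontSet zero_le_one fun n hn => absurd hn (h n)⟩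

theorem neg_ne_int {θ : ℝ} (h : ∀ n : ℤ, θ ≠ n) (n : ℤ) : -θ ≠ n := fun hn =>
  h (-n) (by push_cast; linarith)

theorem flip_rayPt {θ : ℝ} (h : ∀ n : ℤ, θ ≠ n) :
    flip (frontIncl (rayPt (-θ) (neg_ne_int h))) = frontIncl (rayPt θ h) := by
  refine Subtype.ext ?_
  have h1 : (frontIncl (rayPt (-θ) (neg_ne_int h))).1 = ((polar 1 (-θ) : ℂ) : OnePoint ℂ) := rfl
  rw [coe_flip, h1, inversion_coe (polar_ne_zero one_ne_zero _), inv_polar, inv_one, neg_neg]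
  rfl

/-- The part of a ray that leads from `∞` to the unit circle. -/
noncomputable def outerRay (θ : ℝ) (h : ∀ n : ℤ, θ ≠ n) :
    Path inftyPt (frontIncl (rayPt θ h)) :=
  ((radius (rayPt (-θ) (neg_ne_int h))).map flip.continuous).cast rfl (flip_rayPt h).symm

theorem coe_radius_rayPt {θ : ℝ} (h : ∀ n : ℤ, θ ≠ n) (t : I) :
    (radius (rayPt θ h) t).1 = ((polar (t : ℝ) θ : ℂ) : OnePoint ℂ) := by
  change (((t : ℝ) * polar 1 θ : ℂ) : OnePoint ℂ) = _
  simp [polar]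

theorem coe_outerRay {θ : ℝ} (h : ∀ n : ℤ, θ ≠ n) {t : I} (ht : 0 < (t : ℝ)) :
    (outerRay θ h t).1 = ((polar (t : ℝ)⁻¹ θ : ℂ) : OnePoint ℂ) := by
  change (flip (radius (rayPt (-θ) (neg_ne_int h)) t)).1 = _
  rw [coe_flip, coe_radius_rayPt, inversion_coe (polar_ne_zero ht.ne' _), inv_polar, neg_neg]

theorem outerRay_zero {θ : ℝ} (h : ∀ n : ℤ, θ ≠ n) : outerRay θ h 0 = inftyPt :=
  (outerRay θ h).source

theorem inFront_radius (z : frontSet) (t : I) : InFront (radius z t) := ⟨_, rfl⟩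

theorem inBack_outerRay {θ : ℝ} (h : ∀ n : ℤ, θ ≠ n) (t : I) : InBack (outerRay θ h t) := by
  change InFront (flip (flip (radius (rayPt (-θ) (neg_ne_int h)) t)))
  rw [flip_flip]
  exact inFront_radius _ t

/-- Each ray in a sector represents the class of the arc. -/
theorem arc_eq_ray {k : ZMod 7} {n : ℤ} {θ : ℝ} (hn : (n : ZMod 7) = k) (h1 : n < θ)
    (h2 : θ < n + 1) (h : ∀ n : ℤ, θ ≠ n) :
    arc k = cls (radius (rayPt θ h)) ≫ inv (cls (outerRay θ h)) := by
  have hs : InSector k (frontIncl (rayPt θ h)) := ⟨n, 1, θ, hn, one_pos, h1, h2, rfl⟩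
  rw [arc_eq hs hs.inFront hs.inBack, front_eq hs.inFront (radius (rayPt θ h)) (inFront_radius _),
    back_eq hs.inBack (outerRay θ h) (inBack_outerRay h)]

theorem push_halfTwist_arc_of_cos_le {k : ZMod 7} {n : ℤ} {θ : ℝ} (hn : (n : ZMod 7) = k)
    (h1 : n < θ) (h2 : θ < n + 1) (hθ : Real.cos (2 * Real.pi * (θ - 1 / 2) / 7) ≤ 1 / 2) :
    push (cm (halfTwist 0)) (halfTwist_zeroPt 0) (halfTwist_inftyPt 0) (arc k) = arc k := by
  have h : ∀ n : ℤ, θ ≠ n := fun _ => ne_int_of_lt h1 h2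
  have hP : cm (halfTwist 0) (frontIncl (rayPt θ h)) = frontIncl (rayPt θ h) :=
    halfTwist_zero_polar (r := 1) rfl zero_le_one hθ
  rw [arc_eq_ray hn h1 h2 h, push_comp _ _ hP, push_inv]
  congr 2
  · refine push_cls _ _ _ fun t => (halfTwist_zero_polar (coe_radius_rayPt h t) t.2.1 hθ).symm
  · refine push_cls _ _ _ fun t => ?_
    by_cases ht : t = 0
    · rw [ht, outerRay_zero]; exact (halfTwist_inftyPt 0).symm
    · have ht' : 0 < (t : ℝ) := unitInterval.pos_iff_ne_zero.2 ht
      exact (halfTwist_zero_polar (coe_outerRay h ht') (by positivity) hθ).symm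

theorem push_halfTwist_zero_arc_of_ne {k : ZMod 7} (hk : k ≠ 0) :
    push (cm (halfTwist 0)) (halfTwist_zeroPt 0) (halfTwist_inftyPt 0) (arc k) = arc k := by
  have hpi := Real.pi_pos
  have hk' : k = 1 ∨ k = 2 ∨ k = 3 ∨ k = 4 ∨ k = 5 ∨ k = 6 := by revert hk; revert k; decide
  rcases hk' with rfl | rfl | rfl | rfl | rfl | rfl
  -- The rays in the two adjacent sectors are chosen off the middle, to stay clear of the
  -- support of the half-twist.
  · refine push_halfTwist_arc_of_cos_le (n := 1) (θ := 5 / 3) (by decide) (by norm_num)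
      (by norm_num) ?_
    rw [show 2 * Real.pi * (5 / 3 - 1 / 2) / 7 = Real.pi / 3 by ring, Real.cos_pi_div_three]
  · refine push_halfTwist_arc_of_cos_le (n := 2) (θ := 5 / 2) (by decide) (by norm_num)
      (by norm_num) ?_
    have := Real.cos_nonpos_of_pi_div_two_le_of_le
      (x := 2 * Real.pi * (5 / 2 - 1 / 2) / 7) (by linarith) (by linarith)
    linarith
  · refine push_halfTwist_arc_of_cos_le (n := 3) (θ := 7 / 2) (by decide) (by norm_num)
      (by norm_num) ?_
    have := Real.cos_nonpos_of_pi_div_two_le_of_le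
      (x := 2 * Real.pi * (7 / 2 - 1 / 2) / 7) (by linarith) (by linarith)
    linarith
  · refine push_halfTwist_arc_of_cos_le (n := 4) (θ := 9 / 2) (by decide) (by norm_num)
      (by norm_num) ?_
    have := Real.cos_nonpos_of_pi_div_two_le_of_le
      (x := 2 * Real.pi * (9 / 2 - 1 / 2) / 7) (by linarith) (by linarith)
    linarith
  · refine push_halfTwist_arc_of_cos_le (n := 5) (θ := 11 / 2) (by decide) (by norm_num)
      (by norm_num) ?_
    have := Real.cos_nonpos_of_pi_div_two_le_of_le
      (x := 2 * Real.pi * (11 / 2 - 1 / 2) / 7) (by linarith) (by linarith)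
    linarith
  · refine push_halfTwist_arc_of_cos_le (n := 6) (θ := 19 / 3) (by decide) (by norm_num)
      (by norm_num) ?_
    rw [show 2 * Real.pi * (19 / 3 - 1 / 2) / 7 = 2 * Real.pi - Real.pi / 3 by ring,
      Real.cos_two_pi_sub, Real.cos_pi_div_three]

theorem half_ne_int (n : ℤ) : (1 / 2 : ℝ) ≠ n :=
  ne_int_of_lt (n := 0) (by norm_num) (by norm_num)

theorem polar_half (r : ℝ) : polar r (1 / 2) = axis * (r : ℝ) := by
  simp [axis, polar]; ring

/-- The half-twist that exchanges `p_0` and `p_1` takes the ray between them to a path that passes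
from the front to the back behind `p_1`, returns between the two punctures, and passes to the
back again behind `p_0`. -/
theorem push_halfTwist_zero_arc :
    push (cm (halfTwist 0)) (halfTwist_zeroPt 0) (halfTwist_inftyPt 0) (arc 0) =
      arc 1 ≫ inv (arc 0) ≫ arc 6 := by
  have hc := lt_apothem
  have hc' := apothem_lt
  set z := rayPt (1 / 2) half_ne_int
  have hX : (frontIncl z).1 = ((axis * (1 : ℝ) : ℂ) : OnePoint ℂ) := by
    rw [← polar_half]; rfl
  have hXF : InFront (halfTwist 0 (frontIncl z)) :=
    inFront_halfTwist_axis hX zero_le_one (Or.inr ⟨by linarith, by linarith⟩)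
  have hr : ∀ t : I, (radius z t).1 = ((axis * (t : ℝ) : ℂ) : OnePoint ℂ) := fun t => by
    rw [← polar_half]; exact coe_radius_rayPt half_ne_int t
  have ho : ∀ t : I, 0 < (t : ℝ) → (outerRay (1 / 2) half_ne_int t).1 =
      ((axis * ((t : ℝ)⁻¹ : ℝ) : ℂ) : OnePoint ℂ) := fun t ht => by
    rw [← polar_half]; exact coe_outerRay half_ne_int ht
  -- the part of the ray inside the unit circle
  have e1 : push (cm (halfTwist 0)) (halfTwist_zeroPt 0) rfl (cls (radius z)) =
      arc 1 ≫ inv (arc 0) ≫ front hXF := by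
    let p : Path zeroPt (cm (halfTwist 0) (frontIncl z)) :=
      ((radius z).map (cm (halfTwist 0)).continuous).cast (halfTwist_zeroPt 0).symm rfl
    have hp : ∀ t, p t = halfTwist 0 (radius z t) := fun _ => rfl
    rw [push_cls (cm (halfTwist 0)) (halfTwist_zeroPt 0) rfl (q := p) fun t => rfl]
    have hs : (apothem - 5 / 8) ∈ I := ⟨by linarith, by linarith⟩
    have ht : apothem ∈ I := ⟨by linarith, by linarith⟩
    have e := front_comp_front_back_front inFront_zeroPt hXF p (s := ⟨_, hs⟩) (t := ⟨_, ht⟩)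
      (k := 1) (j := 0) (Subtype.mk_le_mk.2 (by linarith)) ?_ ?_ ?_ ?_ ?_
    · rw [front_zeroPt, Category.id_comp] at e
      exact e
    · intro r hr'
      exact inFront_halfTwist_axis (hr r) r.2.1 (Or.inl hr')
    · intro r hr1 hr2
      exact inBack_halfTwist_axis (hr r) (Or.inl ⟨hr1, hr2⟩)
    · intro r hr'
      exact inFront_halfTwist_axis (hr r) r.2.1 (Or.inr ⟨hr', by linarith [r.2.2]⟩)
    · apply inSector_one
      rw [hp, coe_halfTwist_axis (hr _)]
      have h1 : apothem - 5 / 8 - apothem = -(5 / 8) := by ring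
      rw [Subtype.coe_mk, h1, abs_neg, abs_of_pos (by norm_num), halfTwistAngle_five_eighths,
        Real.cos_neg, Real.sin_neg, Real.cos_pi_div_two, Real.sin_pi_div_two]
      norm_num
    · refine ⟨0, apothem, 1 / 2, by simp, by linarith, by norm_num, by norm_num, ?_⟩
      rw [hp, coe_halfTwist_axis (hr _), polar_half]
      simp
  -- the part outside the unit circle
  have e2 : push (cm (halfTwist 0)) (halfTwist_inftyPt 0) rfl
      (cls (outerRay (1 / 2) half_ne_int)) = inv (arc 6) ≫ front hXF := by
    let p : Path inftyPt (cm (halfTwist 0) (frontIncl z)) :=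
      ((outerRay (1 / 2) half_ne_int).map (cm (halfTwist 0)).continuous).cast
        (halfTwist_inftyPt 0).symm rfl
    have hp : ∀ t, p t = halfTwist 0 (outerRay (1 / 2) half_ne_int t) := fun _ => rfl
    rw [push_cls (cm (halfTwist 0)) (halfTwist_inftyPt 0) rfl (q := p) fun t => rfl]
    have hpos : 0 < apothem + 5 / 8 := by linarith
    have hs : (apothem + 5 / 8)⁻¹ ∈ I := ⟨by positivity, inv_le_one_of_one_le₀ (by linarith)⟩
    have e := back_comp_back_front inBack_inftyPt hXF p (s := ⟨_, hs⟩) (k := 6) ?_ ?_ ?_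
    · rw [back_inftyPt, Category.id_comp] at e
      exact e
    · intro r hr'
      by_cases hr0 : r = 0
      · rw [hr0, p.source]; exact inBack_inftyPt
      have hr0' : 0 < (r : ℝ) := unitInterval.pos_iff_ne_zero.2 hr0
      exact inBack_halfTwist_axis (ho r hr0') (Or.inr ((le_inv_comm₀ hpos hr0').2 hr'))
    · intro r hr'
      have hr0' : 0 < (r : ℝ) := lt_of_lt_of_le (by positivity) (Subtype.coe_le_coe.2 hr')
      refine inFront_halfTwist_axis (ho r hr0') (by positivity) (Or.inr ⟨?_, ?_⟩)
      · exact hc'.le.trans ((one_le_inv₀ hr0').2 r.2.2)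
      · exact (inv_le_comm₀ hr0' hpos).2 hr'
    · apply inSector_six
      rw [hp, coe_halfTwist_axis (ho _ (by positivity))]
      have h1 : apothem + 5 / 8 - apothem = 5 / 8 := by ring
      rw [Subtype.coe_mk, inv_inv, h1, abs_of_pos (by norm_num), halfTwistAngle_five_eighths,
        Real.cos_neg, Real.sin_neg, Real.cos_pi_div_two, Real.sin_pi_div_two]
      norm_num
  have e0 := arc_eq_ray (k := 0) (n := 0) (by simp) (by norm_num) (by norm_num) half_ne_int
  have e3 := push_comp (cm (halfTwist 0)) (halfTwist_zeroPt 0) rfl (halfTwist_inftyPt 0)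
    (cls (radius z)) (inv (cls (outerRay (1 / 2) half_ne_int)))
  rw [← e0, push_inv, e1, e2] at e3
  rw [e3]
  simp

/-- The classes of the arcs, as values of the action of a homeomorphism that fixes `0` and `∞`. -/
theorem push_inv_rot_arc (k j : ZMod 7) (h0 : cm (rot k)⁻¹ zeroPt = zeroPt)
    (hi : cm (rot k)⁻¹ inftyPt = inftyPt) :
    push (cm (rot k)⁻¹) h0 hi (arc (j + k)) = arc j := by
  rw [← push_rot_arc, push_push]
  exact push_of_eq_id _ (fun x => (rot k).symm_apply_apply x) _

theorem push_halfTwist (k j : ZMod 7) :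
    push (cm (halfTwist k)) (halfTwist_zeroPt k) (halfTwist_inftyPt k) (arc j) =
      if j = k then arc (k + 1) ≫ inv (arc k) ≫ arc (k - 1) else arc j := by
  have h0 : cm (rot k)⁻¹ zeroPt = zeroPt :=
    (Homeomorph.symm_apply_eq _).2 (rot_zeroPt k).symm
  have hi : cm (rot k)⁻¹ inftyPt = inftyPt :=
    (Homeomorph.symm_apply_eq _).2 (rot_inftyPt k).symm
  have e : cm (halfTwist k) = (cm (rot k)).comp ((cm (halfTwist 0)).comp (cm (rot k)⁻¹)) := by
    ext1 x
    exact congrArg (fun φ : S ≃ₜ S => φ x) (halfTwist_eq_conj k)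
  have e' : push (cm (halfTwist k)) (halfTwist_zeroPt k) (halfTwist_inftyPt k) (arc j) =
      push (cm (rot k)) (rot_zeroPt k) (rot_inftyPt k)
        (push (cm (halfTwist 0)) (halfTwist_zeroPt 0) (halfTwist_inftyPt 0)
          (push (cm (rot k)⁻¹) h0 hi (arc j))) := by
    rw [push_push, push_push]
    congr 1
  obtain ⟨i, rfl⟩ : ∃ i, j = i + k := ⟨j - k, by ring⟩
  rw [e', push_inv_rot_arc]
  by_cases hi0 : i = 0
  · subst hi0
    rw [push_halfTwist_zero_arc, push_comp _ _ (rot_inftyPt k), push_comp _ _ (rot_zeroPt k),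
      push_inv, push_rot_arc, push_rot_arc, push_rot_arc, zero_add, if_pos rfl]
    have h1 : 1 + k = k + 1 := by ring
    have h6 : 6 + k = k - 1 := by
      have : (6 : ZMod 7) = -1 := by decide
      rw [this]; ring
    rw [h1, h6]
  · rw [push_halfTwist_zero_arc_of_ne hi0, push_rot_arc, if_neg]
    intro h
    exact hi0 (by simpa using h)

end SevenPuncturedSphere

namespace SevenPuncturedSphere

/-! ### The combinatorics of the track -/

/-- The puncture next to the switch where an oriented branch starts. -/
def ini : OBranch → ZMod 7
  | (Sum.inl k, _) => k
  | (Sum.inr i, true) => (start i : ZMod 7)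
  | (Sum.inr i, false) => (start i : ZMod 7) + (shift i : ZMod 7)

/-- Whether a branch is one of the loops around the punctures. -/
def isLoop (x : OBranch) : Bool := x.1.isLeft

/-- The smooth continuations, in combinatorial terms: at each switch, the ends of the loop are on
one side and the ends of the nine other branches are on the other side. -/
def Cont (x y : OBranch) : Prop := ini x.rev = ini y ∧ isLoop x ≠ isLoop y

instance : DecidableRel Cont := fun x y => by unfold Cont; infer_instance

/-- The switch next to the puncture `p_k`. -/
noncomputable def switch (k : ZMod 7) : ℂ := polar (9 / 10) k.val

theorem polar_intCast (r : ℝ) (n : ℤ) : polar r n = polar r ((n : ZMod 7).val : ℝ) := by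
  have h : ((n : ZMod 7).val : ℤ) = n % 7 := ZMod.val_intCast n
  have h2 := Int.emod_add_mul_ediv n 7
  have h3 : (n : ℝ) = ((n : ZMod 7).val : ℝ) + 7 * (n / 7 : ℤ) := by
    have : n = ((n : ZMod 7).val : ℤ) + 7 * (n / 7) := by omega
    exact_mod_cast this
  conv_lhs => rw [h3, polar_add]

theorem initPt_eq (x : OBranch) : initPt x = switch (ini x) := by
  obtain ⟨k | i, _ | _⟩ := x
  · simp [initPt, curve, modulus, angle, switch, ini]
  · simp [initPt, curve, modulus, angle, switch, ini]
  · have : (start i : ℝ) + (shift i : ℝ) = ((start i + shift i : ℤ) : ℝ) := by push_cast; rfl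
    simp only [initPt, curve, modulus, angle, switch, ini]
    norm_num
    rw [this, polar_intCast]; push_cast; rfl
  · have : (start i : ℝ) = ((start i : ℤ) : ℝ) := by push_cast; rfl
    simp only [initPt, curve, modulus, angle, switch, ini]
    norm_num
    rw [this, polar_intCast]; push_cast; rfl

theorem switch_injective : Function.Injective switch := by
  intro j k h
  obtain ⟨-, n, hn⟩ := exists_eq_of_polar_eq (by norm_num) (by norm_num) h
  have h1 : (j.val : ℤ) = k.val + 7 * n := by exact_mod_cast hn
  have hj := j.val_lt
  have hk := k.val_lt
  exact ZMod.val_injective 7 (by omega)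

/-- The derivative of the modulus along a branch. -/
noncomputable def modulusDeriv : Branch → ℝ → ℝ
  | Sum.inl _, t => 4 / 5 * (1 - 2 * t)
  | Sum.inr i, t => -(dip i * (1 - 2 * t)) +
      bulge i * (5 * t ^ 4 * (1 - t) ^ 3 - 3 * t ^ 5 * (1 - t) ^ 2)

/-- The derivative of the angle along a branch. -/
noncomputable def angleDeriv : Branch → ℝ → ℝ
  | Sum.inl _, t => 16 * (t * (1 - t)) * ((1 - 2 * t) ^ 2 - t * (1 - t))
  | Sum.inr i, t => (shift i : ℝ) * (6 * (t * (1 - t)))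

theorem hasDerivAt_modulus (b : Branch) (t : ℝ) :
    HasDerivAt (modulus b) (modulusDeriv b t) t := by
  have h1 : HasDerivAt (fun t : ℝ => 1 - t) (-1) t := by
    simpa using (hasDerivAt_id t).const_sub 1
  have h2 : HasDerivAt (fun t : ℝ => t * (1 - t)) (1 * (1 - t) + t * (-1)) t :=
    (hasDerivAt_id t).mul h1
  cases b with
  | inl k =>
    convert! (h2.const_mul (4 / 5)).const_add (9 / 10) using 1
    simp only [modulusDeriv]; ring
  | inr i =>
    convert! ((h2.const_mul (dip i)).const_sub (9 / 10)).add
      (((hasDerivAt_pow 5 t).mul (h1.pow 3)).const_mul (bulge i)) using 1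
    simp only [modulusDeriv, Pi.pow_apply]; push_cast; ring

theorem hasDerivAt_angle (b : Branch) (t : ℝ) :
    HasDerivAt (angle b) (angleDeriv b t) t := by
  have h1 : HasDerivAt (fun t : ℝ => 1 - t) (-1) t := by
    simpa using (hasDerivAt_id t).const_sub 1
  have h2 : HasDerivAt (fun t : ℝ => t * (1 - t)) (1 * (1 - t) + t * (-1)) t :=
    (hasDerivAt_id t).mul h1
  have h3 : HasDerivAt (fun t : ℝ => 1 - 2 * t) (-(2 * 1)) t :=
    ((hasDerivAt_id t).const_mul 2).const_sub 1
  cases b with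
  | inl k =>
    convert! (((h2.pow 2).mul h3).const_mul 8).const_add (k.val : ℝ) using 1
    simp only [angleDeriv, Pi.pow_apply]; push_cast; ring
  | inr i =>
    convert! ((((hasDerivAt_pow 2 t).const_mul 3).sub
      ((hasDerivAt_pow 3 t).const_mul 2)).const_mul (shift i : ℝ)).const_add (start i : ℝ) using 1
    simp only [angleDeriv]; push_cast; ring

theorem hasDerivAt_curve (b : Branch) (t : ℝ) :
    HasDerivAt (curve b) (polar 1 (angle b t) *
      ((modulusDeriv b t : ℝ) +
        (modulus b t * (2 * Real.pi * angleDeriv b t / 7) : ℝ) * Complex.I)) t := by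
  have hm := (hasDerivAt_modulus b t).ofReal_comp
  have ha : HasDerivAt (fun t => ((2 * Real.pi * angle b t / 7 : ℝ) : ℂ) * Complex.I)
      (((2 * Real.pi * angleDeriv b t / 7 : ℝ) : ℂ) * Complex.I) t :=
    ((((hasDerivAt_angle b t).const_mul (2 * Real.pi)).div_const 7).ofReal_comp).mul_const _
  convert! hm.mul ha.cexp using 1
  unfold polar
  push_cast
  ring

/-- The initial velocity of a branch in the direction away from the origin: positive for the loops
and negative for the nine other branches. -/
noncomputable def initSpeed : OBranch → ℝ
  | (Sum.inl _, _) => 4 / 5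
  | (Sum.inr i, _) => -dip i

theorem dip_pos (i : Fin 9) : 0 < dip i := by
  fin_cases i <;> simp [dip]

theorem initSpeed_pos_iff (x : OBranch) : 0 < initSpeed x ↔ isLoop x = true := by
  obtain ⟨k | i, d⟩ := x
  · simp [initSpeed, isLoop]
  · simp [initSpeed, isLoop, (dip_pos i).le]

theorem initSpeed_ne_zero (x : OBranch) : initSpeed x ≠ 0 := by
  obtain ⟨k | i, d⟩ := x
  · simp [initSpeed]
  · simp [initSpeed, (dip_pos i).ne']

theorem initVel_eq (x : OBranch) : initVel x = initSpeed x • puncture (ini x) := by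
  have key : ∀ (b : Branch) (t : ℝ), angleDeriv b t = 0 →
      deriv (curve b) t = modulusDeriv b t * polar 1 (angle b t) := fun b t h => by
    rw [(hasDerivAt_curve b t).deriv, h]; simp [mul_comm]
  rw [Complex.real_smul, puncture]
  obtain ⟨k | i, _ | _⟩ := x
  · simp only [initVel, Bool.false_eq_true, if_false]
    rw [key _ _ (by simp [angleDeriv])]
    simp [modulusDeriv, angle, initSpeed, ini]; norm_num
  · simp only [initVel, if_true]
    rw [key _ _ (by simp [angleDeriv])]
    simp [modulusDeriv, angle, initSpeed, ini]
  · have : (start i : ℝ) + (shift i : ℝ) = ((start i + shift i : ℤ) : ℝ) := by push_cast; rfl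
    simp only [initVel, Bool.false_eq_true, if_false]
    rw [key _ _ (by simp [angleDeriv])]
    simp only [modulusDeriv, angle, initSpeed, ini]
    norm_num
    rw [this, polar_intCast]; push_cast; left; rfl
  · have : (start i : ℝ) = ((start i : ℤ) : ℝ) := by push_cast; rfl
    simp only [initVel, if_true]
    rw [key _ _ (by simp [angleDeriv])]
    simp only [modulusDeriv, angle, initSpeed, ini]
    norm_num
    rw [this, polar_intCast]; push_cast; left; rfl

theorem sameRay_smul_smul_iff {u : ℂ} (hu : u ≠ 0) {a b : ℝ} (ha : a ≠ 0) (hb : b ≠ 0) :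
    SameRay ℝ (a • u) (b • u) ↔ (0 < a ↔ 0 < b) := by
  constructor
  · intro h
    obtain ⟨r, s, hr, hs, h⟩ := h.exists_pos (smul_ne_zero ha hu) (smul_ne_zero hb hu)
    rw [smul_smul, smul_smul] at h
    have h' : r * a = s * b := smul_left_injective ℝ hu h
    rw [← mul_pos_iff_of_pos_left hr, h', mul_pos_iff_of_pos_left hs]
  · intro h
    by_cases h0 : 0 < a
    · exact (SameRay.refl u).nonneg_smul_left h0.le |>.nonneg_smul_right (h.1 h0).le
    · have ha' : 0 ≤ -a := by linarith
      have hb' : 0 ≤ -b := by linarith [mt h.2 h0]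
      have h1 : SameRay ℝ (-(a • u)) (-(b • u)) := by
        rw [← neg_smul, ← neg_smul]
        exact (SameRay.refl u).nonneg_smul_left ha' |>.nonneg_smul_right hb'
      exact sameRay_neg_iff.1 h1

theorem sameRay_initVel_iff {x y : OBranch} (h : ini x = ini y) :
    SameRay ℝ (initVel x) (initVel y) ↔ isLoop x = isLoop y := by
  rw [initVel_eq, initVel_eq, h, sameRay_smul_smul_iff (puncture_ne_zero _) (initSpeed_ne_zero x)
    (initSpeed_ne_zero y), initSpeed_pos_iff, initSpeed_pos_iff]
  cases isLoop x <;> cases isLoop y <;> simp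

theorem sameRay_initVel_neg_iff {x y : OBranch} (h : ini x = ini y) :
    SameRay ℝ (initVel x) (-initVel y) ↔ isLoop x ≠ isLoop y := by
  have h1 : 0 < -initSpeed y ↔ ¬ 0 < initSpeed y := by
    have := initSpeed_ne_zero y
    rw [neg_pos, not_lt]
    exact ⟨le_of_lt, fun h => lt_of_le_of_ne h this⟩
  rw [initVel_eq, initVel_eq, h, ← neg_smul, sameRay_smul_smul_iff (puncture_ne_zero _)
    (initSpeed_ne_zero x) (neg_ne_zero.2 (initSpeed_ne_zero y)), h1, initSpeed_pos_iff,
    initSpeed_pos_iff]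
  cases isLoop x <;> cases isLoop y <;> simp

theorem initPt_eq_iff {x y : OBranch} : initPt x = initPt y ↔ ini x = ini y := by
  rw [initPt_eq, initPt_eq, switch_injective.eq_iff]

theorem continues_iff {x y : OBranch} : Continues x y ↔ Cont x y := by
  unfold Continues Cont
  rw [initPt_eq_iff]
  refine and_congr_right fun h => ?_
  rw [← sameRay_neg_iff, neg_neg, sameRay_initVel_neg_iff h]
  rfl

/-- The sum of the weights of the ends of the nine branches at a switch. -/
def endSum (v : Fin 9 → ℝ) (k : ZMod 7) : ℝ :=
  ∑ i, ((if ini (Sum.inr i, true) = k then v i else 0) +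
    if ini (Sum.inr i, false) = k then v i else 0)

/-- The switch conditions: the loop at a switch has two ends on one side, and all the ends of the nine
branches are on the other side. -/
theorem isTransverse_iff {μ : Branch → ℝ} :
    IsTransverse μ ↔ (∀ b, 0 ≤ μ b) ∧ ∀ k, 2 * μ (Sum.inl k) = endSum (w μ) k := by
  classical
  have h1 : ∀ x : OBranch, ∑ y : OBranch with ini y = ini x ∧ isLoop y = true, μ y.1 =
      2 * μ (Sum.inl (ini x)) := by
    intro x
    rw [Finset.sum_filter, Fintype.sum_prod_type, Fintype.sum_sum_type]
    simp [ini, isLoop, two_mul]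
  have h2 : ∀ x : OBranch, ∑ y : OBranch with ini y = ini x ∧ isLoop y = false, μ y.1 =
      endSum (w μ) (ini x) := by
    intro x
    rw [Finset.sum_filter, Fintype.sum_prod_type, Fintype.sum_sum_type]
    simp [isLoop, endSum, w]
  have e1 : ∀ x : OBranch, (∑ y : OBranch with initPt y = initPt x ∧
      SameRay ℝ (initVel y) (initVel x), μ y.1) =
      ∑ y : OBranch with ini y = ini x ∧ isLoop y = isLoop x, μ y.1 := fun x => by
    congr 1
    refine Finset.filter_congr fun y _ => ?_
    rw [initPt_eq_iff]
    exact and_congr_right sameRay_initVel_iff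
  have e2 : ∀ x : OBranch, (∑ y : OBranch with initPt y = initPt x ∧
      SameRay ℝ (initVel y) (-initVel x), μ y.1) =
      ∑ y : OBranch with ini y = ini x ∧ isLoop y = !isLoop x, μ y.1 := fun x => by
    congr 1
    refine Finset.filter_congr fun y _ => ?_
    rw [initPt_eq_iff]
    refine and_congr_right fun h => ?_
    rw [sameRay_initVel_neg_iff h]
    cases isLoop y <;> cases isLoop x <;> simp
  unfold IsTransverse
  refine and_congr_right fun _ => ⟨fun h k => ?_, fun h x => ?_⟩
  · have := h (Sum.inl k, true)
    rw [e1, e2] at this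
    have hl : isLoop (Sum.inl k, true) = true := rfl
    simp only [hl, Bool.not_true] at this
    rw [h1, h2] at this
    exact this
  · rw [e1, e2]
    cases isLoop x
    · simp only [Bool.not_false]
      rw [h1, h2, h]
    · simp only [Bool.not_true]
      rw [h1, h2, h]

theorem existsUnique_isTransverse (v : Fin 9 → ℝ) (hv : ∀ i, 0 ≤ v i) :
    ∃! μ : Branch → ℝ, IsTransverse μ ∧ w μ = v := by
  refine ⟨Sum.elim (fun k => endSum v k / 2) v, ⟨isTransverse_iff.2 ⟨?_, fun k => ?_⟩, rfl⟩, ?_⟩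
  · rintro (k | i)
    · refine div_nonneg (Finset.sum_nonneg fun i _ => add_nonneg ?_ ?_) (by norm_num) <;>
        split_ifs <;> simp [hv]
    · exact hv i
  · have : w (Sum.elim (fun k => endSum v k / 2) v) = v := rfl
    rw [this, Sum.elim_inl]; ring
  · rintro μ ⟨hμ, rfl⟩
    obtain ⟨-, h⟩ := isTransverse_iff.1 hμ
    ext (k | i)
    · rw [Sum.elim_inl, ← h]; ring
    · rfl

theorem ini_surjective_on_sides (x : OBranch) : ∃ y, ini y = ini x ∧ isLoop y ≠ isLoop x := by
  revert x; decide

/-! ### The track is embedded -/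

/-- The smoothstep function that describes the angle along the nine branches. -/
noncomputable def step (t : ℝ) : ℝ := 3 * t ^ 2 - 2 * t ^ 3

theorem step_lt_step {a b : ℝ} (ha : 0 ≤ a) (hab : a < b) (hb : b ≤ 1) : step a < step b := by
  have h : 0 < (b - a) * (3 * (a + b) - 2 * (a ^ 2 + a * b + b ^ 2)) := by
    apply mul_pos (by linarith)
    nlinarith [mul_nonneg ha (sub_nonneg.2 hb), mul_nonneg ha (by linarith : 0 ≤ 1 - a),
      mul_nonneg (ha.trans hab.le) (sub_nonneg.2 hb)]
  unfold step
  nlinarith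

theorem step_one_sub (t : ℝ) : step (1 - t) = 1 - step t := by unfold step; ring

theorem step_zero : step 0 = 0 := by norm_num [step]

theorem step_one : step 1 = 1 := by norm_num [step]

theorem step_le_step {a b : ℝ} (ha : 0 ≤ a) (hab : a ≤ b) (hb : b ≤ 1) : step a ≤ step b := by
  rcases hab.eq_or_lt with rfl | h
  · exact le_rfl
  · exact (step_lt_step ha h hb).le

theorem step_nonneg {t : ℝ} (ht : t ∈ I) : 0 ≤ step t := by
  have := step_le_step le_rfl ht.1 ht.2; rwa [step_zero] at this

theorem step_le_one {t : ℝ} (ht : t ∈ I) : step t ≤ 1 := by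
  have := step_le_step ht.1 ht.2 le_rfl; rwa [step_one] at this

theorem le_of_step_le {a b : ℝ} (ha : a ∈ I) (hb : b ∈ I) (h : step a ≤ step b) : a ≤ b := by
  by_contra hlt
  exact absurd (step_lt_step hb.1 (not_le.1 hlt) ha.2) (not_lt.2 h)

theorem step_inj {a b : ℝ} (ha : a ∈ I) (hb : b ∈ I) (h : step a = step b) : a = b :=
  le_antisymm (le_of_step_le ha hb h.le) (le_of_step_le hb ha h.ge)

theorem zero_mem_I : (0 : ℝ) ∈ I := ⟨le_rfl, zero_le_one⟩

theorem one_mem_I : (1 : ℝ) ∈ I := ⟨zero_le_one, le_rfl⟩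

/-- A parameter at one of the ends of a branch. -/
def IsEnd (t : ℝ) : Prop := t = 0 ∨ t = 1

theorem isEnd_of_mul_eq_zero {t : ℝ} (h : t * (1 - t) = 0) : IsEnd t := by
  rcases mul_eq_zero.1 h with h | h
  · exact Or.inl h
  · exact Or.inr (by linarith)

theorem one_sub_mem_I {t : ℝ} (ht : t ∈ I) : 1 - t ∈ I := ⟨by linarith [ht.2], by linarith [ht.1]⟩

theorem isEnd_one_sub {t : ℝ} : IsEnd (1 - t) ↔ IsEnd t :=
  ⟨fun h => h.elim (fun h => Or.inr (by linarith)) fun h => Or.inl (by linarith),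
    fun h => h.elim (fun h => Or.inr (by linarith)) fun h => Or.inl (by linarith)⟩

theorem mul_one_sub_nonneg {t : ℝ} (ht : t ∈ I) : 0 ≤ t * (1 - t) :=
  mul_nonneg ht.1 (by linarith [ht.2])

theorem mul_one_sub_le (t : ℝ) : t * (1 - t) ≤ 1 / 4 := by nlinarith [sq_nonneg (1 - 2 * t)]

/-- Two branches over angular intervals that do not overlap meet at most at their ends. -/
theorem isEnd_of_le {u v p q a b : ℝ} (ha : a ∈ I) (hb : b ∈ I) (hp : 0 < p) (hq : 0 < q)
    (h : u + p * step a = v + q * step b) (huv : u + p ≤ v) : IsEnd a ∧ IsEnd b := by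
  have h1 := step_le_one ha
  have h2 := step_nonneg hb
  have h3 : step a = 1 := by nlinarith
  have h4 : step b = 0 := by nlinarith
  exact ⟨Or.inr (step_inj ha one_mem_I (by rw [h3, step_one])),
    Or.inl (step_inj hb zero_mem_I (by rw [h4, step_zero]))⟩

/-- Two branches without bulge that leave the same switch in the same direction, and of which the
longer one dips further, meet at most at their ends: the point where both have the same angle is
further from the origin on the shorter one, since `(1 - t)² / (3 - 2 t)` decreases. -/
theorem isEnd_of_nested {p q d e a b : ℝ} (ha : a ∈ I) (hb : b ∈ I) (hq : 0 < q) (hqp : q < p)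
    (hd : 0 < d) (he : 0 < e) (hde : e ^ 2 * p ≤ d ^ 2 * q)
    (hs : p * step a = q * step b) (hm : d * (a * (1 - a)) = e * (b * (1 - b))) :
    IsEnd a ∧ IsEnd b := by
  by_cases hb0 : b * (1 - b) = 0
  · rw [hb0, mul_zero] at hm
    exact ⟨isEnd_of_mul_eq_zero ((mul_eq_zero.1 hm).resolve_left hd.ne'),
      isEnd_of_mul_eq_zero hb0⟩
  exfalso
  have hsa := step_nonneg ha
  have hsb := step_nonneg hb
  have hb1 : b < 1 := lt_of_le_of_ne hb.2 fun h => hb0 (by rw [h]; ring)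
  have hbpos : 0 < b := lt_of_le_of_ne hb.1 fun h => hb0 (by rw [← h]; ring)
  have hsb' : 0 < step b := by
    have := step_lt_step le_rfl hbpos hb.2; rwa [step_zero] at this
  have hsab : step a < step b := by nlinarith
  have hab : a < b := lt_of_le_of_ne (le_of_step_le ha hb hsab.le) fun h => by
    rw [h] at hsab; exact lt_irrefl _ hsab
  have hapos : 0 < a := lt_of_le_of_ne ha.1 fun h => by
    rw [← h, step_zero] at hs; nlinarith
  have hf : (1 - b) ^ 2 * (3 - 2 * a) < (1 - a) ^ 2 * (3 - 2 * b) := by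
    have : 0 < (b - a) * (4 - 3 * a - 3 * b + 2 * a * b) :=
      mul_pos (by linarith) (by nlinarith)
    nlinarith
  have hm2 : d ^ 2 * (a ^ 2 * (1 - a) ^ 2) = e ^ 2 * (b ^ 2 * (1 - b) ^ 2) := by
    have := congrArg (· ^ 2) hm
    linear_combination this
  have hs2 : p * (a ^ 2 * (3 - 2 * a)) = q * (b ^ 2 * (3 - 2 * b)) := by
    unfold step at hs; linear_combination hs
  have key : (a ^ 2 * (3 - 2 * a)) * (d ^ 2 * q * ((1 - a) ^ 2 * (3 - 2 * b))) =
      (a ^ 2 * (3 - 2 * a)) * (e ^ 2 * p * ((1 - b) ^ 2 * (3 - 2 * a))) := by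
    linear_combination q * (3 - 2 * a) * (3 - 2 * b) * hm2 - e ^ 2 * (1 - b) ^ 2 * (3 - 2 * a) * hs2
  have hne : a ^ 2 * (3 - 2 * a) ≠ 0 := by
    have : 0 < 3 - 2 * a := by linarith [ha.2]
    positivity
  have key2 := mul_left_cancel₀ hne key
  have hp : 0 < p := by linarith
  have h1 : 0 < e ^ 2 * p := by positivity
  have h2 : 0 ≤ (1 - a) ^ 2 * (3 - 2 * b) := mul_nonneg (sq_nonneg _) (by linarith)
  nlinarith [mul_lt_mul_of_pos_left hf h1, mul_le_mul_of_nonneg_right hde h2]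

theorem lt_of_step_lt {a c : ℝ} (ha : a ∈ I) (hc : c ∈ I) (h : step a < step c) : a < c := by
  by_contra hlt
  exact absurd (step_le_step hc.1 (not_lt.1 hlt) ha.2) (not_le.2 h)

theorem mem_I_of {c : ℝ} (h0 : 0 ≤ c) (h1 : c ≤ 1) : c ∈ I := ⟨h0, h1⟩

/-- The function `t²(1 - t)`, which governs the bulge, increases on `[0, 2/3]`. -/
theorem sq_mul_one_sub_mono {a b : ℝ} (ha : 0 ≤ a) (hab : a ≤ b) (hb : b ≤ 2 / 3) :
    a ^ 2 * (1 - a) ≤ b ^ 2 * (1 - b) := by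
  have : 0 ≤ (b - a) * (a + b - (a ^ 2 + a * b + b ^ 2)) := by
    apply mul_nonneg (by linarith)
    nlinarith [mul_nonneg ha (sub_nonneg.2 hb), mul_nonneg ha (by linarith : 0 ≤ 2 / 3 - a),
      mul_nonneg (ha.trans hab) (sub_nonneg.2 hb)]
  nlinarith

/-- … and decreases on `[2/3, 1]`. -/
theorem sq_mul_one_sub_anti {a b : ℝ} (ha : 2 / 3 ≤ a) (hab : a ≤ b) :
    b ^ 2 * (1 - b) ≤ a ^ 2 * (1 - a) := by
  have : 0 ≤ (b - a) * ((a ^ 2 + a * b + b ^ 2) - (a + b)) := by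
    apply mul_nonneg (by linarith)
    nlinarith [mul_nonneg (sub_nonneg.2 ha) (sub_nonneg.2 (ha.trans hab)), sub_nonneg.2 ha,
      sub_nonneg.2 (ha.trans hab)]
  nlinarith

/-! In the following lemmas, `a` and `b` are the parameters of two branches at points of the same
angle (`hs`) and the same modulus (`hm`); the branches are called short, deep, or a bulge according
to their shapes. Bounds on `a` and `b` are read off from `hs`, and those on the moduli then
contradict `hm`. -/

theorem isEnd_of_short_deep {a b : ℝ} (ha : a ∈ I) (hb : b ∈ I) (hs : step b = -1 + 3 * step a)
    (hm : 2 / 5 * (b * (1 - b)) = 3 * (a * (1 - a))) : IsEnd a ∧ IsEnd b := by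
  exfalso
  have h1 := step_nonneg hb
  have h2 := step_le_one hb
  have h3 : 3 / 10 < a := lt_of_step_lt (mem_I_of (by norm_num) (by norm_num)) ha (by
    have : step (3 / 10) = 27 / 125 := by norm_num [step]
    linarith)
  have h4 : a < 7 / 10 := lt_of_step_lt ha (mem_I_of (by norm_num) (by norm_num)) (by
    have : step (7 / 10) = 98 / 125 := by norm_num [step]
    linarith)
  have h5 := mul_one_sub_le b
  nlinarith

theorem isEnd_of_bulge_short {a b : ℝ} (ha : a ∈ I) (hb : b ∈ I) (hs : 3 * step a = step b)
    (hm : 2 * (a * (1 - a)) - 160 * (a ^ 5 * (1 - a) ^ 3) = 2 / 5 * (b * (1 - b))) :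
    IsEnd a ∧ IsEnd b := by
  have hm' : (a * (1 - a)) * (2 - 160 * (a ^ 2 * (1 - a)) ^ 2) = 2 / 5 * (b * (1 - b)) := by
    linear_combination hm
  by_cases ha0 : a = 0
  · refine ⟨Or.inl ha0, Or.inl (step_inj hb zero_mem_I ?_)⟩
    rw [← hs, ha0, step_zero, mul_zero]
  exfalso
  have hapos : 0 < a := lt_of_le_of_ne ha.1 (Ne.symm ha0)
  have h2 := step_le_one hb
  have h4 : a < 39 / 100 := lt_of_step_lt ha (mem_I_of (by norm_num) (by norm_num)) (by
    have : step (39 / 100) = 168831 / 500000 := by norm_num [step]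
    linarith)
  have hupos : 0 < a * (1 - a) := mul_pos hapos (by linarith)
  have hv0 : 0 ≤ a ^ 2 * (1 - a) := mul_nonneg (sq_nonneg a) (by linarith)
  by_cases h3 : a ≤ 3 / 10
  · have hab : a ≤ b := le_of_step_le ha hb (by linarith [step_nonneg ha])
    have hb3 : b ≤ 3 * a := by
      refine le_of_sq_le_sq ?_ (by linarith)
      have e1 : 0 ≤ b ^ 2 * (1 - b) := mul_nonneg (sq_nonneg _) (by linarith [hb.2])
      have e2 : 0 ≤ a ^ 3 := pow_nonneg hapos.le 3
      unfold step at hs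
      nlinarith
    have hv := sq_mul_one_sub_mono hapos.le h3 (by norm_num)
    have hv2 := pow_le_pow_left₀ hv0 hv 2
    have e3 : b * (1 - b) ≤ 3 * (a * (1 - a)) := by
      have e4 : 0 ≤ (1 - b) := by linarith [hb.2]
      calc b * (1 - b) ≤ 3 * a * (1 - b) := mul_le_mul_of_nonneg_right hb3 e4
        _ ≤ 3 * a * (1 - a) := mul_le_mul_of_nonneg_left (by linarith) (by linarith)
        _ = _ := by ring
    norm_num at hv2
    nlinarith
  · have hv := sq_mul_one_sub_mono hapos.le h4.le (by norm_num)
    have hv2 := pow_le_pow_left₀ hv0 hv 2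
    have h5 := mul_one_sub_le b
    have h6 : 21 / 100 ≤ a * (1 - a) := by nlinarith
    norm_num at hv2
    nlinarith

theorem isEnd_of_bulge_dip {a b : ℝ} (ha : a ∈ I) (hb : b ∈ I) (hs : 3 * step a = 2 * step b)
    (hm : 160 * (a ^ 5 * (1 - a) ^ 3) = 2 * (a * (1 - a)) - 2 * (b * (1 - b))) :
    IsEnd a ∧ IsEnd b := by
  have hm' : 160 * (a * (1 - a)) * (a ^ 2 * (1 - a)) ^ 2 =
      2 * (a * (1 - a)) - 2 * (b * (1 - b)) := by linear_combination hm
  by_cases ha0 : a = 0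
  · refine ⟨Or.inl ha0, Or.inl (step_inj hb zero_mem_I ?_)⟩
    rw [step_zero]; rw [ha0, step_zero] at hs; linarith
  exfalso
  have hapos : 0 < a := lt_of_le_of_ne ha.1 (Ne.symm ha0)
  have h2 := step_le_one hb
  have h4 : a < 62 / 100 := lt_of_step_lt ha (mem_I_of (by norm_num) (by norm_num)) (by
    have : step (62 / 100) = 42284 / 62500 := by norm_num [step]
    linarith)
  have hupos : 0 < a * (1 - a) := mul_pos hapos (by linarith)
  have hv0 : 0 < a ^ 2 * (1 - a) := mul_pos (pow_pos hapos 2) (by linarith)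
  have hab : a ≤ b := le_of_step_le ha hb (by linarith [step_nonneg ha])
  -- The point on the branch with the bulge can be lower only if the other point is beyond the
  -- mirror image of it.
  have hsum : 1 - a ≤ b := by
    by_contra hlt
    have e1 : a * (1 - a) - b * (1 - b) = (a - b) * (1 - a - b) := by ring
    have e2 : (a - b) * (1 - a - b) ≤ 0 :=
      mul_nonpos_of_nonpos_of_nonneg (by linarith) (by linarith)
    have e3 : 0 < 160 * (a * (1 - a)) * (a ^ 2 * (1 - a)) ^ 2 := by positivity
    linarith
  have h5 := step_le_step (by linarith [ha.2]) hsum hb.2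
  rw [step_one_sub] at h5
  have h3 : 43 / 100 < a := lt_of_step_lt (mem_I_of (by norm_num) (by norm_num)) ha (by
    have : step (43 / 100) = 197843 / 500000 := by norm_num [step]
    linarith)
  have hub := mul_one_sub_nonneg hb
  by_cases h6 : 46 / 100 ≤ a
  · have hv := sq_mul_one_sub_mono (by norm_num) h6 (by linarith)
    have hv2 := pow_le_pow_left₀ (by norm_num) hv 2
    norm_num at hv2
    nlinarith
  · have hv := sq_mul_one_sub_mono (by norm_num) h3.le (by linarith)
    have hv2 := pow_le_pow_left₀ (by norm_num) hv 2
    have h7 : step a ≤ step (46 / 100) := step_le_step ha.1 (by linarith) (by norm_num)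
    have h8 : step (46 / 100) = 27508 / 62500 := by norm_num [step]
    have h9 : b < 7 / 10 := lt_of_step_lt hb (mem_I_of (by norm_num) (by norm_num)) (by
      have : step (7 / 10) = 98 / 125 := by norm_num [step]
      linarith)
    have h10 : 2 / 10 ≤ b * (1 - b) := by nlinarith
    have h11 := mul_one_sub_le a
    norm_num at hv2
    nlinarith

theorem isEnd_of_bulge_deep {a b : ℝ} (ha : a ∈ I) (hb : b ∈ I) (hs : 3 * step a = -1 + 3 * step b)
    (hm : 2 * (a * (1 - a)) - 160 * (a ^ 5 * (1 - a) ^ 3) = 3 * (b * (1 - b))) :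
    IsEnd a ∧ IsEnd b := by
  exfalso
  have hm' : (a * (1 - a)) * (2 - 160 * (a ^ 2 * (1 - a)) ^ 2) = 3 * (b * (1 - b)) := by
    linear_combination hm
  have h1 := step_nonneg ha
  have h2 := step_le_one hb
  have h4 : a < 62 / 100 := lt_of_step_lt ha (mem_I_of (by norm_num) (by norm_num)) (by
    have : step (62 / 100) = 42284 / 62500 := by norm_num [step]
    linarith)
  have h5 : 3 / 10 < b := lt_of_step_lt (mem_I_of (by norm_num) (by norm_num)) hb (by
    have : step (3 / 10) = 27 / 125 := by norm_num [step]
    linarith)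
  have hua := mul_one_sub_nonneg ha
  have hua' := mul_one_sub_le a
  have hub := mul_one_sub_nonneg hb
  by_cases h6 : 46 / 100 ≤ a
  · have hv := sq_mul_one_sub_mono (by norm_num) h6 (by linarith)
    have hv2 := pow_le_pow_left₀ (by norm_num) hv 2
    have : 0 < a * (1 - a) := mul_pos (by linarith) (by linarith)
    norm_num at hv2
    nlinarith
  · have h7 : step a ≤ step (46 / 100) := step_le_step ha.1 (by linarith) (by norm_num)
    have h8 : step (46 / 100) = 27508 / 62500 := by norm_num [step]
    have h9 : b < 7 / 10 + 1 / 100 := lt_of_step_lt hb (mem_I_of (by norm_num) (by norm_num)) (by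
      have : step (7 / 10 + 1 / 100) = 398239 / 500000 := by norm_num [step]
      linarith)
    have h10 : 2 / 10 ≤ b * (1 - b) := by nlinarith
    nlinarith [mul_nonneg hua (sq_nonneg (a ^ 2 * (1 - a)))]

theorem isEnd_of_deep_bulge {a b : ℝ} (ha : a ∈ I) (hb : b ∈ I) (hs : 2 + 3 * step b = 3 * step a)
    (hm : 2 * (a * (1 - a)) - 160 * (a ^ 5 * (1 - a) ^ 3) = 3 * (b * (1 - b))) :
    IsEnd a ∧ IsEnd b := by
  exfalso
  have hm' : (a * (1 - a)) * (2 - 160 * (a ^ 2 * (1 - a)) ^ 2) = 3 * (b * (1 - b)) := by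
    linear_combination hm
  have h1 := step_nonneg hb
  have h2 := step_le_one ha
  have h3 : 61 / 100 < a := lt_of_step_lt (mem_I_of (by norm_num) (by norm_num)) ha (by
    have : step (61 / 100) = 331169 / 500000 := by norm_num [step]
    linarith)
  have hua := mul_one_sub_nonneg ha
  have hub := mul_one_sub_nonneg hb
  by_cases h6 : a ≤ 78 / 100
  · have hv : 13 / 100 ≤ a ^ 2 * (1 - a) := by
      rcases le_total a (2 / 3) with h | h
      · have := sq_mul_one_sub_mono (by norm_num) h3.le h
        norm_num at this; linarith
      · have := sq_mul_one_sub_anti h h6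
        norm_num at this; linarith
    have hv2 := pow_le_pow_left₀ (by norm_num) hv 2
    have : 0 < a * (1 - a) := mul_pos (by linarith) (by linarith)
    norm_num at hv2
    nlinarith
  · have h7 : step (78 / 100) ≤ step a := step_le_step (by norm_num) (by linarith) ha.2
    have h8 : step (78 / 100) = 109512 / 125000 := by norm_num [step]
    have h9 : b < 39 / 100 := lt_of_step_lt hb (mem_I_of (by norm_num) (by norm_num)) (by
      have : step (39 / 100) = 168831 / 500000 := by norm_num [step]
      linarith)
    have h10 : 28 / 100 < b := lt_of_step_lt (mem_I_of (by norm_num) (by norm_num)) hb (by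
      have : step (28 / 100) = 11956 / 62500 := by norm_num [step]
      linarith)
    have h11 : 2 / 10 ≤ b * (1 - b) := by nlinarith
    have h12 : a * (1 - a) ≤ 2 / 10 := by nlinarith
    nlinarith [mul_nonneg hua (sq_nonneg (a ^ 2 * (1 - a)))]

/-- A loop stays within a small angle of its puncture. -/
theorem abs_loop_angle_le {t : ℝ} (ht : t ∈ I) :
    |8 * ((t * (1 - t)) ^ 2 * (1 - 2 * t))| ≤ 17 / 100 := by
  have key : ∀ s : ℝ, 0 ≤ s → s ≤ 1 → s * (1 - s ^ 2) ^ 2 ≤ 34 / 100 := by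
    intro s h0 h1
    nlinarith [mul_nonneg h0 (sq_nonneg (s ^ 2 - 1 / 5)), sq_nonneg (s - 9 / 20),
      mul_nonneg h0 (sq_nonneg (s - 9 / 20)), mul_nonneg (mul_nonneg h0 h0) h0]
  have e : 8 * ((t * (1 - t)) ^ 2 * (1 - 2 * t)) =
      (1 - 2 * t) * (1 - (1 - 2 * t) ^ 2) ^ 2 / 2 := by ring
  have hs : |1 - 2 * t| ≤ 1 := abs_le.2 ⟨by linarith [ht.2], by linarith [ht.1]⟩
  rw [e, abs_div, abs_mul, abs_of_nonneg (a := (1 - (1 - 2 * t) ^ 2) ^ 2) (sq_nonneg _), ← sq_abs (1 - 2 * t),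
    abs_of_pos (by norm_num : (0 : ℝ) < 2)]
  linarith [key _ (abs_nonneg (1 - 2 * t)) hs]

/-- A loop and one of the branches that leave the unit disc meet at most at their ends: where the
branch is as far out as a loop, its angle is near the middle of the branch, and there it is
further out than the loop. -/
theorem isEnd_of_loop_bulge {a t : ℝ} (ha : a ∈ I) (ht : t ∈ I) {N : ℤ}
    (hs : 3 * step a = N + 8 * ((t * (1 - t)) ^ 2 * (1 - 2 * t)))
    (hm : 4 / 5 * (t * (1 - t)) = 160 * (a ^ 5 * (1 - a) ^ 3) - 2 * (a * (1 - a))) :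
    IsEnd t ∧ IsEnd a := by
  have hm' : 4 / 5 * (t * (1 - t)) = (a * (1 - a)) * (160 * (a ^ 2 * (1 - a)) ^ 2 - 2) := by
    linear_combination hm
  by_cases ha0 : a * (1 - a) = 0
  · rw [ha0, zero_mul] at hm'
    exact ⟨isEnd_of_mul_eq_zero (by linarith), isEnd_of_mul_eq_zero ha0⟩
  exfalso
  have hε := abs_le.1 (abs_loop_angle_le ht)
  have hua := mul_one_sub_nonneg ha
  have hupos : 0 < a * (1 - a) := lt_of_le_of_ne hua (Ne.symm ha0)
  have hut := mul_one_sub_nonneg ht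
  have hv0 : 0 ≤ a ^ 2 * (1 - a) := mul_nonneg (sq_nonneg a) (by linarith [ha.2])
  have hv : 1 / 80 ≤ (a ^ 2 * (1 - a)) ^ 2 := by
    by_contra hlt
    have := mul_neg_of_pos_of_neg hupos
      (by linarith : 160 * (a ^ 2 * (1 - a)) ^ 2 - 2 < 0)
    linarith
  have h1 : 45 / 100 < a := by
    by_contra hlt
    have e1 := sq_mul_one_sub_mono ha.1 (not_lt.1 hlt) (by norm_num)
    have e2 := pow_le_pow_left₀ hv0 e1 2
    norm_num at e2
    linarith
  have h2 : a < 85 / 100 := by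
    by_contra hlt
    have e1 := sq_mul_one_sub_anti (by norm_num) (not_lt.1 hlt)
    have e2 := pow_le_pow_left₀ hv0 e1 2
    norm_num at e2
    linarith
  have h3 := step_lt_step (by norm_num) h1 ha.2
  have h4 := step_lt_step ha.1 h2 (by norm_num)
  have h5 : step (45 / 100) = 3402 / 8000 := by norm_num [step]
  have h6 : step (85 / 100) = 7514 / 8000 := by norm_num [step]
  have hN1 : (1 : ℝ) < N := by linarith
  have hN2 : (N : ℝ) < 3 := by linarith
  have hN : N = 2 := by
    have e1 : 1 < N := by exact_mod_cast hN1
    have e2 : N < 3 := by exact_mod_cast hN2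
    omega
  rw [hN] at hs
  push_cast at hs
  have h7 : 56 / 100 < a := lt_of_step_lt (mem_I_of (by norm_num) (by norm_num)) ha (by
    have : step (56 / 100) = 36848 / 62500 := by norm_num [step]
    linarith)
  have h8 : a < 67 / 100 := lt_of_step_lt ha (mem_I_of (by norm_num) (by norm_num)) (by
    have : step (67 / 100) = 372587 / 500000 := by norm_num [step]
    linarith)
  have h9 : 137 / 1000 ≤ a ^ 2 * (1 - a) := by
    rcases le_total a (2 / 3) with h | h
    · have := sq_mul_one_sub_mono (by norm_num) h7.le h
      norm_num at this; linarith
    · have := sq_mul_one_sub_anti h h8.le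
      norm_num at this; linarith
  have h10 := pow_le_pow_left₀ (by norm_num) h9 2
  have h11 : 22 / 100 ≤ a * (1 - a) := by nlinarith
  have h12 := mul_one_sub_le t
  norm_num at h10
  nlinarith

/-- The lower end of the angular interval of a branch. -/
def lowEnd : Fin 9 → ℤ := ![3, 3, 3, -1, 2, 0, -1, 0, 0]

/-- The length of the angular interval of a branch. -/
def width : Fin 9 → ℤ := ![3, 2, 1, 3, 3, 3, 1, 1, 2]

/-- The parameter of a branch in the direction of increasing angle. -/
noncomputable def forward (i : Fin 9) (t : ℝ) : ℝ := if shift i < 0 then 1 - t else t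

theorem forward_mem_I (i : Fin 9) {t : ℝ} (ht : t ∈ I) : forward i t ∈ I := by
  unfold forward
  split_ifs
  · exact one_sub_mem_I ht
  · exact ht

theorem isEnd_forward {i : Fin 9} {t : ℝ} : IsEnd (forward i t) ↔ IsEnd t := by
  unfold forward
  split_ifs
  · exact isEnd_one_sub
  · rfl

theorem angle_inr (i : Fin 9) (t : ℝ) :
    angle (Sum.inr i) t = lowEnd i + width i * step (forward i t) := by
  fin_cases i <;> simp [angle, start, shift, lowEnd, width, forward, step] <;> ring

theorem modulus_inr (i : Fin 9) (t : ℝ) :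
    modulus (Sum.inr i) t = 9 / 10 - dip i * (forward i t * (1 - forward i t)) +
      bulge i * (forward i t ^ 5 * (1 - forward i t) ^ 3) := by
  fin_cases i <;> simp [modulus, shift, dip, bulge, forward] <;> ring

theorem dip_le (i : Fin 9) : dip i ≤ 3 := by
  fin_cases i <;> simp [dip] <;> norm_num

theorem bulge_nonneg (i : Fin 9) : 0 ≤ bulge i := by
  fin_cases i <;> simp [bulge]

theorem modulus_pos (b : Branch) {t : ℝ} (ht : t ∈ I) : 0 < modulus b t := by
  have h1 := mul_one_sub_nonneg ht
  have h2 := mul_one_sub_le t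
  rcases b with k | i
  · simp only [modulus]; linarith
  · have h3 : 0 ≤ bulge i * (t ^ 5 * (1 - t) ^ 3) :=
      mul_nonneg (bulge_nonneg i) (mul_nonneg (pow_nonneg ht.1 5) (pow_nonneg (by linarith [ht.2]) 3))
    have h4 := mul_le_mul (dip_le i) h2 h1 (by norm_num)
    simp only [modulus]; linarith

theorem eq_of_curve_eq {b b' : Branch} {t t' : ℝ} (ht : t ∈ I) (ht' : t' ∈ I)
    (h : curve b t = curve b' t') :
    modulus b t = modulus b' t' ∧ ∃ n : ℤ, angle b t = angle b' t' + 7 * n :=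
  exists_eq_of_polar_eq (modulus_pos b ht) (modulus_pos b' ht') h

/-- The pairs of branches whose angular intervals overlap. -/
theorem interval_overlap_cases (i j : Fin 9) (hij : i < j) :
    lowEnd i + width i ≤ lowEnd j ∨ lowEnd j + width j ≤ lowEnd i ∨
      (i, j) ∈ [((0 : Fin 9), (1 : Fin 9)), (0, 2), (0, 4), (1, 2), (1, 4), (2, 4), (3, 5), (3, 6),
        (3, 7), (3, 8), (4, 5), (5, 7), (5, 8), (7, 8)] := by
  revert i j; decide

theorem width_pos (i : Fin 9) : 0 < width i := by revert i; decide

theorem width_le_three (i : Fin 9) : width i ≤ 3 := by revert i; decide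

theorem shift_ne_zero (i : Fin 9) : shift i ≠ 0 := by revert i; decide

theorem neg_one_le_lowEnd (i : Fin 9) : -1 ≤ lowEnd i := by revert i; decide

theorem highEnd_le_six (i : Fin 9) : lowEnd i + width i ≤ 6 := by revert i; decide

/-- Two of the nine branches meet at most at their ends: either their angular intervals do not
overlap, or one of the estimates for overlapping pairs applies. -/
theorem isEnd_of_curve_eq {i j : Fin 9} (hij : i < j) {t t' : ℝ} (ht : t ∈ I) (ht' : t' ∈ I)
    (h : curve (Sum.inr i) t = curve (Sum.inr j) t') : IsEnd t ∧ IsEnd t' := by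
  obtain ⟨hm, n, hn⟩ := eq_of_curve_eq ht ht' h
  rw [modulus_inr, modulus_inr] at hm
  rw [angle_inr, angle_inr] at hn
  rw [← isEnd_forward (i := i), ← isEnd_forward (i := j) (t := t')]
  have ha := forward_mem_I i ht
  have hb := forward_mem_I j ht'
  generalize forward i t = a at *
  generalize forward j t' = b at *
  have hi : (0 : ℝ) < width i := by exact_mod_cast width_pos i
  have hj : (0 : ℝ) < width j := by exact_mod_cast width_pos j
  have touch : ∀ m : ℤ, lowEnd i + width i ≤ lowEnd j + 7 * m → n = m → IsEnd a ∧ IsEnd b := by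
    rintro m hle rfl
    refine isEnd_of_le ha hb hi hj (u := lowEnd i) (v := lowEnd j + 7 * n) (by linarith) ?_
    exact_mod_cast hle
  have touch' : ∀ m : ℤ, lowEnd j + width j + 7 * m ≤ lowEnd i → n = m → IsEnd a ∧ IsEnd b := by
    rintro m hle rfl
    refine (isEnd_of_le hb ha hj hi (u := lowEnd j + 7 * n) (v := lowEnd i) (by linarith) ?_).symm
    have : (lowEnd j : ℝ) + width j + 7 * n ≤ lowEnd i := by exact_mod_cast hle
    linarith
  have l1 := neg_one_le_lowEnd i
  have l2 := neg_one_le_lowEnd j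
  have l3 := highEnd_le_six i
  have l4 := highEnd_le_six j
  rcases lt_trichotomy n 0 with hn0 | hn0 | hn0
  · exact touch' n (by omega) rfl
  · rcases interval_overlap_cases i j hij with h1 | h1 | h1
    · exact touch 0 (by omega) hn0
    · exact touch' 0 (by omega) hn0
    · rw [hn0] at hn
      have flipped : ∀ {d e : ℝ}, d * ((1 - a) * (1 - (1 - a))) = e * ((1 - b) * (1 - (1 - b))) ↔
          d * (a * (1 - a)) = e * (b * (1 - b)) := fun {d e} => by
        rw [show (1 - a) * (1 - (1 - a)) = a * (1 - a) by ring,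
          show (1 - b) * (1 - (1 - b)) = b * (1 - b) by ring]
      simp only [List.mem_cons, Prod.mk.injEq, List.not_mem_nil, or_false] at h1
      rcases h1 with ⟨rfl, rfl⟩ | ⟨rfl, rfl⟩ | ⟨rfl, rfl⟩ | ⟨rfl, rfl⟩ | ⟨rfl, rfl⟩ | ⟨rfl, rfl⟩ |
        ⟨rfl, rfl⟩ | ⟨rfl, rfl⟩ | ⟨rfl, rfl⟩ | ⟨rfl, rfl⟩ | ⟨rfl, rfl⟩ | ⟨rfl, rfl⟩ | ⟨rfl, rfl⟩ |
        ⟨rfl, rfl⟩ <;> simp [lowEnd, width, dip, bulge] at hm hn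
      · exact isEnd_of_bulge_dip ha hb (by linarith) (by linarith)
      · exact isEnd_of_bulge_short ha hb (by linarith) (by linarith)
      · exact isEnd_of_bulge_deep ha hb (by linarith) (by linarith)
      · exact isEnd_of_nested (p := 2) (q := 1) (d := 2) (e := 2 / 5) ha hb (by norm_num)
          (by norm_num) (by norm_num) (by norm_num) (by norm_num) (by linarith) (by linarith)
      · have := isEnd_of_nested (p := 3) (q := 2) (d := 3) (e := 2) (one_sub_mem_I hb)
          (one_sub_mem_I ha) (by norm_num) (by norm_num) (by norm_num) (by norm_num) (by norm_num)
          (by rw [step_one_sub, step_one_sub]; linarith) (flipped.2 (by linarith)).symm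
        exact ⟨isEnd_one_sub.1 this.2, isEnd_one_sub.1 this.1⟩
      · exact (isEnd_of_short_deep hb ha (by linarith) (by linarith)).symm
      · exact (isEnd_of_bulge_deep hb ha (by linarith) (by linarith)).symm
      · exact isEnd_of_nested (p := 3) (q := 1) (d := 3) (e := 2 / 5) ha hb (by norm_num)
          (by norm_num) (by norm_num) (by norm_num) (by norm_num) (by linarith) (by linarith)
      · exact isEnd_of_short_deep ha hb (by linarith) (by linarith)
      · have := isEnd_of_nested (p := 3) (q := 2) (d := 3) (e := 2) (one_sub_mem_I ha)
          (one_sub_mem_I hb) (by norm_num) (by norm_num) (by norm_num) (by norm_num) (by norm_num)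
          (by rw [step_one_sub, step_one_sub]; linarith) (flipped.2 (by linarith))
        exact ⟨isEnd_one_sub.1 this.1, isEnd_one_sub.1 this.2⟩
      · exact (isEnd_of_deep_bulge hb ha (by linarith) (by linarith)).symm
      · exact isEnd_of_bulge_short ha hb (by linarith) (by linarith)
      · exact isEnd_of_bulge_dip ha hb (by linarith) (by linarith)
      · exact (isEnd_of_nested (p := 2) (q := 1) (d := 2) (e := 2 / 5) hb ha (by norm_num)
          (by norm_num) (by norm_num) (by norm_num) (by norm_num) (by linarith) (by linarith)).symm
  · exact touch n (by omega) rfl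

theorem isEnd_of_loop_eq {k : ZMod 7} {i : Fin 9} {t t' : ℝ} (ht : t ∈ I) (ht' : t' ∈ I)
    (h : curve (Sum.inl k) t = curve (Sum.inr i) t') : IsEnd t ∧ IsEnd t' := by
  obtain ⟨hm, n, hn⟩ := eq_of_curve_eq ht ht' h
  rw [modulus_inr] at hm
  rw [angle_inr] at hn
  rw [← isEnd_forward (i := i) (t := t')]
  have ha := forward_mem_I i ht'
  generalize forward i t' = a at *
  simp only [modulus] at hm
  simp only [angle] at hn
  have hut := mul_one_sub_nonneg ht
  have hua := mul_one_sub_nonneg ha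
  have hbulge : bulge i = 0 ∨ bulge i = 160 ∧ dip i = 2 ∧ width i = 3 := by
    fin_cases i <;> simp [bulge, dip, width]
  rcases hbulge with hb | ⟨hb, hd, hw⟩
  · rw [hb, zero_mul, add_zero] at hm
    have h1 := mul_nonneg (dip_pos i).le hua
    have h2 : dip i * (a * (1 - a)) = 0 := by linarith
    exact ⟨isEnd_of_mul_eq_zero (by linarith),
      isEnd_of_mul_eq_zero ((mul_eq_zero.1 h2).resolve_left (dip_pos i).ne')⟩
  · rw [hb, hd] at hm
    rw [hw] at hn
    refine isEnd_of_loop_bulge ha ht (N := k.val - lowEnd i - 7 * n) ?_ (by linarith)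
    push_cast at hn ⊢
    linarith

/-- At equal modulus two loops have parameters with the same `t (1 - t)`, and the angle tells these
parameters apart. -/
theorem loop_eq_of_curve_eq {k j : ZMod 7} {t t' : ℝ} (ht : t ∈ I) (ht' : t' ∈ I)
    (h : curve (Sum.inl k) t = curve (Sum.inl j) t') : k = j ∧ (t = t' ∨ (IsEnd t ∧ IsEnd t')) := by
  obtain ⟨hm, n, hn⟩ := eq_of_curve_eq ht ht' h
  simp only [modulus] at hm
  simp only [angle] at hn
  have hu : t * (1 - t) = t' * (1 - t') := by linarith
  have e1 := abs_le.1 (abs_loop_angle_le ht)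
  have e2 := abs_le.1 (abs_loop_angle_le ht')
  have h0 : (k.val : ℤ) - j.val - 7 * n = 0 := by
    have h1 : (((k.val : ℤ) - j.val - 7 * n : ℤ) : ℝ) < 1 := by push_cast; linarith
    have h2 : (-1 : ℝ) < (((k.val : ℤ) - j.val - 7 * n : ℤ) : ℝ) := by push_cast; linarith
    have h1' : (k.val : ℤ) - j.val - 7 * n < 1 := by exact_mod_cast h1
    have h2' : -1 < (k.val : ℤ) - j.val - 7 * n := by exact_mod_cast h2
    omega
  have hk := k.val_lt
  have hj := j.val_lt
  refine ⟨ZMod.val_injective 7 (by omega), ?_⟩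
  have h3 : ((k.val : ℝ)) - j.val - 7 * n = 0 := by exact_mod_cast h0
  have h4 : (t * (1 - t)) ^ 2 * (1 - 2 * t) = (t' * (1 - t')) ^ 2 * (1 - 2 * t') := by linarith
  have h5 : (t * (1 - t)) ^ 2 * (t' - t) = 0 := by
    rw [← hu] at h4; linarith
  rcases mul_eq_zero.1 h5 with h6 | h6
  · have h7 : t * (1 - t) = 0 := by simpa using h6
    exact Or.inr ⟨isEnd_of_mul_eq_zero h7, isEnd_of_mul_eq_zero (hu ▸ h7)⟩
  · exact Or.inl (by linarith)

theorem param_eq_of_curve_eq {i : Fin 9} {t t' : ℝ} (ht : t ∈ I) (ht' : t' ∈ I)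
    (h : curve (Sum.inr i) t = curve (Sum.inr i) t') : t = t' := by
  obtain ⟨-, n, hn⟩ := eq_of_curve_eq ht ht' h
  rw [angle_inr, angle_inr] at hn
  have ha := forward_mem_I i ht
  have hb := forward_mem_I i ht'
  have e1 := step_nonneg ha
  have e2 := step_le_one ha
  have e3 := step_nonneg hb
  have e4 := step_le_one hb
  have w0 : (0 : ℝ) < width i := by exact_mod_cast width_pos i
  have w3 : (width i : ℝ) ≤ 3 := by
    exact_mod_cast width_le_three i
  have h0 : n = 0 := by
    have h1 : (n : ℝ) < 1 := by nlinarith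
    have h2 : (-1 : ℝ) < n := by nlinarith
    have h1' : n < 1 := by exact_mod_cast h1
    have h2' : -1 < n := by exact_mod_cast h2
    omega
  rw [h0] at hn
  have h1 : step (forward i t) = step (forward i t') := by
    apply mul_left_cancel₀ w0.ne'
    push_cast at hn
    linarith
  have h2 := step_inj ha hb h1
  unfold forward at h2
  split_ifs at h2
  · linarith
  · exact h2

/-- The branches are embedded and disjoint, except at their ends. -/
theorem eq_or_isEnd_of_curve_eq {b b' : Branch} {t t' : ℝ} (ht : t ∈ I) (ht' : t' ∈ I)
    (h : curve b t = curve b' t') : (b = b' ∧ t = t') ∨ (IsEnd t ∧ IsEnd t') := by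
  rcases b with k | i <;> rcases b' with j | j
  · obtain ⟨rfl, h1 | h1⟩ := loop_eq_of_curve_eq ht ht' h
    · exact Or.inl ⟨rfl, h1⟩
    · exact Or.inr h1
  · exact Or.inr (isEnd_of_loop_eq ht ht' h)
  · exact Or.inr (isEnd_of_loop_eq ht' ht h.symm).symm
  · rcases lt_trichotomy i j with hij | rfl | hij
    · exact Or.inr (isEnd_of_curve_eq hij ht ht' h)
    · exact Or.inl ⟨rfl, param_eq_of_curve_eq ht ht' h⟩
    · exact Or.inr (isEnd_of_curve_eq hij ht' ht h.symm).symm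

theorem contDiff_curve (b : Branch) : ContDiff ℝ (⊤ : ℕ∞) (curve b) := by
  have hm : ContDiff ℝ (⊤ : ℕ∞) (modulus b) := by
    cases b <;> unfold modulus <;> fun_prop
  have ha : ContDiff ℝ (⊤ : ℕ∞) (angle b) := by
    cases b <;> unfold angle <;> fun_prop
  have hc : ContDiff ℝ (⊤ : ℕ∞) (fun x : ℝ => (x : ℂ)) := Complex.ofRealCLM.contDiff
  unfold curve polar
  refine (hc.comp hm).mul (ContDiff.cexp ?_)
  refine ContDiff.mul (hc.comp ?_) contDiff_const
  exact (contDiff_const.mul ha).div_const 7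

theorem deriv_curve_ne_zero (b : Branch) {t : ℝ} (ht : t ∈ I) : deriv (curve b) t ≠ 0 := by
  rw [(hasDerivAt_curve b t).deriv]
  refine mul_ne_zero (polar_ne_zero one_ne_zero _) fun h => ?_
  have hre : modulusDeriv b t = 0 := by simpa using congrArg Complex.re h
  have him : modulus b t * (2 * Real.pi * angleDeriv b t / 7) = 0 := by
    simpa using congrArg Complex.im h
  have ha : angleDeriv b t = 0 := by
    have h1 := (mul_eq_zero.1 him).resolve_left (modulus_pos b ht).ne'
    have hpi := Real.pi_pos
    field_simp at h1
    simpa using h1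
  rcases b with k | i
  · simp only [modulusDeriv] at hre
    have h1 : t = 1 / 2 := by linarith
    rw [h1] at ha
    norm_num [angleDeriv] at ha
  · simp only [angleDeriv] at ha
    have hs : (shift i : ℝ) ≠ 0 := by
      exact_mod_cast shift_ne_zero i
    have h1 : t * (1 - t) = 0 := by
      have := (mul_eq_zero.1 ha).resolve_left hs
      linarith
    have hd := (dip_pos i).ne'
    rcases isEnd_of_mul_eq_zero h1 with rfl | rfl <;> norm_num [modulusDeriv] at hre <;>
      exact hd hre

theorem isEmbeddedTrack : IsEmbeddedTrack := by
  refine ⟨contDiff_curve, fun b t ht => deriv_curve_ne_zero b ht, fun b b' t ht t' ht' h => ?_,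
    fun x y h => ?_, fun x => ?_⟩
  · refine (eq_or_isEnd_of_curve_eq ⟨ht.1.le, ht.2.le⟩ ht' h).resolve_right fun he => ?_
    rcases he.1 with h0 | h1
    · exact ht.1.ne' h0
    · exact ht.2.ne h1
  · rw [sameRay_initVel_iff (initPt_eq_iff.1 h), sameRay_initVel_neg_iff (initPt_eq_iff.1 h)]
    exact em _
  · obtain ⟨y, h1, h2⟩ := ini_surjective_on_sides x
    exact ⟨y, initPt_eq_iff.2 h1, (sameRay_initVel_neg_iff h1).2 h2⟩

end SevenPuncturedSphere

namespace SevenPuncturedSphere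

open CategoryTheory

/-! ### The homotopy classes of the branches -/

/-- The switch next to `p_k`, as a point of `S`. -/
noncomputable def switchPt (k : ZMod 7) : S :=
  ⟨((switch k : ℂ) : OnePoint ℂ), fun l hl => by
    obtain ⟨h, -⟩ := eq_int_of_polar_eq_puncture (by norm_num) (OnePoint.coe_injective hl)
    norm_num at h⟩

theorem switchPt_injective : Function.Injective switchPt := fun _ _ h =>
  switch_injective (OnePoint.coe_injective (congrArg Subtype.val h))

theorem inFront_switchPt (k : ZMod 7) : InFront (switchPt k) :=
  inFront_polar rfl (by norm_num) fun _ _ => by norm_num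

/-- The class of the radius from `0` to a switch. -/
noncomputable def spoke (k : ZMod 7) : Hom zeroPt (switchPt k) := front (inFront_switchPt k)

theorem branchPath_rev (x : OBranch) (t : I) :
    branchPath x.rev t = branchPath x (unitInterval.symm t) := by
  obtain ⟨b, _ | _⟩ := x
  · change branchPath (b, true) t = branchPath (b, true) (unitInterval.symm (unitInterval.symm t))
    rw [unitInterval.symm_symm]
  · rfl

theorem branchPath_zero (x : OBranch) : branchPath x 0 = switchPt (ini x) := by
  refine Subtype.ext ?_
  change _ = ((switch (ini x) : ℂ) : OnePoint ℂ)
  rw [← initPt_eq]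
  obtain ⟨b, _ | _⟩ := x
  · change ((curve b (unitInterval.symm 0 : I) : ℂ) : OnePoint ℂ) = _
    simp [initPt]
  · change ((curve b (0 : I) : ℂ) : OnePoint ℂ) = _
    simp [initPt]

theorem branchPath_one (x : OBranch) : branchPath x 1 = switchPt (ini x.rev) := by
  rw [← branchPath_zero, branchPath_rev, unitInterval.symm_zero]

/-- An oriented branch as a path between two switches. -/
noncomputable def edge (x : OBranch) : Path (switchPt (ini x)) (switchPt (ini x.rev)) where
  toContinuousMap := branchPath x
  source' := branchPath_zero x
  target' := branchPath_one x

/-- The class of the closed path from `0` along a spoke, an oriented branch, and back along a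
spoke. -/
noncomputable def letter : OBranch → Hom zeroPt zeroPt
  | (Sum.inl k, true) => arc k ≫ inv (arc (k - 1))
  | (Sum.inl k, false) => arc (k - 1) ≫ inv (arc k)
  | (Sum.inr i, true) => if bulge i = 0 then 𝟙 _ else
      arc (lowEnd i + 1 : ℤ) ≫ inv (arc (lowEnd i + 2 : ℤ))
  | (Sum.inr i, false) => if bulge i = 0 then 𝟙 _ else
      arc (lowEnd i + 2 : ℤ) ≫ inv (arc (lowEnd i + 1 : ℤ))

theorem letter_rev (x : OBranch) : letter x.rev = inv (letter x) := by
  obtain ⟨k | i, _ | _⟩ := x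
  · simp [letter, OBranch.rev]
  · simp [letter, OBranch.rev]
  · simp only [letter, OBranch.rev, Bool.not_false]; split_ifs <;> simp
  · simp only [letter, OBranch.rev, Bool.not_true]; split_ifs <;> simp

/-- A loop starts and ends in the front and passes behind its puncture. -/
theorem spoke_comp_loop (k : ZMod 7) :
    spoke k ≫ cls (edge (Sum.inl k, true)) = letter (Sum.inl k, true) ≫ spoke k := by
  have hx : ∀ t : I, (edge (Sum.inl k, true) t).1 = ((polar (9 / 10 + 4 / 5 * ((t : ℝ) * (1 - t)))
      (k.val + 8 * (((t : ℝ) * (1 - t)) ^ 2 * (1 - 2 * t))) : ℂ) : OnePoint ℂ) := fun t => rfl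
  -- Along the loop, the angle is that of the puncture at both ends and in the middle only.
  have hint : ∀ (t : I) (n : ℤ), (k.val + 8 * (((t : ℝ) * (1 - t)) ^ 2 * (1 - 2 * t)) : ℝ) = n →
      (t : ℝ) * (1 - t) = 0 ∨ (t : ℝ) = 1 / 2 := by
    intro t n hn
    have hε := abs_le.1 (abs_loop_angle_le t.2)
    have h0 : n = k.val := by
      have h1 : (n : ℝ) < (k.val + 1 : ℤ) := by push_cast; linarith
      have h2 : ((k.val - 1 : ℤ) : ℝ) < n := by push_cast; linarith
      have h1' : n < k.val + 1 := by exact_mod_cast h1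
      have h2' : (k.val : ℤ) - 1 < n := by exact_mod_cast h2
      omega
    have h1 : ((t : ℝ) * (1 - t)) ^ 2 * (1 - 2 * t) = 0 := by
      rw [h0] at hn; push_cast at hn; linarith
    rcases mul_eq_zero.1 h1 with h2 | h2
    · left; simpa using h2
    · right; linarith
  have hpos : ∀ t : I, 0 ≤ (t : ℝ) * (1 - t) := fun t => mul_one_sub_nonneg t.2
  have hs : (1 / 4 : ℝ) ∈ I := ⟨by norm_num, by norm_num⟩
  have ht : (3 / 4 : ℝ) ∈ I := ⟨by norm_num, by norm_num⟩
  have e := front_comp_front_back_front (inFront_switchPt k) (inFront_switchPt k)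
    (edge (Sum.inl k, true)) (s := ⟨_, hs⟩) (t := ⟨_, ht⟩) (k := k) (j := k - 1)
    (Subtype.mk_le_mk.2 (by norm_num)) ?_ ?_ ?_ ?_ ?_
  · rw [spoke, letter, Category.assoc]; exact e
  · intro r hr
    have hr' : (r : ℝ) ≤ 1 / 4 := hr
    refine inFront_polar (hx r) (by linarith [hpos r]) fun n hn => ?_
    rcases hint r n hn with h | h <;> linarith
  · intro r hr1 hr2
    have hr1' : 1 / 4 ≤ (r : ℝ) := hr1
    have hr2' : (r : ℝ) ≤ 3 / 4 := hr2
    refine inBack_polar (hx r) (by linarith [hpos r]) fun n hn => ?_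
    rcases hint r n hn with h | h
    · nlinarith
    · rw [h]; norm_num
  · intro r hr
    have hr' : 3 / 4 ≤ (r : ℝ) := hr
    refine inFront_polar (hx r) (by linarith [hpos r]) fun n hn => ?_
    rcases hint r n hn with h | h <;> linarith
  · exact ⟨k.val, _, _, by simp, by norm_num, by norm_num, by norm_num, hx _⟩
  · refine ⟨k.val - 1, _, _, by simp, by norm_num, ?_, ?_, hx _⟩ <;> push_cast <;> norm_num1 <;>
      linarith

/-- The branches with a bulge run in the direction of increasing angle. -/
theorem modulus_inr_of_bulge {i : Fin 9} (hb : bulge i ≠ 0) (t : ℝ) :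
    modulus (Sum.inr i) t = 9 / 10 + t * (1 - t) * (160 * (t ^ 2 * (1 - t)) ^ 2 - 2) ∧
    angle (Sum.inr i) t = lowEnd i + 3 * step t := by
  have hbulge : bulge i = 0 ∨ bulge i = 160 ∧ dip i = 2 ∧ width i = 3 ∧ forward i t = t := by
    fin_cases i <;> simp [bulge, dip, width, forward, shift]
  obtain ⟨h1, h2, h3, h4⟩ := hbulge.resolve_left hb
  rw [modulus_inr, angle_inr, h1, h2, h3, h4]
  exact ⟨by ring, by push_cast; ring⟩

/-- A branch with a bulge passes behind the second of the two punctures between its ends. -/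
theorem spoke_comp_bulge (i : Fin 9) (hb : bulge i ≠ 0) :
    spoke (ini (Sum.inr i, true)) ≫ cls (edge (Sum.inr i, true)) =
      letter (Sum.inr i, true) ≫ spoke (ini (Sum.inr i, false)) := by
  have hx : ∀ t : I, (edge (Sum.inr i, true) t).1 =
      ((polar (modulus (Sum.inr i) t) (angle (Sum.inr i) t) : ℂ) : OnePoint ℂ) := fun t => rfl
  have hpos : ∀ t : I, 0 < modulus (Sum.inr i) t := fun t => modulus_pos _ t.2
  have hint : ∀ (t : I) (n : ℤ), angle (Sum.inr i) t = n → 3 * step t = (n - lowEnd i : ℤ) := by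
    intro t n hn
    rw [(modulus_inr_of_bulge hb t).2] at hn
    push_cast; linarith
  have hs : (1 / 2 : ℝ) ∈ I := ⟨by norm_num, by norm_num⟩
  have ht : (3 / 4 : ℝ) ∈ I := ⟨by norm_num, by norm_num⟩
  have hs' : step (1 / 2) = 1 / 2 := by norm_num [step]
  have ht' : step (3 / 4) = 27 / 32 := by norm_num [step]
  have e := front_comp_front_back_front (inFront_switchPt (ini (Sum.inr i, true)))
    (inFront_switchPt (ini (Sum.inr i, false)))
    (edge (Sum.inr i, true)) (s := ⟨_, hs⟩) (t := ⟨_, ht⟩) (k := (lowEnd i + 1 : ℤ))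
    (j := (lowEnd i + 2 : ℤ)) (Subtype.mk_le_mk.2 (by norm_num)) ?_ ?_ ?_ ?_ ?_
  · rw [spoke, letter, if_neg hb, Category.assoc]; exact e
  · intro r hr
    have hr' : (r : ℝ) ≤ 1 / 2 := hr
    refine inFront_polar (hx r) (hpos r).le fun n hn => ?_
    have h1 := hint r n hn
    have h2 := step_le_step r.2.1 hr' (by norm_num)
    have h3 : n - lowEnd i < 2 := by
      have : ((n - lowEnd i : ℤ) : ℝ) < (2 : ℤ) := by push_cast at h1 ⊢; linarith
      exact_mod_cast this
    have h4 : ((n - lowEnd i : ℤ) : ℝ) ≤ 1 := by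
      have : n - lowEnd i ≤ 1 := by omega
      exact_mod_cast this
    have h5 : (r : ℝ) < 39 / 100 := lt_of_step_lt r.2 (mem_I_of (by norm_num) (by norm_num)) (by
      have : step (39 / 100) = 168831 / 500000 := by norm_num [step]
      linarith)
    have h6 := sq_mul_one_sub_mono r.2.1 h5.le (by norm_num)
    have h7 := pow_le_pow_left₀ (mul_nonneg (sq_nonneg (r : ℝ)) (by linarith [r.2.2])) h6 2
    have h8 := mul_one_sub_nonneg r.2
    norm_num at h7
    rw [(modulus_inr_of_bulge hb r).1]
    nlinarith
  · intro r hr1 hr2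
    have hr1' : 1 / 2 ≤ (r : ℝ) := hr1
    have hr2' : (r : ℝ) ≤ 3 / 4 := hr2
    refine inBack_polar (hx r) (hpos r) fun n hn => ?_
    have h1 := hint r n hn
    have h2 := step_le_step (by norm_num) hr1' r.2.2
    have h2' := step_le_step r.2.1 hr2' (by norm_num)
    have h3 : n - lowEnd i < 3 := by
      have : ((n - lowEnd i : ℤ) : ℝ) < (3 : ℤ) := by push_cast at h1 ⊢; linarith
      exact_mod_cast this
    have h3' : 1 < n - lowEnd i := by
      have : ((1 : ℤ) : ℝ) < ((n - lowEnd i : ℤ) : ℝ) := by push_cast at h1 ⊢; linarith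
      exact_mod_cast this
    have h4 : n - lowEnd i = 2 := by omega
    rw [h4] at h1
    push_cast at h1
    have h5 : 61 / 100 < (r : ℝ) := lt_of_step_lt (mem_I_of (by norm_num) (by norm_num)) r.2 (by
      have : step (61 / 100) = 331169 / 500000 := by norm_num [step]
      linarith)
    have h5' : (r : ℝ) < 62 / 100 := lt_of_step_lt r.2 (mem_I_of (by norm_num) (by norm_num)) (by
      have : step (62 / 100) = 42284 / 62500 := by norm_num [step]
      linarith)
    have h6 := sq_mul_one_sub_mono (by norm_num) h5.le (by linarith)
    have h7 := pow_le_pow_left₀ (by norm_num) h6 2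
    have h8 : 23 / 100 ≤ (r : ℝ) * (1 - r) := by nlinarith
    norm_num at h7
    rw [(modulus_inr_of_bulge hb r).1]
    nlinarith
  · intro r hr
    have hr' : 3 / 4 ≤ (r : ℝ) := hr
    refine inFront_polar (hx r) (hpos r).le fun n hn => ?_
    have h1 := hint r n hn
    have h2 := step_le_step (by norm_num) hr' r.2.2
    have h3' : 2 < n - lowEnd i := by
      have : ((2 : ℤ) : ℝ) < ((n - lowEnd i : ℤ) : ℝ) := by push_cast at h1 ⊢; linarith
      exact_mod_cast this
    have h3 : (3 : ℝ) ≤ ((n - lowEnd i : ℤ) : ℝ) := by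
      have : 3 ≤ n - lowEnd i := by omega
      exact_mod_cast this
    have h4 : (r : ℝ) = 1 := step_inj r.2 one_mem_I
      (le_antisymm (by rw [step_one]; exact step_le_one r.2) (by rw [step_one]; linarith))
    rw [(modulus_inr_of_bulge hb r).1, h4]
    norm_num
  · refine ⟨lowEnd i + 1, _, _, rfl, hpos _, ?_, ?_, hx _⟩ <;>
      rw [(modulus_inr_of_bulge hb _).2, Subtype.coe_mk, hs'] <;> push_cast <;> linarith
  · refine ⟨lowEnd i + 2, _, _, rfl, hpos _, ?_, ?_, hx _⟩ <;>
      rw [(modulus_inr_of_bulge hb _).2, Subtype.coe_mk, ht'] <;> push_cast <;> linarith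

/-- A branch without bulge stays in the unit disc. -/
theorem spoke_comp_inner (i : Fin 9) (hb : bulge i = 0) :
    spoke (ini (Sum.inr i, true)) ≫ cls (edge (Sum.inr i, true)) =
      letter (Sum.inr i, true) ≫ spoke (ini (Sum.inr i, false)) := by
  rw [letter, if_pos hb, Category.id_comp]
  refine front_comp _ _ _ fun t => inFront_polar (r := modulus (Sum.inr i) t)
    (θ := angle (Sum.inr i) t) rfl (modulus_pos _ t.2).le fun n _ => ?_
  have := mul_nonneg (dip_pos i).le (mul_one_sub_nonneg t.2)
  simp only [modulus, hb]
  linarith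

theorem cls_eq_of_comp_eq {x y z : S} {p : Path x y} {u : Hom z x} {ω : Hom z z} {v : Hom z y}
    (h : u ≫ cls p = ω ≫ v) : cls p = inv u ≫ ω ≫ v :=
  (IsIso.eq_inv_comp u).2 h

theorem cls_symm_eq_of_comp_eq {x y z : S} {p : Path x y} {u : Hom z x} {ω : Hom z z}
    {v : Hom z y} (h : u ≫ cls p = ω ≫ v) : cls p.symm = inv v ≫ inv ω ≫ u := by
  rw [cls_symm, cls_eq_of_comp_eq h]
  simp

theorem cls_edge (x : OBranch) :
    cls (edge x) = inv (spoke (ini x)) ≫ letter x ≫ spoke (ini x.rev) := by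
  have key : ∀ b : Branch, spoke (ini (b, true)) ≫ cls (edge (b, true)) =
      letter (b, true) ≫ spoke (ini (b, false)) := by
    rintro (k | i)
    · exact spoke_comp_loop k
    · by_cases hb : bulge i = 0
      · exact spoke_comp_inner i hb
      · exact spoke_comp_bulge i hb
  obtain ⟨b, _ | _⟩ := x
  · have h : letter (b, false) = inv (letter (b, true)) := letter_rev (b, true)
    rw [h]
    exact cls_symm_eq_of_comp_eq (key b)
  · exact cls_eq_of_comp_eq (key b)

/-! ### Paths that follow an edge path -/

theorem follows_iff {p : I → S} {l : List OBranch} :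
    Follows p l ↔ ∃ θ : I → ℝ, Continuous θ ∧ StrictMono θ ∧ θ 0 = 0 ∧ θ 1 = l.length ∧
      ∀ (t : I) (i : ℕ) (hi : i < l.length), (i : ℝ) ≤ θ t → θ t ≤ (i : ℝ) + 1 →
        p t = branchPath l[i] (Set.projIcc 0 1 zero_le_one (θ t - (i : ℝ))) :=
  ⟨fun ⟨θ, h1, h2, h3, h4, h5⟩ => ⟨θ, h1, h2, h3, h4, fun t i hi => h5 t ⟨i, hi⟩⟩,
    fun ⟨θ, h1, h2, h3, h4, h5⟩ => ⟨θ, h1, h2, h3, h4, fun t i => h5 t i i.2⟩⟩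

theorem follows_single (x : OBranch) : Follows (branchPath x) [x] := by
  refine follows_iff.2 ⟨fun t => t, continuous_subtype_val, fun s t h => h, rfl, by simp, ?_⟩
  rintro t i hi - -
  have h0 : i = 0 := by simpa using hi
  subst h0
  simp [Set.projIcc_val]

theorem follows_symm {p : I → S} {l : List OBranch} (h : Follows p l) :
    Follows (fun t => p (unitInterval.symm t)) (l.reverse.map OBranch.rev) := by
  obtain ⟨θ, h1, h2, h3, h4, h5⟩ := follows_iff.1 h
  refine follows_iff.2 ⟨fun t => l.length - θ (unitInterval.symm t), by fun_prop,
    fun s t hst => ?_, by simp [h4], by simp [h3], fun t i hi hi1 hi2 => ?_⟩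
  · have : θ (unitInterval.symm t) < θ (unitInterval.symm s) :=
      h2 (unitInterval.strictAnti_symm hst)
    linarith
  · have hi' : i < l.length := by simpa using hi
    have hc : ((l.length - 1 - i : ℕ) : ℝ) = l.length - 1 - i := by
      rw [Nat.cast_sub (by omega), Nat.cast_sub (by omega), Nat.cast_one]
    rw [h5 (unitInterval.symm t) (l.length - 1 - i) (by omega) (by rw [hc]; linarith)
      (by rw [hc]; linarith)]
    simp only [List.getElem_map, List.getElem_reverse]
    rw [branchPath_rev]
    congr 1
    ext
    rw [hc, unitInterval.coe_symm_eq, Set.coe_projIcc, Set.coe_projIcc,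
      min_eq_right (by linarith), min_eq_right (by linarith), max_eq_right (by linarith),
      max_eq_right (by linarith)]
    ring

/-- The number of edges passed along the image of an edge path `l`, when the image of each edge `x`
is parametrized by `Θ x`. -/
noncomputable def totalParam (Θ : OBranch → I → ℝ) : List OBranch → ℝ → ℝ
  | [], _ => 0
  | x :: l, u => Θ x (Set.projIcc 0 1 zero_le_one u) + totalParam Θ l (u - 1)

section totalParam

variable {Θ : OBranch → I → ℝ}

theorem continuous_totalParam (h : ∀ x, Continuous (Θ x)) (l : List OBranch) :
    Continuous (totalParam Θ l) := by
  induction l with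
  | nil => exact continuous_const
  | cons x l ih =>
    exact ((h x).comp continuous_projIcc).add (ih.comp (continuous_id.sub continuous_const))

theorem monotone_totalParam (h : ∀ x, StrictMono (Θ x)) (l : List OBranch) :
    Monotone (totalParam Θ l) := by
  induction l with
  | nil => exact monotone_const
  | cons x l ih =>
    intro u v huv
    exact add_le_add ((h x).monotone (Set.monotone_projIcc _ huv)) (ih (by linarith))

theorem totalParam_of_nonpos (h : ∀ x, Θ x 0 = 0) (l : List OBranch) {u : ℝ} (hu : u ≤ 0) :
    totalParam Θ l u = 0 := by
  induction l generalizing u with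
  | nil => rfl
  | cons x l ih =>
    have h0 : Set.projIcc (0 : ℝ) 1 zero_le_one u = 0 := Set.projIcc_of_le_left _ hu
    rw [totalParam, ih (by linarith), h0, h, add_zero]

theorem totalParam_of_length_le {image : OBranch → List OBranch}
    (h : ∀ x, Θ x 1 = (image x).length) (l : List OBranch) {u : ℝ} (hu : l.length ≤ u) :
    totalParam Θ l u = (l.flatMap image).length := by
  induction l generalizing u with
  | nil => simp [totalParam]
  | cons x l ih =>
    rw [List.length_cons] at hu
    push_cast at hu
    have h0 : Set.projIcc (0 : ℝ) 1 zero_le_one u = 1 :=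
      Set.projIcc_of_right_le _ (by linarith [(Nat.cast_nonneg l.length : (0 : ℝ) ≤ _)])
    rw [totalParam, ih (by linarith), h0, h, List.flatMap_cons, List.length_append]
    push_cast; rfl

theorem strictMonoOn_totalParam (h : ∀ x, StrictMono (Θ x)) (l : List OBranch) :
    StrictMonoOn (totalParam Θ l) (Set.Icc 0 l.length) := by
  induction l with
  | nil =>
    intro u hu v hv huv
    simp only [List.length_nil, Nat.cast_zero, Set.Icc_self, Set.mem_singleton_iff] at hu hv
    linarith
  | cons x l ih =>
    intro u hu v hv huv
    rw [List.length_cons] at hu hv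
    push_cast at hu hv
    rcases lt_or_ge u 1 with h1 | h1
    · refine add_lt_add_of_lt_of_le (h x ?_) (monotone_totalParam h l (by linarith))
      rw [← Subtype.coe_lt_coe, Set.coe_projIcc, Set.coe_projIcc, min_eq_right h1.le,
        max_eq_right hu.1]
      exact lt_max_of_lt_right (lt_min h1 huv)
    · exact add_lt_add_of_le_of_lt ((h x).monotone (Set.monotone_projIcc _ huv.le))
        (ih ⟨by linarith, by linarith [hu.2]⟩ ⟨by linarith, by linarith [hv.2]⟩ (by linarith))

/-- At each parameter, the position along the image path matches a position along `l`. -/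
theorem exists_totalParam_index {g : S → S} {image : OBranch → List OBranch}
    (hm : ∀ x, StrictMono (Θ x)) (h0 : ∀ x, Θ x 0 = 0) (h1 : ∀ x, Θ x 1 = (image x).length)
    (hg : ∀ x (s : I) (i : ℕ) (hi : i < (image x).length), (i : ℝ) ≤ Θ x s → Θ x s ≤ (i : ℝ) + 1 →
      g (branchPath x s) = branchPath (image x)[i] (Set.projIcc 0 1 zero_le_one (Θ x s - i)))
    (l : List OBranch) {u : ℝ} (hu0 : 0 ≤ u) (hu1 : u ≤ l.length) (i : ℕ)
    (hi : i < (l.flatMap image).length) (hi0 : (i : ℝ) ≤ totalParam Θ l u)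
    (hi1 : totalParam Θ l u ≤ (i : ℝ) + 1) :
    ∃ (j : ℕ) (hj : j < l.length), (j : ℝ) ≤ u ∧ u ≤ (j : ℝ) + 1 ∧
      g (branchPath l[j] (Set.projIcc 0 1 zero_le_one (u - j))) =
        branchPath (l.flatMap image)[i] (Set.projIcc 0 1 zero_le_one (totalParam Θ l u - i)) := by
  induction l generalizing u i with
  | nil => simp at hi
  | cons x l ih =>
    rw [List.length_cons] at hu1
    push_cast at hu1
    simp only [List.flatMap_cons] at hi ⊢
    have hl := h1 x
    rcases lt_or_ge i (image x).length with hlt | hge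
    · -- Beyond the first edge, more than the edges of its image have been passed.
      have hu : u ≤ 1 := by
        by_contra! hu
        have e : Set.projIcc (0 : ℝ) 1 zero_le_one u = 1 := Set.projIcc_of_right_le _ hu.le
        have h2 : totalParam Θ l 0 < totalParam Θ l (u - 1) :=
          strictMonoOn_totalParam hm l ⟨le_rfl, Nat.cast_nonneg _⟩ ⟨by linarith, by linarith⟩
            (by linarith)
        rw [totalParam_of_nonpos h0 l le_rfl] at h2
        rw [totalParam, e, hl] at hi1
        have h3 : (i : ℝ) + 1 ≤ (image x).length := by exact_mod_cast hlt
        linarith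
      have e : totalParam Θ (x :: l) u = Θ x (Set.projIcc 0 1 zero_le_one u) := by
        rw [totalParam, totalParam_of_nonpos h0 l (by linarith), add_zero]
      rw [e] at hi0 hi1 ⊢
      refine ⟨0, by simp, by simpa using hu0, by simpa using hu, ?_⟩
      rw [List.getElem_append_left hlt]
      simpa using hg x _ i hlt hi0 hi1
    · have hu : 1 ≤ u := by
        by_contra! hu
        have e : totalParam Θ (x :: l) u = Θ x (Set.projIcc 0 1 zero_le_one u) := by
          rw [totalParam, totalParam_of_nonpos h0 l (by linarith), add_zero]
        have h2 : Θ x (Set.projIcc 0 1 zero_le_one u) < Θ x 1 := hm x (by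
          rw [← Subtype.coe_lt_coe, Set.coe_projIcc, min_eq_right hu.le, max_eq_right hu0]
          exact hu)
        have h3 : ((image x).length : ℝ) ≤ i := by exact_mod_cast hge
        linarith
      have e : totalParam Θ (x :: l) u = (image x).length + totalParam Θ l (u - 1) := by
        have e : Set.projIcc (0 : ℝ) 1 zero_le_one u = 1 := Set.projIcc_of_right_le _ hu
        rw [totalParam, e, hl]
      have hc : ((i - (image x).length : ℕ) : ℝ) = i - (image x).length := Nat.cast_sub hge
      rw [List.length_append] at hi
      obtain ⟨j, hj, hj0, hj1, hj2⟩ := ih (u := u - 1) (by linarith) (by linarith)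
        (i - (image x).length) (by omega) (by rw [hc]; linarith) (by rw [hc]; linarith)
      refine ⟨j + 1, by simpa using hj, by push_cast; linarith, by push_cast; linarith, ?_⟩
      rw [List.getElem_append_right hge, List.getElem_cons_succ, e]
      have e1 : u - ((j + 1 : ℕ) : ℝ) = u - 1 - j := by push_cast; ring
      have e2 : ((image x).length + totalParam Θ l (u - 1) - i : ℝ) =
          totalParam Θ l (u - 1) - (i - (image x).length : ℕ) := by rw [hc]; ring
      rw [e1, e2, hj2]

end totalParam

/-- If a map takes each edge to a path that follows an edge path, then it takes a path that follows
an edge path to a path that follows the concatenation. -/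
theorem Follows.flatMap {g : S → S} {image : OBranch → List OBranch} {p : I → S}
    {l : List OBranch} (hp : Follows p l) (hg : ∀ x, Follows (fun t => g (branchPath x t)) (image x)) :
    Follows (fun t => g (p t)) (l.flatMap image) := by
  obtain ⟨θ, h1, h2, h3, h4, h5⟩ := follows_iff.1 hp
  choose Θ g1 g2 g3 g4 g5 using fun x => follows_iff.1 (hg x)
  have hθ : ∀ t, θ t ∈ Set.Icc (0 : ℝ) l.length := fun t =>
    ⟨h3 ▸ h2.monotone t.2.1, h4 ▸ h2.monotone t.2.2⟩
  refine follows_iff.2 ⟨fun t => totalParam Θ l (θ t), (continuous_totalParam g1 l).comp h1,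
    fun s t hst => strictMonoOn_totalParam g2 l (hθ s) (hθ t) (h2 hst), ?_, ?_,
    fun t i hi hi0 hi1 => ?_⟩
  · exact totalParam_of_nonpos g3 l h3.le
  · exact totalParam_of_length_le g4 l h4.ge
  · obtain ⟨j, hj, hj0, hj1, hj2⟩ := exists_totalParam_index g2 g3 g4 g5 l (hθ t).1 (hθ t).2 i hi
      hi0 hi1
    rw [← hj2, h5 t j hj hj0 hj1]

/-- The concatenation of an edge and a path that follows `l` follows `x :: l`. -/
theorem Follows.cons {q r : I → S} {x : OBranch} {l : List OBranch} (hq : Follows q l)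
    (h0 : ∀ (t : I) (ht : (t : ℝ) ≤ 1 / 2), r t =
      branchPath x ⟨2 * t, mul_nonneg zero_le_two t.2.1, by linarith⟩)
    (h1 : ∀ (t : I) (ht : 1 / 2 ≤ (t : ℝ)), r t = q ⟨2 * t - 1, by linarith, by linarith [t.2.2]⟩) :
    Follows r (x :: l) := by
  obtain ⟨θ, g1, g2, g3, g4, g5⟩ := follows_iff.1 hq
  have hle : ∀ t : I, (t : ℝ) ≤ 1 / 2 → Set.projIcc (0 : ℝ) 1 zero_le_one (2 * t - 1) = 0 :=
    fun t ht => Set.projIcc_of_le_left _ (by linarith)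
  have hge : ∀ t : I, 1 / 2 ≤ (t : ℝ) → min (2 * t : ℝ) 1 = 1 :=
    fun t ht => min_eq_right (by linarith)
  refine follows_iff.2 ⟨fun t => min (2 * t : ℝ) 1 + θ (Set.projIcc 0 1 zero_le_one (2 * t - 1)),
    ?_, fun s t hst => ?_, ?_, ?_, fun t i hi hi0 hi1 => ?_⟩
  · have := g1.comp (continuous_projIcc (h := zero_le_one (α := ℝ)))
    fun_prop
  · have hst' : (s : ℝ) < t := hst
    rcases lt_or_ge (s : ℝ) (1 / 2) with hs | hs
    · refine add_lt_add_of_lt_of_le ?_ (g2.monotone (Set.monotone_projIcc _ (by linarith)))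
      rw [min_eq_left (by linarith)]
      exact lt_min (by linarith) (by linarith)
    · refine add_lt_add_of_le_of_lt (min_le_min_right _ (by linarith)) (g2 ?_)
      rw [← Subtype.coe_lt_coe, Set.projIcc_of_mem _ ⟨by linarith, by linarith [s.2.2]⟩,
        Set.projIcc_of_mem _ ⟨by linarith, by linarith [t.2.2]⟩]
      change (2 * s - 1 : ℝ) < 2 * t - 1
      linarith
  · beta_reduce
    rw [hle 0 (by simp)]; simp [g3]
  · have : Set.projIcc (0 : ℝ) 1 zero_le_one (2 * (1 : I) - 1) = 1 :=
      Set.projIcc_of_right_le _ (by simp; norm_num)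
    beta_reduce
    rw [this, hge 1 (by simp; norm_num), g4]; simp [add_comm]
  · rcases le_or_gt (t : ℝ) (1 / 2) with ht | ht
    · simp only [hle t ht, g3, add_zero, min_eq_left (show (2 * t : ℝ) ≤ 1 by linarith)] at hi0 hi1 ⊢
      rcases Nat.eq_zero_or_pos i with rfl | hpos
      · rw [h0 t ht]
        congr 1
        simp [Set.projIcc_of_mem zero_le_one (show (2 * t : ℝ) ∈ Set.Icc (0 : ℝ) 1 from
          ⟨mul_nonneg zero_le_two t.2.1, by linarith⟩)]
      · -- At the end of the first edge, the second one may be used just as well.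
        have hi1' : (1 : ℝ) ≤ i := by exact_mod_cast hpos
        have ht' : (t : ℝ) = 1 / 2 := by linarith
        have hi' : i = 1 := by
          have : (i : ℝ) ≤ 1 := by linarith
          have : i ≤ 1 := by exact_mod_cast this
          omega
        subst hi'
        have e0 : Set.projIcc (0 : ℝ) 1 zero_le_one (2 * t - (1 : ℕ)) = 0 :=
          Set.projIcc_of_le_left _ (by simp [ht'])
        have e1 := g5 0 0 (by simpa using hi) (by simp [g3]) (by simp [g3])
        rw [e0, h1 t ht'.ge, List.getElem_cons_succ]
        have e2 : (⟨2 * t - 1, by linarith, by linarith [t.2.2]⟩ : I) = 0 :=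
          Subtype.ext (by simp [ht'])
        rw [e2, e1]
        congr 1
        simp [g3]
    · have e : Set.projIcc (0 : ℝ) 1 zero_le_one (2 * t - 1) =
          ⟨2 * t - 1, by linarith, by linarith [t.2.2]⟩ := Set.projIcc_of_mem _ _
      simp only [hge t ht.le, e] at hi0 hi1 ⊢
      have hpos : 0 < θ ⟨2 * t - 1, by linarith, by linarith [t.2.2]⟩ := by
        refine g3.symm.trans_lt (g2 ?_)
        change (0 : ℝ) < 2 * t - 1
        linarith
      obtain ⟨j, rfl⟩ : ∃ j, i = j + 1 := by
        refine ⟨i - 1, (Nat.succ_pred_eq_of_ne_zero ?_).symm⟩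
        rintro rfl
        simp at hi1; linarith
      push_cast at hi0 hi1 ⊢
      rw [h1 t ht.le, g5 _ j (by simpa using hi) (by linarith) (by linarith),
        List.getElem_cons_succ]
      congr 2
      ring

/-- The edge path `l` leads from the switch next to `p_j` to the one next to `p_k`. -/
def Connects : ZMod 7 → List OBranch → ZMod 7 → Prop
  | j, [], k => j = k
  | j, x :: l, k => ini x = j ∧ Connects (ini x.rev) l k

instance : ∀ j l k, Decidable (Connects j l k)
  | j, [], k => inferInstanceAs (Decidable (j = k))
  | j, x :: l, k =>
    have := instDecidableConnects (ini x.rev) l k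
    inferInstanceAs (Decidable (ini x = j ∧ Connects (ini x.rev) l k))

/-- The product of the letters of an edge path. -/
noncomputable def word : List OBranch → Hom zeroPt zeroPt
  | [] => 𝟙 _
  | x :: l => letter x ≫ word l

/-- Each edge path is followed by a path, whose class is given by the word of the edge path. -/
theorem exists_path_follows {j k : ZMod 7} {l : List OBranch} (hl : l ≠ []) (h : Connects j l k) :
    ∃ P : Path (switchPt j) (switchPt k), Follows P l ∧
      cls P = inv (spoke j) ≫ word l ≫ spoke k := by
  induction l generalizing j with
  | nil => exact absurd rfl hl
  | cons x l ih =>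
    obtain ⟨rfl, h⟩ := h
    rcases eq_or_ne l [] with rfl | hne
    · obtain rfl : ini x.rev = k := h
      refine ⟨edge x, follows_single x, ?_⟩
      rw [cls_edge]; simp [word]
    · obtain ⟨P, hP, hP'⟩ := ih hne h
      refine ⟨(edge x).trans P, hP.cons (fun t ht => ?_) (fun t ht => ?_), ?_⟩
      · rw [Path.trans_apply, dif_pos ht]; rfl
      · rcases ht.lt_or_eq with h1 | h1
        · rw [Path.trans_apply, dif_neg (not_le.2 h1)]
        · have e0 : (⟨2 * t - 1, by linarith, by linarith [t.2.2]⟩ : I) = 0 :=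
            Subtype.ext (by simp [← h1])
          have e1 : (⟨2 * t, mul_nonneg zero_le_two t.2.1, by linarith⟩ : I) = 1 :=
            Subtype.ext (by simp [← h1])
          rw [Path.trans_apply, dif_pos h1.ge, e0]
          exact (congrArg (edge x) e1).trans ((edge x).target.trans P.source.symm)
      · rw [cls_trans, hP', cls_edge]; simp [word]

/-! ### Edge maps and carrying maps -/

/-- The combinatorial data of a map of `T` to itself that permutes the switches, takes each loop
to a loop with the same direction, and each of the nine other branches to an edge path. -/
structure EdgeMap where
  /-- the action on the switches -/
  perm : ZMod 7 → ZMod 7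
  /-- the images of the nine branches that are not loops -/
  img : Fin 9 → List OBranch

namespace EdgeMap

/-- The image of an oriented branch under an edge map. -/
def image (m : EdgeMap) : OBranch → List OBranch
  | (Sum.inl k, d) => [(Sum.inl (m.perm k), d)]
  | (Sum.inr i, true) => m.img i
  | (Sum.inr i, false) => (m.img i).reverse.map OBranch.rev

/-- An edge map is smooth if the image of a branch is a train path that joins the images of the
switches at its ends, and starts on the same side of the switch as the branch. -/
def IsSmooth (m : EdgeMap) : Prop :=
  ∀ x, (m.image x).IsChain Cont ∧ Connects (m.perm (ini x)) (m.image x) (m.perm (ini x.rev)) ∧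
    ∃ a ∈ (m.image x).head?, ini a = m.perm (ini x) ∧ isLoop a = isLoop x

/-- How often the edge path `l` passes over an end, at the switch next to `p_k`, of a branch that
is not a loop. -/
def endCount (l : List OBranch) (k : ZMod 7) : ℕ :=
  ∑ i, ((if ini (Sum.inr i, true) = k then passes l (Sum.inr i) else 0) +
    if ini (Sum.inr i, false) = k then passes l (Sum.inr i) else 0)

/-- The switch conditions for an image path: it passes twice from one side to the other for each
loop, and it begins and ends on the side of the nine branches. -/
def IsBalanced (m : EdgeMap) : Prop :=
  ∀ i k, endCount (m.img i) k = 2 * passes (m.img i) (Sum.inl k) +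
    ((if m.perm (ini (Sum.inr i, true)) = k then 1 else 0) +
      if m.perm (ini (Sum.inr i, false)) = k then 1 else 0)

theorem image_rev (m : EdgeMap) (x : OBranch) :
    m.image x.rev = (m.image x).reverse.map OBranch.rev := by
  have hr : ∀ x : OBranch, x.rev.rev = x := fun x => by simp [OBranch.rev]
  obtain ⟨k | i, _ | _⟩ := x
  · rfl
  · rfl
  · change m.img i = ((m.img i).reverse.map OBranch.rev).reverse.map OBranch.rev
    rw [← List.map_reverse, List.reverse_reverse, List.map_map]
    have : OBranch.rev ∘ OBranch.rev = id := funext hr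
    rw [this, List.map_id]
  · rfl

end EdgeMap

theorem passes_reverse_rev (l : List OBranch) (b : Branch) :
    passes (l.reverse.map OBranch.rev) b = passes l b := by
  have : Prod.fst ∘ OBranch.rev = Prod.fst := rfl
  rw [passes, List.map_map, this, List.map_reverse, List.count_reverse, passes]

theorem isChain_flatMap {image : OBranch → List OBranch} (h : ∀ x, (image x).IsChain Continues)
    (hne : ∀ x, image x ≠ [])
    (h' : ∀ x y, Continues x y → ∀ a ∈ (image x).getLast?, ∀ b ∈ (image y).head?, Continues a b)
    {l : List OBranch} (hl : l.IsChain Continues) : (l.flatMap image).IsChain Continues := by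
  induction l with
  | nil => simp
  | cons x l ih =>
    rw [List.flatMap_cons, List.isChain_append]
    refine ⟨h x, ih hl.tail, fun a ha b hb => ?_⟩
    cases l with
    | nil => simp at hb
    | cons y l =>
      rw [List.flatMap_cons, List.head?_append_of_ne_nil _ (hne y)] at hb
      exact h' x y (List.isChain_cons_cons.1 hl).1 a ha b hb

/-- At a switch between two branches, the images of the branches meet in the image of the switch, on
its two sides. -/
theorem EdgeMap.IsSmooth.isTrainPath {m : EdgeMap} (hm : m.IsSmooth) {l : List OBranch}
    (hl : IsTrainPath l) : IsTrainPath (l.flatMap m.image) := by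
  have hne : ∀ x, m.image x ≠ [] := fun x h0 => by
    obtain ⟨-, -, a, ha, -⟩ := hm x
    simp [h0] at ha
  refine ⟨fun h0 => ?_, isChain_flatMap (fun x => (hm x).1.imp fun a b => continues_iff.2) hne
    (fun x y hxy a ha b hb => ?_) hl.2⟩
  · obtain ⟨x, hx⟩ := List.exists_mem_of_ne_nil l hl.1
    exact hne x (List.flatMap_eq_nil_iff.1 h0 x hx)
  · obtain ⟨h1, h2⟩ := continues_iff.1 hxy
    obtain ⟨-, -, b', hb', hb1, hb2⟩ := hm y
    obtain ⟨-, -, a', ha', ha1, ha2⟩ := hm x.rev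
    have e : a.rev = a' := by
      rw [m.image_rev, List.head?_map, List.head?_reverse, Option.mem_def.1 ha] at ha'
      exact Option.some_injective _ ha'
    obtain rfl : b = b' := Option.mem_unique hb hb'
    refine continues_iff.2 ⟨?_, ?_⟩
    · rw [e, ha1, h1, hb1]
    · have e1 : isLoop a = isLoop x := by rw [show isLoop a = isLoop a.rev from rfl, e, ha2]; rfl
      rw [e1, hb2]; exact h2

/-- A closed train path is taken to a closed train path by a map of edges that preserves train
paths. -/
theorem IsClosedTrainPath.flatMap {image : OBranch → List OBranch} (hne : ∀ x, image x ≠ [])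
    (h : ∀ l, IsTrainPath l → IsTrainPath (l.flatMap image)) {l : List OBranch}
    (hl : IsClosedTrainPath l) : IsClosedTrainPath (l.flatMap image) := by
  obtain ⟨h1, h2⟩ := hl
  cases l with
  | nil => exact absurd rfl h1
  | cons x l =>
    rw [Cycle.chain_coe_cons] at h2
    have h3 := (h _ ⟨by simp, h2⟩).2
    rw [List.flatMap_cons, List.flatMap_append, List.flatMap_cons, List.flatMap_nil,
      List.append_nil] at h3
    rw [List.flatMap_cons]
    cases hx : image x with
    | nil => exact absurd hx (hne x)
    | cons a l' =>
      refine ⟨by simp, ?_⟩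
      rw [List.cons_append, Cycle.chain_coe_cons]
      rw [hx] at h3
      refine h3.prefix ⟨l', ?_⟩
      simp

theorem Follows.ne_nil {p : I → S} {l : List OBranch} (h : Follows p l) : l ≠ [] := by
  obtain ⟨θ, -, h2, h3, h4, -⟩ := h
  rintro rfl
  have := h2 (show (0 : I) < 1 from zero_lt_one)
  rw [h3, h4] at this
  simp at this

theorem edge_inj (b b' : Branch) (t t' : I) (h : edge (b, true) t = edge (b', true) t') :
    (b = b' ∧ t = t') ∨ ((t = 0 ∨ t = 1) ∧ (t' = 0 ∨ t' = 1)) := by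
  have h1 : curve b t = curve b' t' := OnePoint.coe_injective (congrArg Subtype.val h)
  have hend : ∀ t : I, IsEnd t → t = 0 ∨ t = 1 := fun t ht =>
    ht.imp (fun h => Subtype.ext h) fun h => Subtype.ext h
  rcases eq_or_isEnd_of_curve_eq t.2 t'.2 h1 with ⟨h2, h3⟩ | ⟨h2, h3⟩
  · exact Or.inl ⟨h2, Subtype.ext h3⟩
  · exact Or.inr ⟨hend t h2, hend t' h3⟩

/-- The class of a path with tracks attached to both ends; the parts of the tracks that run along the
spokes `s` and `s'` cancel. -/
theorem cls_conj {x y x' y' : S} {c : Path x x'} {P : Path x' y'} {d : Path y y'} {e : Hom zeroPt x}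
    {e' : Hom zeroPt y} {s : Hom zeroPt x'} {s' : Hom zeroPt y'} {u u' ω : Hom zeroPt zeroPt}
    (hc : cls c = inv e ≫ u ≫ s) (hP : cls P = inv s ≫ ω ≫ s')
    (hd : cls d = inv e' ≫ u' ≫ s') :
    cls (c.trans (P.trans d.symm)) = inv e ≫ (u ≫ ω ≫ inv u') ≫ e' := by
  rw [cls_trans, cls_trans, cls_symm, hc, hP, hd]
  simp

/-- A homeomorphism that takes the classes of the branches to those of their images under an edge
map, up to a change of the path from the base point to each switch, is homotopic to a map that is
this edge map on `T`. -/
theorem EdgeMap.exists_homotopic (m : EdgeMap) (hm : m.IsSmooth) (φ : S ≃ₜ S)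
    (h0 : φ zeroPt = zeroPt) (u : ZMod 7 → Hom zeroPt zeroPt)
    (hφ : ∀ b, push (cm φ) h0 h0 (letter (b, true)) =
      u (ini (b, true)) ≫ word (m.image (b, true)) ≫ inv (u (ini (b, false)))) :
    ∃ G : C(S, S), G.Homotopic (cm φ) ∧ ∀ x, Follows (fun t => G (branchPath x t)) (m.image x) := by
  have hne : ∀ x, m.image x ≠ [] := fun x h0 => by
    obtain ⟨-, -, a, ha, -⟩ := hm x
    simp [h0] at ha
  choose P hP hP' using fun b => exists_path_follows (hne (b, true)) (hm (b, true)).2.1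
  choose c hc using fun v => exists_cls
    (inv (push (cm φ) h0 (rfl : cm φ (switchPt v) = _) (spoke v)) ≫ u v ≫ spoke (m.perm v))
  have hcls : ∀ {x y : S} (p : Path x y), cls (p.map (cm φ).continuous) =
      push (cm φ) rfl rfl (cls p) := fun p => (push_cls _ _ _ fun t => rfl).symm
  obtain ⟨G, hG, hG'⟩ := exists_homotopic_eq_on_graph (E := Branch) (V := ZMod 7) (pos := switchPt)
    (a := fun b => ini (b, true)) (b := fun b => ini (b, false)) (fun b => edge (b, true))
    edge_inj switchPt_injective (cm φ) (pos' := fun v => switchPt (m.perm v)) c P fun b => by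
      rw [← cls_eq_iff]
      refine (hcls (edge (b, true))).trans ?_
      refine (congrArg (push (cm φ) rfl rfl) (cls_edge (b, true))).trans ?_
      rw [push_comp (cm φ) _ h0 _, push_comp (cm φ) _ h0 _, push_inv, hφ]
      exact (cls_conj (hc _) (hP' b) (hc (ini (b, false)))).symm
  refine ⟨G, hG, ?_⟩
  have key : ∀ b, Follows (fun t => G (branchPath (b, true) t)) (m.image (b, true)) := fun b => by
    have : (fun t => G (branchPath (b, true) t)) = P b := funext fun t => hG' b t
    rw [this]
    exact hP b
  rintro ⟨b, _ | _⟩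
  · have := follows_symm (key b)
    rw [← m.image_rev] at this
    exact this
  · exact key b

/-- A map homotopic to `φ` gives a map homotopic to the identity on composition with `φ⁻¹`. -/
theorem homotopic_comp_inv {φ : S ≃ₜ S} {G : C(S, S)} (hG : G.Homotopic (cm φ)) :
    (G.comp (cm φ⁻¹)).Homotopic (ContinuousMap.id S) := by
  have := hG.comp (.refl (cm φ⁻¹))
  have e : (cm φ).comp (cm φ⁻¹) = ContinuousMap.id S := by
    ext1 x; exact φ.apply_symm_apply x
  rwa [e] at this

/-- The carrying map of a composition is homotopic to the identity. -/
theorem homotopic_conj {φ : S ≃ₜ S} {f g : C(S, S)} (hf : f.Homotopic (ContinuousMap.id S))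
    (hg : g.Homotopic (ContinuousMap.id S)) :
    (f.comp ((cm φ).comp (g.comp (cm φ⁻¹)))).Homotopic (ContinuousMap.id S) := by
  have h1 : ((cm φ).comp (g.comp (cm φ⁻¹))).Homotopic (ContinuousMap.id S) :=
    homotopic_comp_inv (G := (cm φ).comp g) ((ContinuousMap.Homotopic.refl (cm φ)).comp hg)
  exact hf.comp h1

/-! ### The action on weights, and composition -/

/-- Invariance in the form that is used for compositions: the images of the two orientations of a
branch pass equally often over each branch, and the matrix describes the action on all weights, not
only on those that satisfy the switch conditions. -/
def StronglyInvariant (φ : S ≃ₜ S) (N : Matrix (Fin 9) (Fin 9) ℝ) : Prop :=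
  ∃ c : CarryingMap φ, (∀ x b, passes (c.image x.rev) b = passes (c.image x) b) ∧
    (∀ μ, w (c.push μ) = N *ᵥ w μ) ∧ ∀ μ, IsTransverse μ → IsTransverse (c.push μ)

theorem StronglyInvariant.invariantWithMatrix {φ : S ≃ₜ S} {N : Matrix (Fin 9) (Fin 9) ℝ}
    (h : StronglyInvariant φ N) : InvariantWithMatrix φ N := by
  obtain ⟨c, -, h1, h2⟩ := h
  exact ⟨c, fun μ hμ => ⟨h2 μ hμ, h1 μ⟩⟩

theorem CarryingMap.image_ne_nil {φ : S ≃ₜ S} (c : CarryingMap φ) (x : OBranch) : c.image x ≠ [] :=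
  (c.follows x).ne_nil

instance : LawfulBEq Branch where
  eq_of_beq {a b} h := by
    rcases a with a | a <;> rcases b with b | b
    · exact congrArg Sum.inl (eq_of_beq (α := ZMod 7) h)
    · exact absurd h Bool.false_ne_true
    · exact absurd h Bool.false_ne_true
    · exact congrArg Sum.inr (eq_of_beq (α := Fin 9) h)
  rfl {a} := by
    rcases a with a | a
    · exact beq_self_eq_true (α := ZMod 7) a
    · exact beq_self_eq_true (α := Fin 9) a

theorem passes_cons (x : OBranch) (l : List OBranch) (b : Branch) :
    passes (x :: l) b = passes l b + if x.1 = b then 1 else 0 := by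
  rw [passes, List.map_cons, List.count_cons, passes]
  congr 1
  by_cases h : x.1 = b
  · rw [if_pos h, if_pos (beq_iff_eq.2 h)]
  · rw [if_neg h, if_neg fun h' => h (beq_iff_eq.1 h')]

theorem passes_flatMap {image : OBranch → List OBranch}
    (h : ∀ x b, passes (image x.rev) b = passes (image x) b) (l : List OBranch) (b : Branch) :
    passes (l.flatMap image) b = ∑ b', passes (image (b', true)) b * passes l b' := by
  have hx : ∀ x : OBranch, passes (image x) b = passes (image (x.1, true)) b := by
    rintro ⟨b', _ | _⟩
    · exact h (b', true) b
    · rfl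
  induction l with
  | nil => simp [passes]
  | cons x l ih =>
    have h1 : passes ((x :: l).flatMap image) b = passes (image x) b + passes (l.flatMap image) b := by
      simp [passes]
    rw [h1, ih, hx]
    simp only [passes_cons, mul_add, Finset.sum_add_distrib, mul_ite, mul_one, mul_zero,
      Finset.sum_ite_eq, Finset.mem_univ, if_true]
    ring

/-- The composition of carrying maps. -/
noncomputable def CarryingMap.comp {φ ψ : S ≃ₜ S} (c : CarryingMap φ) (d : CarryingMap ψ) :
    CarryingMap (φ * ψ) where
  f := c.f.comp ((cm φ).comp (d.f.comp (cm φ⁻¹)))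
  homotopic := homotopic_conj c.homotopic d.homotopic
  image x := (d.image x).flatMap c.image
  follows x := by
    have h := (d.follows x).flatMap (g := fun y => c.f (φ y)) c.follows
    have e : ∀ t, φ.symm (φ (ψ (branchPath x t))) = ψ (branchPath x t) := fun t =>
      φ.symm_apply_apply _
    change Follows (fun t => c.f (φ (d.f (φ.symm (φ (ψ (branchPath x t))))))) _
    simp only [e]
    exact h
  smooth l hl := by
    rw [← List.flatMap_assoc]
    exact c.smooth _ (d.smooth _ hl)

theorem CarryingMap.push_comp {φ ψ : S ≃ₜ S} (c : CarryingMap φ) (d : CarryingMap ψ)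
    (hc : ∀ x b, passes (c.image x.rev) b = passes (c.image x) b) (μ : Branch → ℝ) :
    (c.comp d).push μ = c.push (d.push μ) := by
  ext b
  simp only [CarryingMap.push, CarryingMap.comp, passes_flatMap hc, Finset.mul_sum]
  push_cast
  simp only [Finset.sum_mul]
  rw [Finset.sum_comm]
  exact Finset.sum_congr rfl fun _ _ => Finset.sum_congr rfl fun _ _ => by ring

theorem StronglyInvariant.mul {φ ψ : S ≃ₜ S} {M N : Matrix (Fin 9) (Fin 9) ℝ}
    (hφ : StronglyInvariant φ M) (hψ : StronglyInvariant ψ N) :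
    StronglyInvariant (φ * ψ) (M * N) := by
  obtain ⟨c, c1, c2, c3⟩ := hφ
  obtain ⟨d, d1, d2, d3⟩ := hψ
  refine ⟨c.comp d, fun x b => ?_, fun μ => ?_, fun μ hμ => ?_⟩
  · change passes ((d.image x.rev).flatMap c.image) b = passes ((d.image x).flatMap c.image) b
    simp only [passes_flatMap c1, d1]
  · rw [c.push_comp d c1, c2, d2, Matrix.mulVec_mulVec]
  · rw [c.push_comp d c1]
    exact c3 _ (d3 _ hμ)

theorem StronglyInvariant.pow_mul {φ ψ : S ≃ₜ S} {M N : Matrix (Fin 9) (Fin 9) ℝ}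
    (hφ : StronglyInvariant φ M) (hψ : StronglyInvariant ψ N) (n : ℕ) :
    StronglyInvariant (φ ^ n * ψ) (M ^ n * N) := by
  induction n with
  | zero => simpa using hψ
  | succ n ih =>
    rw [pow_succ', pow_succ', mul_assoc, mul_assoc]
    exact hφ.mul ih

/-- A map that leaves `T` invariant takes a curve that is carried by `T` to a curve that is carried
by `T`, with the transformed weights. -/
theorem CarriedWithWeights.map {φ : S ≃ₜ S} {N : Matrix (Fin 9) (Fin 9) ℝ}
    (hφ : StronglyInvariant φ N) {γ : I → S} {v : Fin 9 → ℝ} (hγ : CarriedWithWeights γ v) :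
    CarriedWithWeights (fun s => φ (γ s)) (N *ᵥ v) := by
  obtain ⟨c, c1, c2, -⟩ := hφ
  obtain ⟨f, hf, l, hl, hl', hw⟩ := hγ
  refine ⟨c.f.comp ((cm φ).comp (f.comp (cm φ⁻¹))), homotopic_conj c.homotopic hf,
    l.flatMap c.image, hl.flatMap c.image_ne_nil c.smooth, ?_, fun i => ?_⟩
  · have h := hl'.flatMap (g := fun y => c.f (φ y)) c.follows
    have e : ∀ t, φ.symm (φ (γ t)) = γ t := fun t => φ.symm_apply_apply _
    change Follows (fun t => c.f (φ (f (φ.symm (φ (γ t)))))) _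
    simp only [e]
    exact h
  · have e1 : w (fun b => (passes l b : ℝ)) = v := funext hw
    rw [← e1, ← c2, passes_flatMap c1]
    push_cast
    rfl

namespace EdgeMap

/-- The matrix of an edge map: the entry at `(i, j)` says how often the image of the `j`-th branch
passes over the `i`-th branch. -/
def mat (m : EdgeMap) : Matrix (Fin 9) (Fin 9) ℝ := .of fun i j => (passes (m.img j) (Sum.inr i) : ℝ)

theorem endSum_passes (l : List OBranch) (k : ZMod 7) :
    endSum (fun i => (passes l (Sum.inr i) : ℝ)) k = endCount l k := by
  simp [endSum, endCount]

theorem endSum_sum {ι : Type*} (s : Finset ι) (v : ι → Fin 9 → ℝ) (c : ι → ℝ) (k : ZMod 7) :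
    endSum (fun i => ∑ j ∈ s, v j i * c j) k = ∑ j ∈ s, endSum (v j) k * c j := by
  simp only [endSum, Finset.sum_mul]
  rw [Finset.sum_comm]
  refine Finset.sum_congr rfl fun i _ => ?_
  split_ifs <;> simp [add_mul, Finset.sum_add_distrib]

/-- The weights of the image satisfy the switch conditions: an image path contributes equally to
both sides of a switch, except at its ends, and the contributions of the ends agree by the switch
conditions for `μ`. -/
theorem IsBalanced.isTransverse {m : EdgeMap} (hm : m.IsBalanced) {μ ν : Branch → ℝ}
    (hμ : IsTransverse μ)
    (hν : ∀ b, ν b = ∑ b', (passes (m.image (b', true)) b : ℝ) * μ b') : IsTransverse ν := by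
  obtain ⟨h0, h1⟩ := isTransverse_iff.1 hμ
  refine isTransverse_iff.2 ⟨fun b => ?_, fun k => ?_⟩
  · rw [hν]
    exact Finset.sum_nonneg fun b' _ => mul_nonneg (Nat.cast_nonneg _) (h0 b')
  have e1 : ∀ k' b, (passes (m.image (Sum.inl k', true)) b : ℝ) =
      if Sum.inl (m.perm k') = b then 1 else 0 := fun k' b => by
    rw [image, passes_cons]
    simp [passes]
  have e2 : w ν = fun i => ∑ j, (passes (m.img j) (Sum.inr i) : ℝ) * w μ j := by
    ext i
    rw [w, hν, Fintype.sum_sum_type]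
    simp only [e1]
    simp [image, w]
  have e3 : ∀ j, (endCount (m.img j) k : ℝ) = 2 * passes (m.img j) (Sum.inl k) +
      ((if m.perm (ini (Sum.inr j, true)) = k then 1 else 0) +
        if m.perm (ini (Sum.inr j, false)) = k then 1 else 0) := fun j => by
    exact_mod_cast hm j k
  -- The ends of the image paths at the switch are the ends at its preimages.
  have e4 : ∑ k', (if m.perm k' = k then endSum (w μ) k' else 0) =
      ∑ j, ((if m.perm (ini (Sum.inr j, true)) = k then 1 else 0) +
        if m.perm (ini (Sum.inr j, false)) = k then 1 else 0) * w μ j := by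
    simp only [endSum, ← Finset.sum_filter]
    rw [Finset.sum_comm]
    refine Finset.sum_congr rfl fun j _ => ?_
    rw [Finset.sum_add_distrib]
    simp [add_mul]
  rw [e2, endSum_sum]
  simp only [endSum_passes, e3, add_mul (2 * (_ : ℝ)), Finset.sum_add_distrib]
  rw [← e4, hν, Fintype.sum_sum_type, mul_add, add_comm, Finset.mul_sum, Finset.mul_sum]
  congr 1
  · exact Finset.sum_congr rfl fun j _ => by rw [mul_assoc]; rfl
  · refine Finset.sum_congr rfl fun k' _ => ?_
    rw [e1, ← h1]
    simp only [Sum.inl.injEq]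
    split_ifs <;> simp

/-- The criterion for invariance: an edge map that describes the action of `φ` on the classes of the
branches, up to a change `u` of the paths from the base point to the switches. -/
theorem stronglyInvariant (m : EdgeMap) (hm : m.IsSmooth) (hb : m.IsBalanced) (φ : S ≃ₜ S)
    (h0 : φ zeroPt = zeroPt) (u : ZMod 7 → Hom zeroPt zeroPt)
    (hφ : ∀ b, push (cm φ) h0 h0 (letter (b, true)) =
      u (ini (b, true)) ≫ word (m.image (b, true)) ≫ inv (u (ini (b, false)))) :
    StronglyInvariant φ m.mat := by
  obtain ⟨G, hG, hG'⟩ := m.exists_homotopic hm φ h0 u hφ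
  refine ⟨⟨G.comp (cm φ⁻¹), homotopic_comp_inv hG, m.image, fun x => ?_,
    fun l hl => hm.isTrainPath hl⟩, fun x b => ?_, fun μ => ?_, fun μ hμ => ?_⟩
  · have e : ∀ t, φ.symm (φ (branchPath x t)) = branchPath x t := fun t => φ.symm_apply_apply _
    change Follows (fun t => G (φ.symm (φ (branchPath x t)))) _
    simp only [e]
    exact hG' x
  · change passes (m.image x.rev) b = passes (m.image x) b
    rw [m.image_rev, passes_reverse_rev]
  · ext i
    rw [w, CarryingMap.push, Fintype.sum_sum_type]
    simp [image, passes, w, mat, Matrix.mulVec, dotProduct]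
  · exact hb.isTransverse hμ fun b => rfl

end EdgeMap

/-! ### The maps `τ` and `τ ∘ ρ` -/

/-- The edge map of `τ`. Here `Sum.inl k` is the loop around `p_k`, `Sum.inr 0, …, Sum.inr 8` are the
nine branches, and `false` marks the reversed direction. -/
def tauEdgeMap : EdgeMap where
  perm k := if k = 0 then 1 else if k = 1 then 2 else if k = 2 then 0 else k
  img := ![[(Sum.inr 0, true)], [(Sum.inr 1, true)], [(Sum.inr 2, true)],
    [(Sum.inr 8, true), (Sum.inl 2, false), (Sum.inr 3, true)],
    [(Sum.inr 8, true), (Sum.inl 2, false), (Sum.inr 4, true)],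
    [(Sum.inr 7, false), (Sum.inl 0, true), (Sum.inr 8, true), (Sum.inl 2, true),
      (Sum.inr 8, false), (Sum.inl 0, false), (Sum.inr 5, true)],
    [(Sum.inr 7, false), (Sum.inl 0, true), (Sum.inr 6, true)],
    [(Sum.inr 7, false), (Sum.inl 0, true), (Sum.inr 8, true)],
    [(Sum.inr 7, false), (Sum.inl 0, true), (Sum.inr 8, true), (Sum.inl 2, true),
      (Sum.inr 8, false)]]

/-- The edge map of `τ ∘ ρ`. -/
def tauRhoEdgeMap : EdgeMap where
  perm k := tauEdgeMap.perm (k + 3)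
  img := ![[(Sum.inr 6, false)], [(Sum.inr 3, false)],
    [(Sum.inr 6, false), (Sum.inl 0, false), (Sum.inr 7, true)],
    [(Sum.inr 4, false), (Sum.inl 2, true), (Sum.inr 8, false)],
    [(Sum.inr 4, false)], [(Sum.inr 0, true)], [(Sum.inr 5, false)], [(Sum.inr 2, true)],
    [(Sum.inr 1, true)]]

instance (m : EdgeMap) : Decidable m.IsSmooth := by
  unfold EdgeMap.IsSmooth; infer_instance

instance (m : EdgeMap) : Decidable m.IsBalanced := by
  unfold EdgeMap.IsBalanced; infer_instance

theorem isSmooth_tauEdgeMap : tauEdgeMap.IsSmooth := by decide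

theorem isBalanced_tauEdgeMap : tauEdgeMap.IsBalanced := by decide

theorem isSmooth_tauRhoEdgeMap : tauRhoEdgeMap.IsSmooth := by decide

theorem isBalanced_tauRhoEdgeMap : tauRhoEdgeMap.IsBalanced := by decide

theorem mat_tauEdgeMap : tauEdgeMap.mat = matA := by
  have h : ∀ i j, passes (tauEdgeMap.img j) (Sum.inr i) =
      (![![1, 0, 0, 0, 0, 0, 0, 0, 0],
        ![0, 1, 0, 0, 0, 0, 0, 0, 0],
        ![0, 0, 1, 0, 0, 0, 0, 0, 0],
        ![0, 0, 0, 1, 0, 0, 0, 0, 0],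
        ![0, 0, 0, 0, 1, 0, 0, 0, 0],
        ![0, 0, 0, 0, 0, 1, 0, 0, 0],
        ![0, 0, 0, 0, 0, 0, 1, 0, 0],
        ![0, 0, 0, 0, 0, 1, 1, 1, 1],
        ![0, 0, 0, 1, 1, 2, 0, 1, 2]] : Fin 9 → Fin 9 → ℕ) i j := by decide
  ext i j
  rw [EdgeMap.mat, Matrix.of_apply, h]
  fin_cases i <;> fin_cases j <;> simp [matA]

theorem mat_tauRhoEdgeMap : tauRhoEdgeMap.mat = matM := by
  have h : ∀ i j, passes (tauRhoEdgeMap.img j) (Sum.inr i) =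
      (![![0, 0, 0, 0, 0, 1, 0, 0, 0],
        ![0, 0, 0, 0, 0, 0, 0, 0, 1],
        ![0, 0, 0, 0, 0, 0, 0, 1, 0],
        ![0, 1, 0, 0, 0, 0, 0, 0, 0],
        ![0, 0, 0, 1, 1, 0, 0, 0, 0],
        ![0, 0, 0, 0, 0, 0, 1, 0, 0],
        ![1, 0, 1, 0, 0, 0, 0, 0, 0],
        ![0, 0, 1, 0, 0, 0, 0, 0, 0],
        ![0, 0, 0, 1, 0, 0, 0, 0, 0]] : Fin 9 → Fin 9 → ℕ) i j := by decide
  ext i j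
  rw [EdgeMap.mat, Matrix.of_apply, h]
  fin_cases i <;> fin_cases j <;> simp [matM]

theorem tau_zeroPt : cm tau zeroPt = zeroPt :=
  (Homeomorph.symm_apply_eq _).2 ((halfTwist_zeroPt 1).trans (halfTwist_zeroPt 0).symm)

theorem tau_inftyPt : cm tau inftyPt = inftyPt :=
  (Homeomorph.symm_apply_eq _).2 ((halfTwist_inftyPt 1).trans (halfTwist_inftyPt 0).symm)

/-- The images of the classes `arc j` under `τ`. -/
noncomputable def tauArc (j : ZMod 7) : Hom zeroPt inftyPt :=
  if j = 0 then arc 6 ≫ inv (arc 0) ≫ arc 1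
  else if j = 1 then arc 2 ≫ inv (arc 1) ≫ arc 6 ≫ inv (arc 0) ≫ arc 1
  else arc j

theorem push_tau_arc (j : ZMod 7) : push (cm tau) tau_zeroPt tau_inftyPt (arc j) = tauArc j := by
  have h0 : cm (halfTwist 0)⁻¹ zeroPt = zeroPt :=
    (Homeomorph.symm_apply_eq _).2 (halfTwist_zeroPt 0).symm
  have hi : cm (halfTwist 0)⁻¹ inftyPt = inftyPt :=
    (Homeomorph.symm_apply_eq _).2 (halfTwist_inftyPt 0).symm
  have hinv : ∀ j, push (cm (halfTwist 0)⁻¹) h0 hi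
      (push (cm (halfTwist 0)) (halfTwist_zeroPt 0) (halfTwist_inftyPt 0) (arc j)) = arc j :=
    fun j => by
      rw [push_push]
      exact push_of_eq_id _ (fun x => (halfTwist 0).symm_apply_apply x) _
  have hne : ∀ j : ZMod 7, j ≠ 0 → push (cm (halfTwist 0)⁻¹) h0 hi (arc j) = arc j :=
    fun j hj => by
      have := hinv j
      rwa [push_halfTwist, if_neg hj] at this
  have hzero : push (cm (halfTwist 0)⁻¹) h0 hi (arc 0) = arc 6 ≫ inv (arc 0) ≫ arc 1 := by
    have h := hinv 0
    rw [push_halfTwist, if_pos rfl, show (0 + 1 : ZMod 7) = 1 from rfl,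
      show (0 - 1 : ZMod 7) = 6 from rfl, push_comp _ h0 hi hi, push_comp _ hi h0 hi, push_inv,
      hne 1 (by decide), hne 6 (by decide)] at h
    generalize push (cm (halfTwist 0)⁻¹) h0 hi (arc 0) = γ at h ⊢
    rw [← h]
    simp
  have e : push (cm tau) tau_zeroPt tau_inftyPt (arc j) = push (cm (halfTwist 0)⁻¹) h0 hi
      (push (cm (halfTwist 1)) (halfTwist_zeroPt 1) (halfTwist_inftyPt 1) (arc j)) :=
    (push_push (cm (halfTwist 1)) (cm (halfTwist 0)⁻¹) (halfTwist_zeroPt 1) (halfTwist_inftyPt 1)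
      h0 hi (arc j)).symm
  rw [e, push_halfTwist, tauArc]
  by_cases h1 : j = 1
  · subst h1
    rw [if_pos rfl, if_neg (by decide), if_pos rfl, show (1 + 1 : ZMod 7) = 2 from rfl,
      show (1 - 1 : ZMod 7) = 0 from rfl, push_comp _ h0 hi hi, push_comp _ hi h0 hi, push_inv,
      hne 1 (by decide), hne 2 (by decide), hzero]
  · rw [if_neg h1, if_neg h1]
    split_ifs with h2
    · rw [h2, hzero]
    · exact hne j h2

theorem tauRho_zeroPt : cm (tau * rho) zeroPt = zeroPt :=
  (congrArg (cm tau) (rot_zeroPt 3)).trans tau_zeroPt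

theorem tauRho_inftyPt : cm (tau * rho) inftyPt = inftyPt :=
  (congrArg (cm tau) (rot_inftyPt 3)).trans tau_inftyPt

theorem push_tauRho_arc (j : ZMod 7) :
    push (cm (tau * rho)) tauRho_zeroPt tauRho_inftyPt (arc j) = tauArc (j + 3) := by
  rw [← push_tau_arc, ← push_rot_arc, push_push]
  rfl

theorem letter_loop (k : ZMod 7) : letter (Sum.inl k, true) = arc k ≫ inv (arc (k - 1)) := rfl

theorem letter_loop_rev (k : ZMod 7) : letter (Sum.inl k, false) = arc (k - 1) ≫ inv (arc k) := rfl

/-- The classes of the nine branches. -/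
theorem letter_inr (i : Fin 9) : letter (Sum.inr i, true) =
    if i = 0 then arc 4 ≫ inv (arc 5) else if i = 5 then arc 1 ≫ inv (arc 2) else 𝟙 _ := by
  have h4 : ((lowEnd 0 + 1 : ℤ) : ZMod 7) = 4 := by decide
  have h5 : ((lowEnd 0 + 2 : ℤ) : ZMod 7) = 5 := by decide
  have h1 : ((lowEnd 5 + 1 : ℤ) : ZMod 7) = 1 := by decide
  have h2 : ((lowEnd 5 + 2 : ℤ) : ZMod 7) = 2 := by decide
  by_cases hi0 : i = 0
  · subst hi0
    rw [letter, if_neg (by simp [bulge]), if_pos rfl]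
    simp only [h4, h5]
  by_cases hi5 : i = 5
  · subst hi5
    rw [letter, if_neg (by simp [bulge]), if_neg (by decide), if_pos rfl]
    simp only [h1, h2]
  rw [letter, if_neg hi0, if_neg hi5, if_pos]
  revert i
  simp [Fin.forall_fin_succ, bulge]

theorem letter_inr_rev (i : Fin 9) : letter (Sum.inr i, false) = inv (letter (Sum.inr i, true)) :=
  letter_rev (Sum.inr i, true)

theorem forall_zmod_seven {P : ZMod 7 → Prop} (h0 : P 0) (h1 : P 1) (h2 : P 2) (h3 : P 3) (h4 : P 4)
    (h5 : P 5) (h6 : P 6) (k : ZMod 7) : P k := by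
  fin_cases k <;> assumption

theorem zmod_seven_sub_one : (0 - 1 : ZMod 7) = 6 ∧ (1 - 1 : ZMod 7) = 0 ∧ (2 - 1 : ZMod 7) = 1 ∧
    (3 - 1 : ZMod 7) = 2 ∧ (4 - 1 : ZMod 7) = 3 ∧ (5 - 1 : ZMod 7) = 4 ∧ (6 - 1 : ZMod 7) = 5 := by
  decide

theorem zmod_seven_add_three : (0 + 3 : ZMod 7) = 3 ∧ (1 + 3 : ZMod 7) = 4 ∧ (2 + 3 : ZMod 7) = 5 ∧
    (3 + 3 : ZMod 7) = 6 ∧ (4 + 3 : ZMod 7) = 0 ∧ (5 + 3 : ZMod 7) = 1 ∧ (6 + 3 : ZMod 7) = 2 := by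
  decide

section push_letter

variable {φ : S ≃ₜ S} {h0 : cm φ zeroPt = zeroPt} {hi : cm φ inftyPt = inftyPt}
  {E : ZMod 7 → Hom zeroPt inftyPt}

theorem push_letter_loop (hE : ∀ j, push (cm φ) h0 hi (arc j) = E j) (k : ZMod 7) :
    push (cm φ) h0 h0 (letter (Sum.inl k, true)) = E k ≫ inv (E (k - 1)) := by
  rw [letter_loop, push_comp _ _ hi _, push_inv, hE, hE]

theorem push_letter_inr (hE : ∀ j, push (cm φ) h0 hi (arc j) = E j) (i : Fin 9) :
    push (cm φ) h0 h0 (letter (Sum.inr i, true)) =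
      if i = 0 then E 4 ≫ inv (E 5) else if i = 5 then E 1 ≫ inv (E 2) else 𝟙 _ := by
  rw [letter_inr]
  split_ifs
  · rw [push_comp _ _ hi _, push_inv, hE, hE]
  · rw [push_comp _ _ hi _, push_inv, hE, hE]
  · rw [push_id]

end push_letter

theorem stronglyInvariant_tau : StronglyInvariant tau matA := by
  rw [← mat_tauEdgeMap]
  -- The ends of the branches at the switches 0 and 2 are turned about a puncture.
  refine tauEdgeMap.stronglyInvariant isSmooth_tauEdgeMap isBalanced_tauEdgeMap tau tau_zeroPt
    (fun v => if v = 0 then arc 6 ≫ inv (arc 0) else if v = 2 then arc 2 ≫ inv (arc 1) else 𝟙 _) ?_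
  obtain ⟨s0, -, s2, s3, s4, s5, s6⟩ := zmod_seven_sub_one
  rintro (k | i)
  · rw [push_letter_loop push_tau_arc]
    revert k
    refine forall_zmod_seven ?_ ?_ ?_ ?_ ?_ ?_ ?_ <;>
      simp +decide [tauArc, word, EdgeMap.image, letter_loop, tauEdgeMap, s0, s2, s3, s4, s5, s6]
  · rw [push_letter_inr push_tau_arc]
    fin_cases i <;>
      simp +decide [tauArc, word, EdgeMap.image, letter_loop, letter_loop_rev, letter_inr,
        letter_inr_rev, tauEdgeMap, s0, s2]

theorem stronglyInvariant_tau_mul_rho : StronglyInvariant (tau * rho) matM := by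
  rw [← mat_tauRhoEdgeMap]
  -- The switches 4 and 6 are the preimages of 0 and 2 under the rotation.
  refine tauRhoEdgeMap.stronglyInvariant isSmooth_tauRhoEdgeMap isBalanced_tauRhoEdgeMap
    (tau * rho) tauRho_zeroPt
    (fun v => if v = 4 then arc 6 ≫ inv (arc 0) else if v = 6 then arc 2 ≫ inv (arc 1) else 𝟙 _) ?_
  obtain ⟨s0, -, s2, s3, s4, s5, s6⟩ := zmod_seven_sub_one
  obtain ⟨a0, a1, a2, a3, -, -, a6⟩ := zmod_seven_add_three
  rintro (k | i)
  · rw [push_letter_loop push_tauRho_arc]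
    revert k
    refine forall_zmod_seven ?_ ?_ ?_ ?_ ?_ ?_ ?_ <;>
      simp +decide [tauArc, word, EdgeMap.image, letter_loop, tauRhoEdgeMap, tauEdgeMap, s0, s2, s3,
        s4, s5, s6, a0, a1, a2, a3, a6]
  · rw [push_letter_inr push_tauRho_arc]
    fin_cases i <;>
      simp +decide [tauArc, word, EdgeMap.image, letter_loop, letter_loop_rev, letter_inr,
        letter_inr_rev, tauRhoEdgeMap, s0, s2, a1, a2]

/-! ### The curve `γ_0` -/

theorem coe_gammaZero (s : I) :
    (gammaZero s).1 = ((polar (gammaModulus s) (gammaAngle s) : ℂ) : OnePoint ℂ) := rfl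

theorem gammaModulus_pos (s : ℝ) : 0 < gammaModulus s := by
  have h1 := Real.neg_one_le_sin (2 * Real.pi * s)
  have h2 := Real.sin_le_one (2 * Real.pi * s)
  unfold gammaModulus
  nlinarith

/-- The curve is determined at each point by the cosine, which is read off the angle, and the sine,
which is read off the modulus; so it is a simple closed curve. -/
theorem gammaZero_inj (s t : I) (h : gammaZero s = gammaZero t) :
    s = t ∨ ((s = 0 ∨ s = 1) ∧ (t = 0 ∨ t = 1)) := by
  obtain ⟨hm, n, hn⟩ := exists_eq_of_polar_eq (gammaModulus_pos s) (gammaModulus_pos t)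
    (OnePoint.coe_injective (congrArg Subtype.val h))
  have hpi := Real.pi_pos
  have a1 := Real.sin_sq_add_cos_sq (2 * Real.pi * s)
  have a2 := Real.sin_sq_add_cos_sq (2 * Real.pi * t)
  have b1 := Real.neg_one_le_cos (2 * Real.pi * s)
  have b2 := Real.cos_le_one (2 * Real.pi * s)
  have b3 := Real.neg_one_le_cos (2 * Real.pi * t)
  have b4 := Real.cos_le_one (2 * Real.pi * t)
  unfold gammaModulus at hm
  unfold gammaAngle at hn
  have hn0 : n = 0 := by
    have h1 : (n : ℝ) < (1 : ℤ) := by push_cast; linarith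
    have h2 : ((-1 : ℤ) : ℝ) < n := by push_cast; linarith
    have h1' : n < 1 := by exact_mod_cast h1
    have h2' : -1 < n := by exact_mod_cast h2
    omega
  rw [hn0] at hn
  have hc : Real.cos (2 * Real.pi * s) = Real.cos (2 * Real.pi * t) := by push_cast at hn; linarith
  rw [hc] at a1
  have hs : Real.sin (2 * Real.pi * s) = Real.sin (2 * Real.pi * t) := by linarith
  obtain ⟨k, hk⟩ := Real.Angle.angle_eq_iff_two_pi_dvd_sub.1 (Real.Angle.cos_sin_inj hc hs)
  have hk' : (s : ℝ) - t = k := by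
    have h1 : 2 * Real.pi * ((s : ℝ) - t) = 2 * Real.pi * k := by linarith
    exact mul_left_cancel₀ (by positivity) h1
  have hs := s.2
  have ht := t.2
  have h1 : ((-1 : ℤ) : ℝ) ≤ k := by push_cast; linarith [hs.1, ht.2]
  have h2 : (k : ℝ) ≤ (1 : ℤ) := by push_cast; linarith [hs.2, ht.1]
  have h1' : -1 ≤ k := by exact_mod_cast h1
  have h2' : k ≤ 1 := by exact_mod_cast h2
  obtain rfl | rfl | rfl : k = -1 ∨ k = 0 ∨ k = 1 := by omega
  · push_cast at hk'
    exact Or.inr ⟨Or.inl (Subtype.ext (by change (s : ℝ) = 0; linarith [hs.1, ht.2])),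
      Or.inr (Subtype.ext (by change (t : ℝ) = 1; linarith [hs.1, ht.2]))⟩
  · push_cast at hk'
    exact Or.inl (Subtype.ext (by linarith))
  · push_cast at hk'
    exact Or.inr ⟨Or.inr (Subtype.ext (by change (s : ℝ) = 1; linarith [hs.2, ht.1])),
      Or.inl (Subtype.ext (by change (t : ℝ) = 0; linarith [hs.2, ht.1]))⟩

/-- Where the curve meets the ray through a puncture, in terms of the sine `x` and the cosine. -/
theorem eq_of_gammaAngle_eq {s : ℝ} {n : ℤ} (h : gammaAngle s = n) :
    (n = 0 ∨ n = 1 ∨ n = 2) ∧ Real.cos (2 * Real.pi * s) = 4 / 5 * (n - 1) ∧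
      Real.sin (2 * Real.pi * s) ^ 2 = 1 - 16 / 25 * (n - 1) ^ 2 := by
  have a := Real.sin_sq_add_cos_sq (2 * Real.pi * s)
  have b1 := Real.neg_one_le_cos (2 * Real.pi * s)
  have b2 := Real.cos_le_one (2 * Real.pi * s)
  unfold gammaAngle at h
  have hc : Real.cos (2 * Real.pi * s) = 4 / 5 * (n - 1) := by linarith
  refine ⟨?_, hc, ?_⟩
  · have h1 : (n : ℝ) < (3 : ℤ) := by push_cast; linarith
    have h2 : ((-1 : ℤ) : ℝ) < n := by push_cast; linarith
    have h1' : n < 3 := by exact_mod_cast h1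
    have h2' : -1 < n := by exact_mod_cast h2
    omega
  · rw [hc] at a; linarith

theorem gammaModulus_eq (s : ℝ) : gammaModulus s = 1 + Real.sin (2 * Real.pi * s) *
    (2 / 5 - 1 / 2 * Real.sin (2 * Real.pi * s)) := by
  unfold gammaModulus; ring

theorem sin_nonneg_of_le_half {s : ℝ} (h0 : 0 ≤ s) (h1 : s ≤ 1 / 2) :
    0 ≤ Real.sin (2 * Real.pi * s) := by
  have hpi := Real.pi_pos
  exact Real.sin_nonneg_of_nonneg_of_le_pi (by positivity) (by nlinarith)

theorem cos_le_cos_of_le_half {s t : ℝ} (h0 : 0 ≤ s) (hst : s ≤ t) (h1 : t ≤ 1 / 2) :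
    Real.cos (2 * Real.pi * t) ≤ Real.cos (2 * Real.pi * s) := by
  have hpi := Real.pi_pos
  exact Real.cos_le_cos_of_nonneg_of_le_pi (by positivity) (by nlinarith) (by nlinarith)

theorem cos_sixth : Real.cos (2 * Real.pi * (1 / 6)) = 1 / 2 := by
  rw [← Real.cos_pi_div_three]; congr 1; ring

theorem cos_third : Real.cos (2 * Real.pi * (1 / 3)) = -(1 / 2) := by
  rw [← Real.cos_pi_div_three, ← Real.cos_pi_sub]; congr 1; ring

theorem cos_half : Real.cos (2 * Real.pi * (1 / 2)) = -1 := by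
  rw [← Real.cos_pi]; congr 1; ring

theorem inBack_gammaZero {s : I} (hs : (s : ℝ) ≤ 1 / 2) (h : (s : ℝ) ≤ 1 / 6 ∨ 1 / 3 ≤ (s : ℝ)) :
    InBack (gammaZero s) := by
  refine inBack_polar (coe_gammaZero s) (gammaModulus_pos s) fun n hn => ?_
  obtain ⟨hn', hc, hx⟩ := eq_of_gammaAngle_eq hn
  have hx0 := sin_nonneg_of_le_half s.2.1 hs
  have hn1 : n ≠ 1 := by
    rintro rfl
    norm_num at hc
    rcases h with h | h
    · have := cos_le_cos_of_le_half s.2.1 h (by norm_num)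
      rw [cos_sixth, hc] at this; linarith
    · have := cos_le_cos_of_le_half (by norm_num) h hs
      rw [cos_third, hc] at this; linarith
  have hx' : Real.sin (2 * Real.pi * s) ^ 2 = (3 / 5) ^ 2 := by
    rcases hn' with rfl | rfl | rfl
    · rw [hx]; norm_num
    · exact absurd rfl hn1
    · rw [hx]; norm_num
  rw [gammaModulus_eq, (sq_eq_sq₀ hx0 (by norm_num)).1 hx']
  norm_num

theorem inFront_gammaZero {s : I} (h : (1 / 6 ≤ (s : ℝ) ∧ (s : ℝ) ≤ 1 / 3) ∨ 1 / 2 ≤ (s : ℝ)) :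
    InFront (gammaZero s) := by
  refine inFront_polar (coe_gammaZero s) (gammaModulus_pos s).le fun n hn => ?_
  obtain ⟨hn', hc, hx⟩ := eq_of_gammaAngle_eq hn
  rw [gammaModulus_eq]
  rcases h with ⟨h1, h2⟩ | h
  · have hx0 := sin_nonneg_of_le_half s.2.1 (by linarith)
    have c1 := cos_le_cos_of_le_half (by norm_num) h1 (by linarith)
    have c2 := cos_le_cos_of_le_half s.2.1 h2 (by norm_num)
    rw [cos_sixth, hc] at c1
    rw [cos_third, hc] at c2
    have hx' : Real.sin (2 * Real.pi * s) ^ 2 = 1 ^ 2 := by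
      rcases hn' with rfl | rfl | rfl
      · norm_num at c2
      · rw [hx]; norm_num
      · norm_num at c1
    rw [(sq_eq_sq₀ hx0 zero_le_one).1 hx']
    norm_num
  · have hpi := Real.pi_pos
    have hx0 : Real.sin (2 * Real.pi * s) ≤ 0 := by
      have h1 := sin_nonneg_of_le_half (s := s - 1 / 2) (by linarith) (by linarith [s.2.2])
      have h2 : 2 * Real.pi * ((s : ℝ) - 1 / 2) = 2 * Real.pi * s - Real.pi := by ring
      rw [h2, Real.sin_sub_pi] at h1
      linarith
    have hx1 : Real.sin (2 * Real.pi * s) ≠ 0 := by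
      intro h0
      rw [h0] at hx
      rcases hn' with rfl | rfl | rfl <;> norm_num at hx
    have hx2 := lt_of_le_of_ne hx0 hx1
    nlinarith

theorem inSector_gammaZero {s : I} {c : ℝ} (hc : Real.cos (2 * Real.pi * s) = c) (n : ℤ)
    {k : ZMod 7} (hk : (n : ZMod 7) = k) (h1 : n < 1 + 5 / 4 * c) (h2 : 1 + 5 / 4 * c < n + 1) :
    InSector k (gammaZero s) :=
  ⟨n, _, _, hk, gammaModulus_pos s, by rwa [gammaAngle, hc], by rwa [gammaAngle, hc],
    coe_gammaZero s⟩

theorem gammaZero_one : gammaZero 1 = gammaZero 0 := by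
  refine Subtype.ext ?_
  rw [coe_gammaZero, coe_gammaZero]
  simp [gammaModulus, gammaAngle]

/-- The curve `γ_0` as a closed path. -/
noncomputable def gammaPath : Path (gammaZero 0) (gammaZero 0) := ⟨gammaZero, rfl, gammaZero_one⟩

theorem inSector_gammaZero_zero : InSector 2 (gammaZero 0) :=
  inSector_gammaZero (c := 1) (by simp) 2 rfl (by norm_num) (by norm_num)

theorem front_comp_of_subpath {x y : S} (p : Path x y) (hx : InFront x) (hy : InFront y)
    {h0 : InFront (p 0)} {h1 : InFront (p 1)} {ω : Hom zeroPt zeroPt}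
    (h : front h0 ≫ cls (p.subpath 0 1) = ω ≫ front h1) : front hx ≫ cls p = ω ≫ front hy := by
  obtain ⟨c, rfl, rfl⟩ := p
  rw [Path.subpath_zero_one] at h
  exact h

/-- From the ray between `p_2` and `p_3`, the curve passes behind `p_2`, to the front between `p_1`
and `p_2`, to the back between `p_0` and `p_1`, behind `p_0`, and returns in the front. -/
theorem cls_gammaPath :
    cls gammaPath = inv (front inSector_gammaZero_zero.inFront) ≫
      (arc 2 ≫ inv (arc 1) ≫ arc 0 ≫ inv (arc 6)) ≫ front inSector_gammaZero_zero.inFront := by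
  have ha : (1 / 6 : ℝ) ∈ I := ⟨by norm_num, by norm_num⟩
  have hb : (1 / 3 : ℝ) ∈ I := ⟨by norm_num, by norm_num⟩
  have hc : (1 / 2 : ℝ) ∈ I := ⟨by norm_num, by norm_num⟩
  obtain ⟨a, haa⟩ : ∃ a : I, (a : ℝ) = 1 / 6 := ⟨⟨_, ha⟩, rfl⟩
  obtain ⟨b, hbb⟩ : ∃ b : I, (b : ℝ) = 1 / 3 := ⟨⟨_, hb⟩, rfl⟩
  obtain ⟨c, hcc⟩ : ∃ c : I, (c : ℝ) = 1 / 2 := ⟨⟨_, hc⟩, rfl⟩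
  have hab : a ≤ b := Subtype.coe_le_coe.1 (by rw [haa, hbb]; norm_num)
  have hbc : b ≤ c := Subtype.coe_le_coe.1 (by rw [hbb, hcc]; norm_num)
  have k0 : InSector 2 (gammaPath 0) := inSector_gammaZero_zero
  have k1 : InSector 2 (gammaPath 1) := gammaPath.target.symm ▸ inSector_gammaZero_zero
  have ka : InSector 1 (gammaPath a) :=
    inSector_gammaZero (c := 1 / 2) (by rw [haa, cos_sixth]) 1 rfl (by norm_num) (by norm_num)
  have kb : InSector 0 (gammaPath b) :=
    inSector_gammaZero (c := -(1 / 2)) (by rw [hbb, cos_third]) 0 rfl (by norm_num) (by norm_num)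
  have kc : InSector 6 (gammaPath c) :=
    inSector_gammaZero (c := -1) (by rw [hcc, cos_half]) (-1) rfl (by norm_num) (by norm_num)
  have e0 := back_comp k0.inBack ka.inBack (gammaPath.subpath 0 a) (subpath_mem gammaPath a.2.1
    fun r _ h => inBack_gammaZero (by linarith [Subtype.coe_le_coe.2 h])
      (Or.inl (by linarith [Subtype.coe_le_coe.2 h])))
  have e1 := front_comp ka.inFront kb.inFront (gammaPath.subpath a b) (subpath_mem gammaPath hab
    fun r h h' => inFront_gammaZero (Or.inl ⟨by linarith [Subtype.coe_le_coe.2 h],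
      by linarith [Subtype.coe_le_coe.2 h']⟩))
  have e2 := back_comp kb.inBack kc.inBack (gammaPath.subpath b c) (subpath_mem gammaPath hbc
    fun r h h' => inBack_gammaZero (by linarith [Subtype.coe_le_coe.2 h'])
      (Or.inr (by linarith [Subtype.coe_le_coe.2 h])))
  have e3 := front_comp kc.inFront k1.inFront (gammaPath.subpath c 1) (subpath_mem gammaPath c.2.2
    fun r h _ => inFront_gammaZero (Or.inr (by linarith [Subtype.coe_le_coe.2 h])))
  have e : front k0.inFront ≫ cls (gammaPath.subpath 0 1) =
      (arc 2 ≫ inv (arc 1) ≫ arc 0 ≫ inv (arc 6)) ≫ front k1.inFront := by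
    rw [← cls_subpath gammaPath 0 a 1, ← cls_subpath gammaPath a b 1, ← cls_subpath gammaPath b c 1,
      front_eq_arc k0 k0.inFront k0.inBack, Category.assoc, ← Category.assoc (back _), e0,
      back_eq_arc ka ka.inFront ka.inBack, Category.assoc, ← Category.assoc (front _), e1,
      front_eq_arc kb kb.inFront kb.inBack, Category.assoc, ← Category.assoc (back _), e2,
      back_eq_arc kc kc.inFront kc.inBack, Category.assoc, e3]
    simp only [Category.assoc]
  exact (IsIso.eq_inv_comp _).2 (front_comp_of_subpath gammaPath _ _ e)

/-- The train path that `γ_0` is homotopic to: around `p_2`, along the ninth branch to `p_0`, around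
`p_0`, and back. -/
def gammaTrainPath : List OBranch :=
  [(Sum.inl 2, true), (Sum.inr 8, false), (Sum.inl 0, true), (Sum.inr 8, true)]

theorem carried_gammaZero : CarriedWithWeights gammaZero (2 • Pi.single 8 1) := by
  obtain ⟨P, hP, hP'⟩ := exists_path_follows (j := 2) (k := 2) (l := gammaTrainPath) (by decide)
    (by decide)
  obtain ⟨c, hc⟩ := exists_cls (inv (front inSector_gammaZero_zero.inFront) ≫ 𝟙 _ ≫ spoke 2)
  obtain ⟨f, hf, hf'⟩ := exists_homotopic_eq_on_graph (E := Unit) (V := Unit)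
    (pos := fun _ => gammaZero 0) (a := fun _ => ()) (b := fun _ => ()) (fun _ => gammaPath)
    (fun _ _ s t h => (gammaZero_inj s t h).imp (fun h => ⟨rfl, h⟩) id)
    (fun _ _ _ => rfl) (ContinuousMap.id S) (pos' := fun _ => switchPt 2) (fun _ => c) (fun _ => P)
    fun _ => by
      rw [← cls_eq_iff]
      refine Eq.trans ?_ (cls_conj hc hP' hc).symm
      have : word gammaTrainPath = arc 2 ≫ inv (arc 1) ≫ arc 0 ≫ inv (arc 6) := by
        obtain ⟨s0, -, s2, -⟩ := zmod_seven_sub_one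
        simp +decide [word, gammaTrainPath, letter_loop, letter_inr, letter_inr_rev, s0, s2]
      rw [this, IsIso.inv_id, Category.id_comp, Category.comp_id]
      exact cls_gammaPath
  refine ⟨f, hf, gammaTrainPath, ⟨by decide, ?_⟩, ?_, ?_⟩
  · rw [gammaTrainPath, Cycle.chain_coe_cons]
    refine List.IsChain.imp (fun a b => continues_iff.2) ?_
    decide
  · have : (fun t => f (gammaZero t)) = P := funext fun t => hf' () t
    rw [this]
    exact hP
  · have h : ∀ i, passes gammaTrainPath (Sum.inr i) = if i = 8 then 2 else 0 := by decide
    intro i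
    rw [h, Pi.smul_apply, Pi.single_apply]
    split_ifs <;> simp

end SevenPuncturedSphere

namespace SevenPuncturedSphere

/-! ### The homeomorphisms `φ_n` and the curves `γ_i` -/

theorem stronglyInvariant_phi {n : ℕ} (hn : 1 ≤ n) :
    StronglyInvariant (phi n) (matA ^ (n - 1) * matM) := by
  obtain ⟨n, rfl⟩ : ∃ k, n = k + 1 := ⟨n - 1, by omega⟩
  rw [Nat.add_sub_cancel, phi, pow_succ, mul_assoc]
  exact stronglyInvariant_tau.pow_mul stronglyInvariant_tau_mul_rho n

/-- The curves `γ_i` are built by composing on the inner side, so the induction is over the tail of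
the sequence of homeomorphisms, for all curves. -/
theorem CarriedWithWeights.phi_prod {r : ℕ → ℕ} (hr : ∀ i, 1 ≤ r (i + 1)) (i : ℕ) {γ : I → S}
    {v : Fin 9 → ℝ} (hγ : CarriedWithWeights γ v) :
    CarriedWithWeights (fun s => Phi r i (γ s))
      (((List.range i).map fun j => matA ^ (r (j + 1) - 1) * matM).prod *ᵥ v) := by
  induction i generalizing γ v with
  | zero => simpa [Phi] using hγ
  | succ i ih =>
    rw [List.range_succ, List.map_append, List.prod_append, ← Matrix.mulVec_mulVec]
    have := ih (hγ.map (stronglyInvariant_phi (hr i)))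
    simpa [Phi] using this

theorem one_le_of_strictly_increasing_differences {r : ℕ → ℕ} (h1 : r 1 = 1) (h2 : r 2 = 2)
    (h : ∀ n : ℕ, 1 ≤ n → (r (n + 1) : ℤ) - r n < (r (n + 2) : ℤ) - r (n + 1)) (i : ℕ) :
    1 ≤ r (i + 1) := by
  have key : 1 ≤ r (i + 1) ∧ (r (i + 1) : ℤ) < r (i + 2) := by
    induction i with
    | zero => simp [h1, h2]
    | succ i ih =>
      have := h (i + 1) (by omega)
      have e : i + 1 + 2 = i + 1 + 1 + 1 := rfl
      rw [e] at this
      constructor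
      · have := ih.1; have := ih.2; rw [show i + 2 = i + 1 + 1 from rfl] at this; omega
      · rw [show i + 1 + 2 = i + 1 + 1 + 1 from rfl]
        have := ih.2; rw [show i + 2 = i + 1 + 1 from rfl] at this; omega
  exact key.1

end SevenPuncturedSphere

theorem mainTheorem9 :
    SevenPuncturedSphere.IsEmbeddedTrack ∧
    (∀ v : Fin 9 → ℝ, (∀ i, 0 ≤ v i) →
      ∃! μ : SevenPuncturedSphere.Branch → ℝ,
        SevenPuncturedSphere.IsTransverse μ ∧ SevenPuncturedSphere.w μ = v) ∧
    SevenPuncturedSphere.InvariantWithMatrix SevenPuncturedSphere.tau SevenPuncturedSphere.matA ∧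
    SevenPuncturedSphere.InvariantWithMatrix
      (SevenPuncturedSphere.tau * SevenPuncturedSphere.rho) SevenPuncturedSphere.matM ∧
    (∀ n : ℕ, 1 ≤ n →
      SevenPuncturedSphere.InvariantWithMatrix (SevenPuncturedSphere.phi n)
        (SevenPuncturedSphere.matA ^ (n - 1) * SevenPuncturedSphere.matM)) ∧
    SevenPuncturedSphere.CarriedWithWeights SevenPuncturedSphere.gammaZero
      (2 • Pi.single 8 1) ∧
    (∀ r : ℕ → ℕ, r 1 = 1 → r 2 = 2 →
      (∀ n : ℕ, 1 ≤ n → (r (n + 1) : ℤ) - r n < (r (n + 2) : ℤ) - r (n + 1)) →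
      ∀ i : ℕ,
        SevenPuncturedSphere.CarriedWithWeights (SevenPuncturedSphere.gamma r i)
          (2 • SevenPuncturedSphere.vec r i)) := by
  refine ⟨SevenPuncturedSphere.isEmbeddedTrack, SevenPuncturedSphere.existsUnique_isTransverse,
    SevenPuncturedSphere.stronglyInvariant_tau.invariantWithMatrix,
    SevenPuncturedSphere.stronglyInvariant_tau_mul_rho.invariantWithMatrix,
    fun n hn => (SevenPuncturedSphere.stronglyInvariant_phi hn).invariantWithMatrix,
    SevenPuncturedSphere.carried_gammaZero, fun r h1 h2 h i => ?_⟩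
  have := SevenPuncturedSphere.carried_gammaZero.phi_prod
    (SevenPuncturedSphere.one_le_of_strictly_increasing_differences h1 h2 h) i
  rw [Matrix.mulVec_smul] at this
  exact this
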